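/- Conventions. In a graph or multigraph $H$, a cut is a set $\emptyset \ne X \subsetneq V(H)$; its size is the number of edges with exactly one end in $X$; a min-cut is a cut of minimum size. A min-cut is non-trivial if neither $X$ nor $V(H)\setminus X$ is a singleton. $\mathcal{C}(G)$ is the set of all min-cuts of $G$ and $\mathcal{NC}(G)$ the set of all non-trivial min-cuts of $G$. A cactus is a 2-edge-connected loopless multigraph in which every edge lies in exactly one cycle (a pair of parallel edges is a cycle of length 2; a single vertex without edges is a cactus). For $\mathcal{S}\subseteq\mathcal{C}(G)$, a cactus representation of $G$ for $\mathcal{S}$ is a cactus $K$ with a map $\varphi:V(G)\to V(K)$ such that (i) every $X\in\mathcal{S}$ equals $\varphi^{-1}(Y)$ for some min-cut $Y$ of $K$, and (ii) $\varphi^{-1}(Y)$ is a min-cut of $G$ for every min-cut $Y$ of $K$. Theorem. There is an algorithm (a word-RAM program) which, for every simple graph $G$ on $n\ge 1$ vertices with minimum degree $\delta$, given any cactus representation $(K,\varphi)$ of $G$ for $\mathcal{C}(G)$ (as $n$, the edge list of $K$ and the table of $\varphi$), computes in time $O(n+|V(K)|+|E(K)|)$, that is, linear in the size of its input, a cactus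 representation $(K',\varphi')$ of $G$ for $\mathcal{NC}(G)$ such that $K'$ has $O(n/\delta)$ vertices; more precisely, if $\delta\ge 1$, then $|V(K')| < 30n/\delta$. The constant in the running time does not depend on $G$ or $(K,\varphi)$, and the program only stores integers that are $O(n+|V(K)|+|E(K)|)$. -/

import Mathlib

/-! ## Cuts, cacti and cactus representations -/

namespace CactusRep

open scoped Graph

/-- The edges of the multigraph `H` with exactly one end in `X`. -/
def cutEdges {α β : Type*} (H : Graph α β) (X : Set α) : Set β :=
  {e | ∃ x ∈ X, ∃ y ∉ X, H.IsLink e x y}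

/-- A cut of `H` is a non-empty proper subset of its vertex set. -/
def IsCut {α β : Type*} (H : Graph α β) (X : Set α) : Prop :=
  X.Nonempty ∧ X ⊂ V(H)

/-- The size of a cut: the number of edges leaving it. -/
noncomputable def cutSize {α β : Type*} (H : Graph α β) (X : Set α) : ℕ∞ :=
  (cutEdges H X).encard

/-- `minCuts H` is the set of all cuts of `H` of minimum size. -/
def minCuts {α β : Type*} (H : Graph α β) : Set (Set α) :=
  {X | IsCut H X ∧ ∀ Y, IsCut H Y → cutSize H X ≤ cutSize H Y}

/-- The minimum cuts for which neither side is a single vertex. -/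
def nontrivialMinCuts {α β : Type*} (H : Graph α β) : Set (Set α) :=
  {X | X ∈ minCuts H ∧ X.encard ≠ 1 ∧ (V(H) \ X).encard ≠ 1}

/-- `C` is the edge set of a cycle of `H`. A cycle has length at least two; one of
length two is a pair of parallel edges. Indices are taken modulo the length `l + 2`. -/
def IsCycle {α β : Type*} (H : Graph α β) (C : Set β) : Prop :=
  ∃ (l : ℕ) (v : Fin (l + 2) → α) (e : Fin (l + 2) → β),
    Function.Injective v ∧ Function.Injective e ∧
      (∀ i, H.IsLink (e i) (v i) (v (i + 1))) ∧ C = Set.range e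

/-- A cactus: a 2-edge-connected multigraph without loops in which every edge lies in
exactly one cycle. The graph with one vertex and no edge is a cactus. -/
structure IsCactus {α β : Type*} (K : Graph α β) : Prop where
  nonempty : V(K).Nonempty
  two_le_cutSize : ∀ X, IsCut K X → 2 ≤ cutSize K X
  loopless : K.Loopless
  existsUnique_cycle : ∀ e ∈ E(K), ∃! C : Set β, IsCycle K C ∧ e ∈ C

/-- `(K, φ)` is a cactus representation of the simple graph `G` for the set `S` of
minimum cuts of `G`. -/
structure IsCactusRepresentation {ν α β : Type*} (G : SimpleGraph ν) (S : Set (Set ν))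
    (K : Graph α β) (φ : ν → α) : Prop where
  isCactus : IsCactus K
  map_mem : ∀ v, φ v ∈ V(K)
  exists_minCut : ∀ X ∈ S, ∃ Y ∈ minCuts K, X = φ ⁻¹' Y
  preimage_mem : ∀ Y ∈ minCuts K, φ ⁻¹' Y ∈ minCuts (Graph.ofSimpleGraph G)

end CactusRep

/-! ## A structured programming language for the word RAM, with running times -/

namespace RAM

/-- A memory state: scalar variables, and arrays with random access. A program names
only finitely many of them. -/
structure State where
  var : ℕ → ℕ
  arr : ℕ → ℕ → ℕ

/-- Assign the value `k` to the scalar variable `x`. -/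
def State.setVar (s : State) (x k : ℕ) : State :=
  { s with var := Function.update s.var x k }

/-- Assign the value `k` to the entry with index `i` of the array `a`. -/
def State.setArr (s : State) (a i k : ℕ) : State :=
  { s with arr := Function.update s.arr a (Function.update (s.arr a) i k) }

/-- Elementary instructions; all of `x y z` name scalar variables, `a` names an array. -/
inductive Instr
  /-- `x := k` -/
  | const (x k : ℕ)
  /-- `x := y` -/
  | copy (x y : ℕ)
  /-- `x := y + z` -/
  | add (x y z : ℕ)
  /-- `x := y - z`, truncated at zero -/
  | sub (x y z : ℕ)
  /-- `x := a[y]` -/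
  | load (x a y : ℕ)
  /-- `a[x] := y` -/
  | store (a x y : ℕ)

/-- The value that an instruction writes. -/
def Instr.value (s : State) : Instr → ℕ
  | .const _ k => k
  | .copy _ y => s.var y
  | .add _ y z => s.var y + s.var z
  | .sub _ y z => s.var y - s.var z
  | .load _ a y => s.arr a (s.var y)
  | .store _ _ y => s.var y

/-- The state after an instruction. -/
def Instr.run (s : State) (i : Instr) : State :=
  match i with
  | .const x _ | .copy x _ | .add x _ _ | .sub x _ _ | .load x _ _ => s.setVar x (i.value s)
  | .store a x _ => s.setArr a (s.var x) (i.value s)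

/-- Tests on scalar variables. -/
inductive Test
  /-- `x < y` -/
  | lt (x y : ℕ)
  /-- `x = y` -/
  | eq (x y : ℕ)

def Test.Holds (s : State) : Test → Prop
  | .lt x y => s.var x < s.var y
  | .eq x y => s.var x = s.var y

/-- Programs. -/
inductive Program
  | skip
  | instr (i : Instr)
  | seq (p q : Program)
  | ite (b : Test) (p q : Program)
  | while (b : Test) (p : Program)

/-- `Exec W p s t s'`: started in the state `s`, the program `p` halts in the state `s'`
after exactly `t` steps, and no value that it writes exceeds `W`. Every elementary
instruction, every evaluation of a test and every `skip` is one step. -/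
inductive Exec (W : ℕ) : Program → State → ℕ → State → Prop
  | skip (s : State) : Exec W .skip s 1 s
  | instr (i : Instr) (s : State) (h : i.value s ≤ W) : Exec W (.instr i) s 1 (i.run s)
  | seq {p q : Program} {s s' s'' : State} {t t' : ℕ}
      (hp : Exec W p s t s') (hq : Exec W q s' t' s'') : Exec W (.seq p q) s (t + t') s''
  | ite_true {b : Test} {p q : Program} {s s' : State} {t : ℕ}
      (hb : b.Holds s) (hp : Exec W p s t s') : Exec W (.ite b p q) s (t + 1) s'
  | ite_false {b : Test} {p q : Program} {s s' : State} {t : ℕ}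
      (hb : ¬ b.Holds s) (hq : Exec W q s t s') : Exec W (.ite b p q) s (t + 1) s'
  | while_true {b : Test} {p : Program} {s s' s'' : State} {t t' : ℕ}
      (hb : b.Holds s) (hp : Exec W p s t s') (hw : Exec W (.while b p) s' t' s'') :
      Exec W (.while b p) s (t + t' + 1) s''
  | while_false {b : Test} {p : Program} {s : State}
      (hb : ¬ b.Holds s) : Exec W (.while b p) s 1 s

end RAM

/-! ## Cactus representations as inputs and outputs of programs -/

namespace CactusRep

/-- A finite multigraph with vertices `0, …, k - 1` and edges `0, …, m - 1`, given by the two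
end vertices of each edge, with a map from `{0, …, n - 1}` to its vertices. -/
structure Data (n : ℕ) where
  k : ℕ
  m : ℕ
  fst : Fin m → Fin k
  snd : Fin m → Fin k
  map : Fin n → Fin k

namespace Data

variable {n : ℕ}

/-- The multigraph that is described by the data. -/
def graph (D : Data n) : Graph (Fin D.k) (Fin D.m) where
  vertexSet := Set.univ
  IsLink e x y := (D.fst e = x ∧ D.snd e = y) ∨ (D.fst e = y ∧ D.snd e = x)
  isLink_symm _ _ := ⟨fun _ _ h => h.symm⟩
  eq_or_eq_of_isLink_of_isLink := by
    rintro e x y v w (⟨rfl, rfl⟩ | ⟨rfl, rfl⟩) (⟨rfl, rfl⟩ | ⟨rfl, rfl⟩) <;> simp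
  left_mem_of_isLink _ _ _ _ := Set.mem_univ _

/-- The number of memory cells, up to a constant, in which the data are stored. -/
def size (D : Data n) : ℕ := n + D.k + D.m

/-- The data are stored in `s`: the three numbers `k`, `m`, `n` in the first three scalar
variables, the lists of first ends, of second ends and of values of the map in the first
three arrays. -/
structure StoredIn (D : Data n) (s : RAM.State) : Prop where
  var_zero : s.var 0 = D.k
  var_one : s.var 1 = D.m
  var_two : s.var 2 = n
  arr_zero : ∀ j : Fin D.m, s.arr 0 j = D.fst j
  arr_one : ∀ j : Fin D.m, s.arr 1 j = D.snd j
  arr_two : ∀ i : Fin n, s.arr 2 i = D.map i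

/-- The state that stores the data, with zeros everywhere else. -/
def toState (D : Data n) : RAM.State where
  var x := if x = 0 then D.k else if x = 1 then D.m else if x = 2 then n else 0
  arr a i :=
    if a = 0 then (if h : i < D.m then D.fst ⟨i, h⟩ else 0)
    else if a = 1 then (if h : i < D.m then D.snd ⟨i, h⟩ else 0)
    else if a = 2 then (if h : i < n then D.map ⟨i, h⟩ else 0)
    else 0

/-- The data are a cactus representation of `G` for `S`. -/
def Represents (D : Data n) (G : SimpleGraph (Fin n)) (S : Set (Set (Fin n))) : Prop :=
  IsCactusRepresentation G S D.graph D.map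

end Data

end CactusRep

/-! A loopless multigraph is a cactus exactly if all its cuts have size at least two and any two
vertices are separated by a cut of size two (`isCactus_iff`), and its min-cuts are then the cuts of
size two (`mem_minCuts_iff`). This description refers to cuts alone, so submodularity applies. It is
stable under contraction: splitting off `x` at a neighbour `z` keeps precisely the two-cuts that
have `x` and `z` on the same side, and these still separate the remaining vertices (`sep_of_link`,
`IsHalfCactus.splice`).

Let the weight of a vertex of the cactus be the number of vertices of `G` mapped to it. Two kinds of
contraction at parallel edges lose no non-trivial min-cut of `G`. If `x` has weight zero and degree
four, then in a two-cut that separates `x` from `z` the vertex `x` can change sides, which does not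
affect the preimage (`keep_of_empty`). If `x` has weight one and both of its edges go to `z`, then
the only two-cuts that separate `x` from `z` are `{x}` and its complement, and they represent a
trivial cut (`keep_of_leaf`). Neither contraction creates a new candidate among the vertices already
treated, so one pass over the vertices for each kind suffices (`SuppressInv.step`, `LeafInv.step`).

The size bound then comes from counting. A two-cut either has all its edges leaving from one vertex
`a`, and then falls apart into `a` and smaller two-cuts hanging at `a`, or it is a disjoint union of
two smaller two-cuts (`exists_pieces`, `exists_split`). Induction along this decomposition gives at
most twice as many vertices as weight (`card_le_two_mul`), which is enough for small minimum degree
`δ`. For `δ ≥ 7`, simplicity of `G` enters: a side of a min-cut has one or at least `δ` vertices,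
and the difference of nested sides has at most two or at least `δ - 1` vertices. A refined induction
(`exists_core`) yields `(δ - 1) * |V(K')| ≤ 11 * n` (`mul_card_le`).

The program is linear because a contraction only changes the mates of the two or four half-edges
that led to the removed vertex; the recorded half-edges at the remaining vertices are never touched.
The output is the quotient of the input cactus by the contraction map, without loops
(`IsQuotient.represents`). The new names of removed vertices are found in reverse order of removal.
-/

namespace HalfEdge

/-! ### Cuts in multigraphs given by half-edges. -/

variable {V H : Type*} [DecidableEq V] [Fintype H]

/-- The number of half-edges that lead from `S` to the outside, where `o` gives the vertex of
a half-edge and `μ` the other half of its edge. -/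
def out (o : H → V) (μ : H → H) (S : Finset V) : ℕ :=
  (Finset.univ.filter fun h => o h ∈ S ∧ o (μ h) ∉ S).card

/-- A multigraph on the vertex set `A`, given by half-edges, in which all cuts have size at
least two and any two vertices are separated by a cut of size two. Loops are allowed. -/
structure IsHalfCactus (o : H → V) (μ : H → H) (A : Finset V) : Prop where
  nonempty : A.Nonempty
  mem : ∀ h, o h ∈ A → o (μ h) ∈ A
  invol : ∀ h, o h ∈ A → μ (μ h) = h
  two_le : ∀ S ⊆ A, S.Nonempty → S ≠ A → 2 ≤ out o μ S
  sep : ∀ x ∈ A, ∀ y ∈ A, x ≠ y → ∃ S ⊆ A, x ∈ S ∧ y ∉ S ∧ out o μ S = 2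

variable {o : H → V} {μ : H → H} {A S T : Finset V}

theorem out_mono_of_imp {T : Finset V}
    (h : ∀ e, o e ∈ S → o (μ e) ∉ S → o e ∈ T ∧ o (μ e) ∉ T) : out o μ S ≤ out o μ T :=
  Finset.card_le_card fun e he => by
    simp only [Finset.mem_filter, Finset.mem_univ, true_and] at he ⊢
    exact h e he.1 he.2

theorem out_submod (o : H → V) (μ : H → H) (S T : Finset V) :
    out o μ (S ∩ T) + out o μ (S ∪ T) ≤ out o μ S + out o μ T := by
  simp only [out, Finset.card_filter, ← Finset.sum_add_distrib]
  refine Finset.sum_le_sum fun h _ => ?_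
  by_cases h1 : o h ∈ S <;> by_cases h2 : o h ∈ T <;> by_cases h3 : o (μ h) ∈ S <;>
    by_cases h4 : o (μ h) ∈ T <;> simp [h1, h2, h3, h4]

namespace IsHalfCactus

theorem out_compl (hA : IsHalfCactus o μ A) (hS : S ⊆ A) : out o μ (A \ S) = out o μ S := by
  refine Finset.card_bij' (fun h _ => μ h) (fun h _ => μ h) ?_ ?_ ?_ ?_ <;> intro h hh <;>
    simp only [Finset.mem_filter, Finset.mem_univ, true_and, Finset.mem_sdiff] at hh ⊢
  · rw [hA.invol h hh.1.1]
    exact ⟨by_contra fun hc => hh.2 ⟨hA.mem h hh.1.1, hc⟩, hh.1.2⟩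
  · rw [hA.invol h (hS hh.1)]
    exact ⟨⟨hA.mem h (hS hh.1), hh.2⟩, fun hc => hc.2 hh.1⟩
  · exact hA.invol h hh.1.1
  · exact hA.invol h (hS hh.1)

theorem out_self (hA : IsHalfCactus o μ A) : out o μ A = 0 := by
  rw [out, Finset.card_eq_zero, Finset.filter_eq_empty_iff]
  exact fun h _ hh => hh.2 (hA.mem h hh.1)

/-- Two crossing cuts of size two have an intersection of size two. -/
theorem out_inter (hA : IsHalfCactus o μ A) (hS : S ⊆ A) (hT : T ⊆ A) (h2 : out o μ S = 2)
    (h2' : out o μ T = 2) (hne : (S ∩ T).Nonempty) (hU : S ∪ T ≠ A) : out o μ (S ∩ T) = 2 := by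
  have h1 := out_submod o μ S T
  have h3 := hA.two_le (S ∪ T) (Finset.union_subset hS hT)
    (hne.mono (Finset.inter_subset_left.trans Finset.subset_union_left)) hU
  have h4 := hA.two_le (S ∩ T) (Finset.inter_subset_left.trans hS) hne ?_
  · omega
  · rintro h
    apply hU
    apply (Finset.union_subset hS hT).antisymm
    rw [← h]
    exact Finset.inter_subset_left.trans Finset.subset_union_left

theorem out_union (hA : IsHalfCactus o μ A) (hS : S ⊆ A) (hT : T ⊆ A) (h2 : out o μ S = 2)
    (h2' : out o μ T = 2) (hne : (S ∩ T).Nonempty) (hU : S ∪ T ≠ A) : out o μ (S ∪ T) = 2 := by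
  have h1 := out_submod o μ S T
  have h5 := hA.out_inter hS hT h2 h2' hne hU
  have h3 := hA.two_le (S ∪ T) (Finset.union_subset hS hT)
    (hne.mono (Finset.inter_subset_left.trans Finset.subset_union_left)) hU
  omega

/-- Disjoint sets that are joined by an edge. -/
theorem out_disjoint_union (hA : IsHalfCactus o μ A) (hS : S ⊆ A)
    (hd : Disjoint S T) {h : H} (h1 : o h ∈ S) (h2 : o (μ h) ∈ T) :
    out o μ (S ∪ T) + 2 ≤ out o μ S + out o μ T := by
  classical
  have hinv := hA.invol h (hS h1)
  have hne : h ≠ μ h := fun hc => by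
    rw [← hc] at h2
    exact Finset.disjoint_left.1 hd h1 h2
  have hs : h ∉ Finset.univ.filter fun e => o e ∈ S ∪ T ∧ o (μ e) ∉ S ∪ T := by
    simp [h2]
  have ht : μ h ∉ Finset.univ.filter fun e => o e ∈ S ∪ T ∧ o (μ e) ∉ S ∪ T := by
    simp [hinv, h1]
  -- The halves `h` and `μ h` of the joining edge are counted on the right but not on the left; this
  -- accounts for the summand two.
  have hcard : out o μ (S ∪ T) + 2 = (insert h (insert (μ h)
      (Finset.univ.filter fun e => o e ∈ S ∪ T ∧ o (μ e) ∉ S ∪ T))).card := by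
    rw [Finset.card_insert_of_notMem, Finset.card_insert_of_notMem ht, out]
    simp only [Finset.mem_insert, not_or]
    exact ⟨hne, hs⟩
  rw [hcard, out, out]
  refine (Finset.card_le_card ?_).trans (Finset.card_union_le _ _)
  intro e he
  simp only [Finset.mem_insert, Finset.mem_filter, Finset.mem_univ, true_and,
    Finset.mem_union, not_or] at he ⊢
  have hd1 : ∀ {y}, y ∈ S → y ∉ T := fun hy => Finset.disjoint_left.1 hd hy
  rcases he with rfl | rfl | he
  · exact Or.inl ⟨h1, fun hc => hd1 hc h2⟩
  · rw [hinv]; exact Or.inr ⟨h2, fun hc => hd1 h1 hc⟩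
  · tauto

/-- Contracting an edge keeps the remaining vertices separated. -/
theorem sep_of_link (hA : IsHalfCactus o μ A) {x z u w : V} {h : H} (hx : x ∈ A)
    (hxh : o h = x) (hzh : o (μ h) = z) (hxz : x ≠ z) (hu : u ∈ A) (hw : w ∈ A) (hux : u ≠ x)
    (hwx : w ≠ x) (huw : u ≠ w) :
    ∃ S ⊆ A, u ∈ S ∧ w ∉ S ∧ out o μ S = 2 ∧ (x ∈ S ↔ z ∈ S) := by
  have hz : z ∈ A := hzh ▸ hA.mem h (hxh ▸ hx)
  -- A vertex other than `x` and `z` can be cut off from both at once. The only bad case is that `P`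
  -- contains `z` and `Q` contains `x`, and then `P ∩ Q` works.
  have key : ∀ u ∈ A, u ≠ x → u ≠ z → ∃ S ⊆ A, u ∈ S ∧ x ∉ S ∧ z ∉ S ∧ out o μ S = 2 := by
    intro u hu hux huz
    obtain ⟨P, hPA, huP, hxP, hP2⟩ := hA.sep u hu x hx hux
    obtain ⟨Q, hQA, huQ, hzQ, hQ2⟩ := hA.sep u hu z hz huz
    by_cases hzP : z ∉ P
    · exact ⟨P, hPA, huP, hxP, hzP, hP2⟩
    by_cases hxQ : x ∉ Q
    · exact ⟨Q, hQA, huQ, hxQ, hzQ, hQ2⟩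
    refine ⟨P ∩ Q, Finset.inter_subset_left.trans hPA, by simp [huP, huQ], by simp [hxP],
      by simp [hzQ], ?_⟩
    by_cases hU : P ∪ Q = A
    -- Submodularity gives nothing when `P ∪ Q` is everything. But then the complements are disjoint
    -- and joined by the edge `h`, so that their union, the complement of `P ∩ Q`, has size at most
    -- two.
    · have hd : Disjoint (A \ P) (A \ Q) := by
        rw [Finset.disjoint_left]
        intro y hy hy'
        have : y ∈ P ∪ Q := hU ▸ (Finset.mem_sdiff.1 hy).1
        rcases Finset.mem_union.1 this with hh | hh
        · exact (Finset.mem_sdiff.1 hy).2 hh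
        · exact (Finset.mem_sdiff.1 hy').2 hh
      have h1 := hA.out_disjoint_union (S := A \ P) (T := A \ Q) (h := h) Finset.sdiff_subset hd
        (by simp [hxh, hx, hxP]) (by simp [hzh, hz, hzQ])
      have h2 : A \ P ∪ A \ Q = A \ (P ∩ Q) := by rw [Finset.sdiff_inter_distrib_right]
      rw [h2, hA.out_compl hPA, hA.out_compl hQA,
        hA.out_compl (Finset.inter_subset_left.trans hPA)] at h1
      have h3 := hA.two_le (P ∩ Q) (Finset.inter_subset_left.trans hPA) ⟨u, by simp [huP, huQ]⟩
        (fun hc => hxP (Finset.inter_subset_left (hc ▸ hx : x ∈ P ∩ Q)))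
      omega
    · exact hA.out_inter hPA hQA hP2 hQ2 ⟨u, by simp [huP, huQ]⟩ hU
  by_cases huz : u = z
  · subst huz
    obtain ⟨S, hSA, h1, h2, h3, h4⟩ := key w hw hwx huw.symm
    refine ⟨A \ S, Finset.sdiff_subset, by simp [hu, h3], by simp [h1], ?_, by simp [*]⟩
    rw [hA.out_compl hSA, h4]
  by_cases hwz : w = z
  · subst hwz
    obtain ⟨S, hSA, h1, h2, h3, h4⟩ := key u hu hux huw
    exact ⟨S, hSA, h1, h3, h4, by simp [*]⟩
  obtain ⟨P, hPA, huP, hxP, hzP, hP2⟩ := key u hu hux huz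
  by_cases hwP : w ∉ P
  · exact ⟨P, hPA, huP, hwP, hP2, by simp [*]⟩
  push Not at hwP
  obtain ⟨S, hSA, huS, hwS, hS2⟩ := hA.sep u hu w hw huw
  by_cases hxz' : x ∈ S ↔ z ∈ S
  · exact ⟨S, hSA, huS, hwS, hS2, hxz'⟩
  -- If `S` splits the pair `x`, `z`, intersecting with `P` puts both outside. One of them lies in
  -- neither set, so the union is not all of `A`.
  refine ⟨P ∩ S, Finset.inter_subset_left.trans hPA, by simp [huP, huS], by simp [hwS], ?_,
    by simp [hxP, hzP]⟩
  refine hA.out_inter hPA hSA hP2 hS2 ⟨u, by simp [huP, huS]⟩ fun hU => ?_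
  have h1 : x ∈ P ∪ S := hU ▸ hx
  have h2 : z ∈ P ∪ S := hU ▸ hz
  simp only [Finset.mem_union, hxP, hzP, false_or] at h1 h2
  exact hxz' ⟨fun _ => h2, fun _ => h1⟩

/-- A double edge does not lie in a triangle, and there is no triple edge. -/
theorem no_third_path (hA : IsHalfCactus o μ A) {x z q : V} {h₀ h₁ e f : H} (hx : x ∈ A)
    (hxz : x ≠ z) (hne : h₀ ≠ h₁) (hx₀ : o h₀ = x) (hx₁ : o h₁ = x) (hz₀ : o (μ h₀) = z)
    (hz₁ : o (μ h₁) = z) (he : o e = x) (heq : o (μ e) = q)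
    (hf : q ≠ z → o f = q ∧ o (μ f) = z) (hqz : q = z → e ≠ h₀ ∧ e ≠ h₁) (hqx : q ≠ x) : False := by
  classical
  have hz : z ∈ A := hz₀ ▸ hA.mem h₀ (hx₀ ▸ hx)
  have hq : q ∈ A := heq ▸ hA.mem e (he ▸ hx)
  -- The two parallel edges use up both edges of a two-cut between `x` and `z`, so no further path
  -- from `x` to `z` can cross it.
  obtain ⟨S, hSA, hxS, hzS, hS2⟩ := hA.sep x hx z hz hxz
  have h3 : ∀ g, g ≠ h₀ → g ≠ h₁ → o g ∈ S → o (μ g) ∉ S → False := by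
    intro g hg0 hg1 hgS hgS'
    have : ({g, h₀, h₁} : Finset H) ⊆ Finset.univ.filter fun h => o h ∈ S ∧ o (μ h) ∉ S := by
      intro e he
      simp only [Finset.mem_insert, Finset.mem_singleton] at he
      rcases he with rfl | rfl | rfl <;> simp [*]
    have h4 := Finset.card_le_card this
    rw [Finset.card_eq_three.2 ⟨g, h₀, h₁, hg0, hg1, hne, rfl⟩] at h4
    rw [out] at hS2
    omega
  by_cases hqS : q ∈ S
  · obtain ⟨hf, hfz⟩ := hf fun hc => hzS (hc ▸ hqS)
    refine h3 f ?_ ?_ (hf ▸ hqS) (hfz ▸ hzS)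
    · rintro rfl; exact hqx (hf.symm.trans hx₀)
    · rintro rfl; exact hqx (hf.symm.trans hx₁)
  · by_cases hqz' : q = z
    · exact h3 e (hqz hqz').1 (hqz hqz').2 (he ▸ hxS) (heq ▸ hqS)
    · refine h3 e ?_ ?_ (he ▸ hxS) (heq ▸ hqS)
      · rintro rfl; exact hqz' (heq.symm.trans hz₀)
      · rintro rfl; exact hqz' (heq.symm.trans hz₁)

end IsHalfCactus

/-! ### Splitting off a vertex as contraction. -/

/-- Split off the vertex `x`: half-edges that lead to `x` are joined as prescribed by the
pairing `σ` of the half-edges at `x`. -/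
def splice (o : H → V) (μ : H → H) (x : V) (σ : H → H) (g : H) : H :=
  if o (μ g) = x then μ (σ (μ g)) else μ g

/-- `σ` pairs the half-edges at `x`, and one half-edge of every pair leads to `z`. -/
structure IsPairing (o : H → V) (μ : H → H) (x z : V) (σ : H → H) : Prop where
  owner : ∀ h, o h = x → o (σ h) = x
  invol : ∀ h, o h = x → σ (σ h) = h
  link : ∀ h, o h = x → o (μ h) = z ∨ o (μ (σ h)) = z

variable {x z : V} {σ : H → H}

/-- An edge from `S` to `x` is redirected to `z`: in its pair one half leads to `z`, and this is not
the half that leads into `S`. Both `x` and `z` are outside `S`, so the edge leaves `S` before and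
after. -/
theorem out_splice_of_notMem (hA : IsHalfCactus o μ A) (hσ : IsPairing o μ x z σ)
    (hS : S ⊆ A.erase x) (hzS : z ∉ S) : out o (splice o μ x σ) S = out o μ S := by
  unfold out
  congr 1
  apply Finset.filter_congr
  intro h _
  refine and_congr_right fun hh => ?_
  have hxS : x ∉ S := fun hc => by simpa using hS hc
  have hA' : o h ∈ A := Finset.mem_of_mem_erase (hS hh)
  unfold splice
  split_ifs with hx
  · rcases hσ.link (μ h) hx with h1 | h1
    · rw [hA.invol h hA'] at h1
      exact absurd (h1 ▸ hh) hzS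
    · simp [h1, hx, hzS, hxS]
  · rfl

theorem IsPairing.splice_mem (hA : IsHalfCactus o μ A) (hσ : IsPairing o μ x z σ)
    (hlx : ∀ h, o h = x → o (μ h) ≠ x) (h : H) (hh : o h ∈ A.erase x) :
    o (splice o μ x σ h) ∈ A.erase x ∧ splice o μ x σ (splice o μ x σ h) = h := by
  have hA' : o h ∈ A := Finset.mem_of_mem_erase hh
  have hm := hA.mem h hA'
  rw [Finset.mem_erase] at hh ⊢
  unfold splice
  split_ifs with hx h1 h1
  · have h2 := hσ.owner _ hx
    refine ⟨⟨hlx _ h2, hA.mem _ (h2 ▸ hx ▸ hm)⟩, ?_⟩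
    rw [hA.invol _ (h2 ▸ hx ▸ hm), hσ.invol _ hx, hA.invol h hA']
  · exfalso
    apply h1
    have h2 := hσ.owner _ hx
    rw [hA.invol _ (h2 ▸ hx ▸ hm), h2]
  · exact absurd (by rwa [hA.invol h hA'] at h1) hh.1
  · exact ⟨⟨hx, hm⟩, hA.invol h hA'⟩

/-- If `z` is in `T`, pass to the complement, which avoids `z`. This is legitimate on both sides
because the spliced mates again form an involution on `A.erase x`. -/
theorem out_splice (hA : IsHalfCactus o μ A) (hσ : IsPairing o μ x z σ)
    (hlx : ∀ h, o h = x → o (μ h) ≠ x)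
    (hT : T ⊆ A) (hxT : x ∈ T ↔ z ∈ T) :
    out o (splice o μ x σ) (T.erase x) = out o μ T := by
  have hTe : T.erase x ⊆ A.erase x := Finset.erase_subset_erase x hT
  by_cases hzT : z ∈ T
  · rw [← hA.out_compl hT]
    have hsub : A \ T ⊆ A.erase x := by
      intro y hy
      rw [Finset.mem_sdiff] at hy
      rw [Finset.mem_erase]
      exact ⟨fun hc => hy.2 (hc ▸ hxT.2 hzT), hy.1⟩
    rw [← out_splice_of_notMem hA hσ hsub (by simp [hzT])]
    have hbij : ∀ (μ' : H → H), (∀ h, o h ∈ A.erase x → o (μ' h) ∈ A.erase x ∧ μ' (μ' h) = h) →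
        out o μ' (T.erase x) = out o μ' (A \ T) := by
      intro μ' hμ'
      have hiff : ∀ y ∈ A.erase x, y ∈ A \ T ↔ y ∉ T.erase x := by
        intro y hy
        rw [Finset.mem_erase] at hy
        simp [hy.1, hy.2]
      refine Finset.card_bij' (fun h _ => μ' h) (fun h _ => μ' h) ?_ ?_ ?_ ?_ <;> intro h hh <;>
        simp only [Finset.mem_filter, Finset.mem_univ, true_and] at hh ⊢
      · obtain ⟨h1, h2⟩ := hμ' h (hTe hh.1)
        rw [h2, hiff _ h1, hiff _ (hTe hh.1)]
        exact ⟨hh.2, fun hc => hc hh.1⟩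
      · obtain ⟨h1, h2⟩ := hμ' h (hsub hh.1)
        rw [hiff _ h1, not_not] at hh
        rw [h2]
        exact ⟨hh.2, (hiff _ (hsub hh.1)).1 hh.1⟩
      · exact (hμ' h (hTe hh.1)).2
      · exact (hμ' h (hsub hh.1)).2
    exact hbij _ fun h hh => hσ.splice_mem hA hlx h hh
  · have hxT' : x ∉ T := fun hc => hzT (hxT.1 hc)
    rw [Finset.erase_eq_of_notMem hxT'] at hTe ⊢
    exact out_splice_of_notMem hA hσ hTe hzT

/-- Splitting off a vertex `x` is the contraction of the edges between `x` and `z`. -/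
theorem IsHalfCactus.splice (hA : IsHalfCactus o μ A) (hσ : IsPairing o μ x z σ) (hxz : x ≠ z)
    (hlx : ∀ h, o h = x → o (μ h) ≠ x) (hx : x ∈ A) {h : H} (hh : o h = x)
    (hhz : o (μ h) = z) : IsHalfCactus o (splice o μ x σ) (A.erase x) where
  nonempty := ⟨z, by simp [hxz.symm, hhz ▸ hA.mem h (hh ▸ hx)]⟩
  mem h hh := (hσ.splice_mem hA hlx h hh).1
  invol h hh := (hσ.splice_mem hA hlx h hh).2
  two_le S hS hne hne' := by
    have hz : z ∈ A := hhz ▸ hA.mem h (hh ▸ hx)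
    have hxS : x ∉ S := fun hc => by simpa using hS hc
    by_cases hzS : z ∈ S
    · have h1 := out_splice hA hσ hlx (T := insert x S)
        (Finset.insert_subset hx (hS.trans (Finset.erase_subset _ _))) (by simp [hzS])
      rw [Finset.erase_insert hxS] at h1
      rw [h1]
      refine hA.two_le _ (Finset.insert_subset hx (hS.trans (Finset.erase_subset _ _))) (by simp)
        fun hc => hne' ?_
      rw [← hc, Finset.erase_insert hxS]
    · have h1 := out_splice hA hσ hlx (T := S)
        (hS.trans (Finset.erase_subset _ _)) (by simp [hzS, hxS])
      rw [Finset.erase_eq_of_notMem hxS] at h1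
      rw [h1]
      exact hA.two_le _ (hS.trans (Finset.erase_subset _ _)) hne fun hc => hxS (hc ▸ hx)
  sep u hu w hw huw := by
    have hz : z ∈ A := hhz ▸ hA.mem h (hh ▸ hx)
    rw [Finset.mem_erase] at hu hw
    obtain ⟨S, hSA, h1, h2, h3, h4⟩ :=
      hA.sep_of_link hx hh hhz hxz hu.2 hw.2 hu.1 hw.1 huw
    refine ⟨S.erase x, Finset.erase_subset_erase x hSA, by simp [hu.1, h1], by simp [h2], ?_⟩
    rw [out_splice hA hσ hlx hSA h4, h3]

end HalfEdge

/-! ### Decomposition of cuts of size two. -/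

namespace HalfEdge

variable {V H : Type*} [DecidableEq V] [Fintype H]

/-- A set of vertices of `A` that is left by exactly two edges. -/
def IsTwoCut (o : H → V) (μ : H → H) (A S : Finset V) : Prop :=
  S ⊆ A ∧ out o μ S = 2

/-- All edges that leave `Y` have their inner end at `a`. -/
def Attached (o : H → V) (μ : H → H) (Y : Finset V) (a : V) : Prop :=
  ∀ h, o h ∈ Y → o (μ h) ∉ Y → o h = a

variable {o : H → V} {μ : H → H} {A S T Y Z : Finset V} {a : V}

theorem IsTwoCut.exists_pair (hY : IsTwoCut o μ A Y) :
    ∃ h h', h ≠ h' ∧ o h ∈ Y ∧ o (μ h) ∉ Y ∧ o h' ∈ Y ∧ o (μ h') ∉ Y := by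
  obtain ⟨h, hh, h', hh', hne⟩ := Finset.one_lt_card.1 (show 1 < out o μ Y by rw [hY.2]; simp)
  simp only [Finset.mem_filter, Finset.mem_univ, true_and] at hh hh'
  exact ⟨h, h', hne, hh.1, hh.2, hh'.1, hh'.2⟩

theorem IsTwoCut.nonempty (hY : IsTwoCut o μ A Y) : Y.Nonempty := by
  obtain ⟨h, _, _, h1, _⟩ := hY.exists_pair
  exact ⟨_, h1⟩

namespace IsHalfCactus

theorem ne_of_isTwoCut (hA : IsHalfCactus o μ A) (hY : IsTwoCut o μ A Y) : Y ≠ A := by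
  rintro rfl
  have := hY.2
  rw [hA.out_self] at this
  omega

theorem isTwoCut_compl (hA : IsHalfCactus o μ A) (hY : IsTwoCut o μ A Y) :
    IsTwoCut o μ A (A \ Y) :=
  ⟨Finset.sdiff_subset, by rw [hA.out_compl hY.1, hY.2]⟩

/-- If `T` is not contained in `Y`, this is the intersection of the two-cuts `Y` and `A \ T`, whose
union is not `A`. If it is, then `h` joins the disjoint sets `T` and `A \ Y`, and their union is the
complement of `Y \ T`. -/
theorem isTwoCut_sdiff (hA : IsHalfCactus o μ A) (hY : IsTwoCut o μ A Y) (hT : IsTwoCut o μ A T)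
    {h : H} (h2 : o (μ h) ∉ Y) (h3 : o h ∈ T) (hne : (Y \ T).Nonempty) :
    IsTwoCut o μ A (Y \ T) := by
  refine ⟨Finset.sdiff_subset.trans hY.1, ?_⟩
  have hTc := hA.isTwoCut_compl hT
  have heq : Y \ T = Y ∩ (A \ T) := by
    ext y
    simp only [Finset.mem_sdiff, Finset.mem_inter]
    exact ⟨fun hy => ⟨hy.1, hY.1 hy.1, hy.2⟩, fun hy => ⟨hy.1, hy.2.2⟩⟩
  by_cases hTY : T ⊆ Y
  · have hd : Disjoint T (A \ Y) := by
      rw [Finset.disjoint_left]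
      exact fun y hy hy' => (Finset.mem_sdiff.1 hy').2 (hTY hy)
    have h4 := hA.out_disjoint_union hT.1 hd h3
      (Finset.mem_sdiff.2 ⟨hA.mem h (hT.1 h3), h2⟩)
    have h5 : T ∪ A \ Y = A \ (Y \ T) := by
      ext y
      simp only [Finset.mem_sdiff, Finset.mem_union, not_and, not_not]
      have := @hTY y
      have := @hY.1 y
      tauto
    rw [h5, hA.out_compl (Finset.sdiff_subset.trans hY.1), hA.out_compl hY.1, hT.2, hY.2] at h4
    have h6 := hA.two_le (Y \ T) (Finset.sdiff_subset.trans hY.1) hne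
      (fun hc => (Finset.mem_sdiff.1 (hc ▸ hT.1 h3 : o h ∈ Y \ T)).2 h3)
    omega
  · rw [heq] at hne ⊢
    refine hA.out_inter hY.1 hTc.1 hY.2 hTc.2 hne fun hU => hTY fun y hy => ?_
    have : y ∈ Y ∪ A \ T := by rw [hU]; exact hT.1 hy
    simpa [hy] using this

/-- A two-cut with edges leaving from two vertices splits into two smaller two-cuts. -/
theorem exists_split (hA : IsHalfCactus o μ A) (hY : IsTwoCut o μ A Y)
    (hna : ∀ a, ¬ Attached o μ Y a) :
    ∃ Y₁ Y₂, IsTwoCut o μ A Y₁ ∧ IsTwoCut o μ A Y₂ ∧ Disjoint Y₁ Y₂ ∧ Y = Y₁ ∪ Y₂ := by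
  obtain ⟨h, _, _, h1, h2, _⟩ := hY.exists_pair
  have := hna (o h)
  unfold Attached at this
  push Not at this
  obtain ⟨h', h1', h2', hne⟩ := this
  -- Separate the inner ends of two leaving edges. Each of the two edges then provides the link that
  -- `isTwoCut_sdiff` needs for one of the parts `Y \ T` and `Y ∩ T`.
  obtain ⟨T, hTA, hT1, hT2, hT⟩ := hA.sep _ (hY.1 h1) _ (hY.1 h1') hne.symm
  have hT' : IsTwoCut o μ A T := ⟨hTA, hT⟩
  have hTc := hA.isTwoCut_compl hT'
  have ha := hA.isTwoCut_sdiff hY hT' h2 hT1 ⟨o h', by simp [h1', hT2]⟩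
  have hb := hA.isTwoCut_sdiff hY hTc h2' (by simp [hY.1 h1', hT2]) ⟨o h, by simp [h1, hT1]⟩
  refine ⟨_, _, ha, hb, ?_, ?_⟩
  · rw [Finset.disjoint_left]
    intro y hy hy'
    simp only [Finset.mem_sdiff] at hy hy'
    exact hy'.2 ⟨hY.1 hy.1, hy.2⟩
  · ext y
    have := @hY.1 y
    simp only [Finset.mem_sdiff, Finset.mem_union]
    tauto

/-- The decomposition of a set that is attached at a single vertex. -/
theorem exists_pieces (hA : IsHalfCactus o μ A) (hYA : Y ⊆ A) (ha : a ∈ Y)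
    (hat : Attached o μ Y a) :
    ∃ P : Finset (Finset V), (∀ Z ∈ P, IsTwoCut o μ A Z ∧ Z ⊆ Y.erase a ∧
        ∀ h, o h ∈ Z → o (μ h) ∉ Z → o (μ h) = a) ∧
      (P : Set (Finset V)).PairwiseDisjoint id ∧ P.biUnion id = Y.erase a := by
  classical
  -- The pieces are the maximal two-cuts that avoid `a`. Unions of intersecting or adjacent two-cuts
  -- in `Y.erase a` are again two-cuts, so maximal ones are disjoint and not adjacent.
  set C := (Y.erase a).powerset.filter fun Z => out o μ Z = 2 with hC
  have hCm : ∀ Z, Z ∈ C ↔ Z ⊆ Y.erase a ∧ out o μ Z = 2 := by simp [hC]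
  have hCA : ∀ Z ∈ C, Z ⊆ A := fun Z hZ =>
    ((hCm Z).1 hZ).1.trans ((Finset.erase_subset _ _).trans hYA)
  have haC : ∀ Z ∈ C, a ∉ Z := fun Z hZ hc => by simpa using ((hCm Z).1 hZ).1 hc
  set P := C.filter fun Z => Maximal (· ∈ C) Z with hP
  have hPm : ∀ Z, Z ∈ P ↔ Maximal (· ∈ C) Z := by
    intro Z
    simp only [hP, Finset.mem_filter, and_iff_right_iff_imp]
    exact fun h => h.prop
  have hcov : ∀ u ∈ Y.erase a, ∃ Z ∈ C, u ∈ Z := by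
    intro u hu
    rw [Finset.mem_erase] at hu
    obtain ⟨T, hTA, huT, haT, hT⟩ := hA.sep u (hYA hu.2) a (hYA ha) hu.1
    refine ⟨T ∩ Y, (hCm _).2 ⟨fun y hy => ?_, ?_⟩, by simp [huT, hu.2]⟩
    · rw [Finset.mem_inter] at hy
      exact Finset.mem_erase.2 ⟨fun hc => haT (hc ▸ hy.1), hy.2⟩
    -- Restricting `T` to `Y` adds no leaving edges: all edges out of `Y` start at `a`, which is not
    -- in `T`.
    · have h1 : out o μ (T ∩ Y) ≤ out o μ T := by
        refine out_mono_of_imp fun e he he' => ?_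
        rw [Finset.mem_inter] at he he'
        refine ⟨he.1, fun hc => he' ⟨hc, by_contra fun hc' => ?_⟩⟩
        exact haT (hat e he.2 hc' ▸ he.1)
      have h2 := hA.two_le (T ∩ Y) (Finset.inter_subset_left.trans hTA)
        ⟨u, by simp [huT, hu.2]⟩ fun hc => haT (Finset.mem_inter.1 (hc ▸ hYA ha : a ∈ T ∩ Y)).1
      omega
  have hdisj : ∀ Z ∈ P, ∀ Z' ∈ P, Z ≠ Z' → Disjoint Z Z' := by
    intro Z hZ Z' hZ' hne
    rw [hPm] at hZ hZ'
    by_contra hnd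
    rw [Finset.not_disjoint_iff_nonempty_inter] at hnd
    have h1 := (hCm Z).1 hZ.prop
    have h2 := (hCm Z').1 hZ'.prop
    have hU : Z ∪ Z' ∈ C := (hCm _).2 ⟨Finset.union_subset h1.1 h2.1,
      hA.out_union (hCA _ hZ.prop) (hCA _ hZ'.prop) h1.2 h2.2 hnd fun hc => by
        rcases Finset.mem_union.1 (hc ▸ hYA ha : a ∈ Z ∪ Z') with h | h
        · exact haC _ hZ.prop h
        · exact haC _ hZ'.prop h⟩
    exact hne ((hZ.eq_of_le hU Finset.subset_union_left).trans
      (hZ'.eq_of_le hU Finset.subset_union_right).symm)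
  have hmax : ∀ u ∈ Y.erase a, ∃ Z ∈ P, u ∈ Z := by
    intro u hu
    obtain ⟨Z, hZ, huZ⟩ := hcov u hu
    obtain ⟨Z', hle, hZ'⟩ := C.exists_le_maximal hZ
    exact ⟨Z', (hPm _).2 hZ', hle huZ⟩
  refine ⟨P, fun Z hZ => ?_, fun Z hZ Z' hZ' hne => hdisj Z hZ Z' hZ' hne, ?_⟩
  · have hZ' := (hPm Z).1 hZ
    have h1 := (hCm Z).1 hZ'.prop
    refine ⟨⟨hCA _ hZ'.prop, h1.2⟩, h1.1, fun h h2 h3 => by_contra fun hc => ?_⟩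
    have h4 : o h ∈ Y ∧ o h ≠ a := by
      have := h1.1 h2
      rw [Finset.mem_erase] at this
      exact this.symm
    have h5 : o (μ h) ∈ Y := by_contra fun hc' => h4.2 (hat h h4.1 hc')
    -- An edge from `Z` to a vertex of `Y` other than `a` would end in another piece, and the union
    -- of both pieces would contradict maximality.
    obtain ⟨Z', hZP, hmem⟩ := hmax (o (μ h)) (Finset.mem_erase.2 ⟨hc, h5⟩)
    have hne : Z ≠ Z' := by rintro rfl; exact h3 hmem
    have h6 := hA.out_disjoint_union (hCA _ hZ'.prop) (hdisj Z hZ Z' hZP hne) h2 hmem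
    have hZC := ((hPm Z').1 hZP).prop
    have h7 := (hCm Z').1 hZC
    have h8 := hA.two_le (Z ∪ Z') (Finset.union_subset (hCA _ hZ'.prop) (hCA _ hZC))
      ⟨o h, by simp [h2]⟩ fun hc => by
        rcases Finset.mem_union.1 (hc ▸ hYA ha : a ∈ Z ∪ Z') with h | h
        · exact haC _ hZ'.prop h
        · exact haC _ hZC h
    have hU : Z ∪ Z' ∈ C := (hCm _).2 ⟨Finset.union_subset h1.1 h7.1, by omega⟩
    exact hne ((hZ'.eq_of_le hU Finset.subset_union_left).trans
      (((hPm Z').1 hZP).eq_of_le hU Finset.subset_union_right).symm)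
  · ext u
    simp only [Finset.mem_biUnion, id]
    refine ⟨fun ⟨Z, hZ, hu⟩ => ((hCm Z).1 ((hPm Z).1 hZ).prop).1 hu, fun hu => hmax u hu⟩

/-- The size of the cut around the vertex at which a two-cut with a single piece is attached. -/
theorem out_singleton_eq_four (hA : IsHalfCactus o μ A) (hY : IsTwoCut o μ A Y)
    (ha : a ∈ Y) (hat : Attached o μ Y a) (hZ : IsTwoCut o μ A Z) (hZY : Z = Y.erase a)
    (hZa : ∀ h, o h ∈ Z → o (μ h) ∉ Z → o (μ h) = a) : out o μ {a} = 4 := by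
  classical
  have haZ : a ∉ Z := by simp [hZY]
  have h1 : out o μ Z = (Finset.univ.filter fun h => o h = a ∧ o (μ h) ∈ Z).card := by
    refine Finset.card_bij' (fun h _ => μ h) (fun h _ => μ h) ?_ ?_ ?_ ?_ <;> intro h hh <;>
      simp only [Finset.mem_filter, Finset.mem_univ, true_and] at hh ⊢
    · rw [hA.invol h (hZ.1 hh.1)]
      exact ⟨hZa h hh.1 hh.2, hh.1⟩
    · rw [hA.invol h (hY.1 (hh.1 ▸ ha)), hh.1]
      exact ⟨hh.2, haZ⟩
    · exact hA.invol h (hZ.1 hh.1)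
    · exact hA.invol h (hY.1 (hh.1 ▸ ha))
  -- The non-loop edges at `a` are the two that leave `Y` and the two that lead to the only piece
  -- `Z`.
  have h2 : out o μ {a} = out o μ Y + out o μ Z := by
    rw [h1, out, out, ← Finset.card_union_of_disjoint]
    · congr 1
      ext h
      simp only [Finset.mem_filter, Finset.mem_univ, true_and, Finset.mem_singleton,
        Finset.mem_union]
      constructor
      · rintro ⟨h3, h4⟩
        by_cases h5 : o (μ h) ∈ Y
        · exact Or.inr ⟨h3, hZY ▸ Finset.mem_erase.2 ⟨h4, h5⟩⟩
        · exact Or.inl ⟨h3 ▸ ha, h5⟩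
      · rintro (⟨h3, h4⟩ | ⟨h3, h4⟩)
        · exact ⟨hat h h3 h4, fun hc => h4 (hc ▸ ha)⟩
        · exact ⟨h3, fun hc => haZ (hc ▸ h4)⟩
    · rw [Finset.disjoint_left]
      intro h hh hh'
      simp only [Finset.mem_filter, Finset.mem_univ, true_and] at hh hh'
      rw [hZY] at hh'
      exact hh.2 (Finset.mem_of_mem_erase hh'.2)
  rw [h2, hY.2, hZ.2]

end IsHalfCactus

/-- No vertex of `A` of weight `k` and degree `d` is incident with two parallel edges. -/
def NoParallel (o : H → V) (μ : H → H) (A : Finset V) (w : V → ℕ) (k d : ℕ) : Prop :=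
  ∀ x ∈ A, w x = k → out o μ {x} = d →
    ∀ h h', o h = x → o h' = x → h ≠ h' → o (μ h) = o (μ h') → o (μ h) = x

theorem sum_pieces {V : Type*} [DecidableEq V] {Y : Finset V} {a : V} {P : Finset (Finset V)} (ha : a ∈ Y)
    (hd : (P : Set (Finset V)).PairwiseDisjoint id) (hU : P.biUnion id = Y.erase a)
    (f : V → ℕ) : ∑ x ∈ Y, f x = f a + ∑ Z ∈ P, ∑ x ∈ Z, f x := by
  rw [← Finset.add_sum_erase _ _ ha, ← hU, Finset.sum_biUnion hd]
  rfl

/-! ### Counting vertices by weight. -/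

section Counting

variable {w : V → ℕ} (hA : IsHalfCactus o μ A)
  (hpos : ∀ S, IsTwoCut o μ A S → 0 < ∑ x ∈ S, w x) (h04 : NoParallel o μ A w 0 4)

include hA hpos h04

/-- Induction on `Y`. The slack of one per piece pays for the attaching vertex `a` as soon as there
are two pieces. With one piece, `a` pays for itself unless its weight is zero; then `a` has degree
four, the two edges to the piece are not parallel, and so the piece is not attached at a single
vertex. This is why unattached sets need the stronger bound, which they get from adding the bounds
of their two parts. -/
theorem card_twoCut_le (Y : Finset V) (hY : IsTwoCut o μ A Y) :
    Y.card + 1 ≤ 2 * ∑ x ∈ Y, w x ∧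
      ((∀ a, ¬ Attached o μ Y a) → Y.card + 2 ≤ 2 * ∑ x ∈ Y, w x) := by
  classical
  induction hn : Y.card using Nat.strong_induction_on generalizing Y with
  | _ N ih =>
  subst hn
  by_cases hat : ∃ a, Attached o μ Y a
  · obtain ⟨a, hat⟩ := hat
    refine ⟨?_, fun hc => absurd hat (hc a)⟩
    have ha : a ∈ Y := by
      obtain ⟨h, _, _, h1, h2, _⟩ := hY.exists_pair
      exact hat h h1 h2 ▸ h1
    obtain ⟨P, hP, hd, hU⟩ := hA.exists_pieces hY.1 ha hat
    have hlt : ∀ Z ∈ P, Z.card < Y.card := fun Z hZ =>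
      (Finset.card_le_card (hP Z hZ).2.1).trans_lt (Finset.card_erase_lt_of_mem ha)
    have hw := sum_pieces ha hd hU w
    have hc := sum_pieces ha hd hU (fun _ => 1)
    simp only [Finset.sum_const, smul_eq_mul, mul_one] at hc
    have hsum : ∑ Z ∈ P, Z.card + P.card ≤ 2 * ∑ Z ∈ P, ∑ x ∈ Z, w x := by
      rw [Finset.card_eq_sum_ones, ← Finset.sum_add_distrib, Finset.mul_sum]
      exact Finset.sum_le_sum fun Z hZ => (ih _ (hlt Z hZ) Z (hP Z hZ).1 rfl).1
    rcases Nat.lt_or_ge P.card 2 with h2 | h2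
    · interval_cases hPc : P.card
      · rw [Finset.card_eq_zero] at hPc
        have := hpos Y hY
        simp [hPc] at hc
        omega
      · obtain ⟨Z, rfl⟩ := Finset.card_eq_one.1 hPc
        simp only [Finset.sum_singleton] at hw hc hsum
        obtain ⟨hZ, hZY, hZa⟩ := hP Z (by simp)
        have ihZ := ih _ (hlt Z (by simp)) Z hZ rfl
        by_cases hwa : w a = 0
        · by_cases hZat : ∃ b, Attached o μ Z b
          · obtain ⟨b, hZat⟩ := hZat
            exfalso
            obtain ⟨h, h', hne, h1, h2, h1', h2'⟩ := hZ.exists_pair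
            have h4 := hA.out_singleton_eq_four hY ha hat hZ (by simpa using hU) hZa
            have e1 := hA.invol h (hZ.1 h1)
            have e2 := hA.invol h' (hZ.1 h1')
            have := h04 a (hY.1 ha) hwa h4 (μ h) (μ h') (hZa h h1 h2) (hZa h' h1' h2')
              (fun hc => hne (by rw [← e1, hc, e2]))
              (by rw [e1, e2, hZat h h1 h2, hZat h' h1' h2'])
            rw [e1] at this
            have h3 := hZY h1
            simp [this] at h3
          · push Not at hZat
            have := ihZ.2 hZat
            omega
        · omega
    · omega
  · push Not at hat
    obtain ⟨Y₁, Y₂, h1, h2, hd, rfl⟩ := hA.exists_split hY hat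
    have hc := Finset.card_union_of_disjoint hd
    have hw := Finset.sum_union hd (f := w)
    have := h1.nonempty.card_pos
    have := h2.nonempty.card_pos
    have ih1 := (ih _ (by omega) Y₁ h1 rfl).1
    have ih2 := (ih _ (by omega) Y₂ h2 rfl).1
    constructor <;> [skip; intro _] <;> omega

/-- The number of vertices is at most twice the total weight. -/
theorem card_le_two_mul (hw : 0 < ∑ x ∈ A, w x) : A.card ≤ 2 * ∑ x ∈ A, w x := by
  -- No edge leaves `A`, so `A` counts as attached at any vertex `r` and falls apart into `r` and
  -- pieces.
  obtain ⟨r, hr⟩ := hA.nonempty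
  obtain ⟨P, hP, hd, hU⟩ := hA.exists_pieces subset_rfl hr
    (fun h h1 h2 => absurd (hA.mem h h1) h2)
  have hw' := sum_pieces hr hd hU w
  have hc := sum_pieces hr hd hU (fun _ => 1)
  simp only [Finset.sum_const, smul_eq_mul, mul_one] at hc
  have hsum : ∑ Z ∈ P, Z.card + P.card ≤ 2 * ∑ Z ∈ P, ∑ x ∈ Z, w x := by
    rw [Finset.card_eq_sum_ones, ← Finset.sum_add_distrib, Finset.mul_sum]
    exact Finset.sum_le_sum fun Z hZ => (card_twoCut_le hA hpos h04 Z (hP Z hZ).1).1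
  rcases P.eq_empty_or_nonempty with rfl | hne
  · simp at hc; omega
  · have := hne.card_pos
    omega

variable {δ D : ℕ} (h12 : NoParallel o μ A w 1 2)
  (hbig : ∀ S, IsTwoCut o μ A S → ∑ x ∈ S, w x = 1 ∨ δ ≤ ∑ x ∈ S, w x)
  (hchain : ∀ X Y, IsTwoCut o μ A X → IsTwoCut o μ A Y → X ⊆ Y → 3 ≤ ∑ x ∈ Y \ X, w x →
    D ≤ ∑ x ∈ Y \ X, w x)
  (hD : 4 ≤ D) (hDδ : D ≤ δ)

-- A two-cut of weight at most one is a single vertex by `card_twoCut_le`. As a piece it would be a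
-- weight-one vertex with two parallel edges to `a`, which `h12` excludes.
include h12 in
theorem one_lt_sum_piece (hZ : IsTwoCut o μ A Z) (haZ : a ∉ Z)
    (hZa : ∀ h, o h ∈ Z → o (μ h) ∉ Z → o (μ h) = a) : 2 ≤ ∑ x ∈ Z, w x := by
  by_contra hlt
  have h1 := (card_twoCut_le hA hpos h04 Z hZ).1
  have h2 := hZ.nonempty.card_pos
  obtain ⟨b, rfl⟩ := Finset.card_eq_one.1 (show Z.card = 1 by omega)
  simp only [Finset.sum_singleton, Finset.card_singleton] at h1 hlt
  obtain ⟨h, h', hne, e1, e2, e1', e2'⟩ := hZ.exists_pair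
  have := h12 b (hZ.1 (by simp)) (by omega) hZ.2 h h' (by simpa using e1) (by simpa using e1') hne
    (by rw [hZa h e1 e2, hZa h' e1' e2'])
  exact e2 (by simpa using this)

include h12 hbig hchain hD hDδ

/-- The core `X` is the part of `Y` that satisfies the bound with slack ten; the rest has weight at
most two, hence at most four vertices, which leaves slack six for `Y`. Two pieces thus give slack
twelve, enough for one attaching vertex and ten more. When growing `Y` makes the weight outside the
core exceed two, `hchain` makes it at least `D`, which contributes `11 * D`, while at most five
vertices were added; then `Y` itself becomes the core. The last clause carries an extra unit for
unattached sets, which pays for an attaching vertex of weight zero, as in `card_twoCut_le`. -/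
theorem exists_core (Y : Finset V) (hY : IsTwoCut o μ A Y) (hY2 : 2 ≤ ∑ x ∈ Y, w x) :
    ∃ X ⊆ Y, IsTwoCut o μ A X ∧ D * (X.card + 10) ≤ 11 * ∑ x ∈ X, w x ∧
      (Y \ X).card ≤ 2 * ∑ x ∈ Y \ X, w x ∧ ∑ x ∈ Y \ X, w x ≤ 2 ∧
      ((∀ a, ¬ Attached o μ Y a) → D * (Y.card + 11) ≤ 11 * ∑ x ∈ Y, w x ∨
        (Y \ X).card + 1 ≤ 2 * ∑ x ∈ Y \ X, w x) := by
  classical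
  induction hn : Y.card using Nat.strong_induction_on generalizing Y with
  | _ N ih =>
  subst hn
  have hslack : ∀ Z : Finset V, Z.card < Y.card → IsTwoCut o μ A Z → 2 ≤ ∑ x ∈ Z, w x →
      D * (Z.card + 6) ≤ 11 * ∑ x ∈ Z, w x := by
    intro Z hlt hZ hZ2
    obtain ⟨X, hXZ, hX, h1, h2, h3, -⟩ := ih _ hlt Z hZ hZ2 rfl
    have h4 := Finset.card_sdiff_add_card_eq_card hXZ
    have h5 := Finset.sum_sdiff hXZ (f := w)
    have h6 : Z.card + 6 ≤ X.card + 10 := by omega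
    have h7 := Nat.mul_le_mul_left D h6
    omega
  by_cases hat : ∃ a, Attached o μ Y a
  · obtain ⟨a, hat⟩ := hat
    have ha : a ∈ Y := by
      obtain ⟨h, _, _, h1, h2, _⟩ := hY.exists_pair
      exact hat h h1 h2 ▸ h1
    have himp : ∀ p : Prop, (∀ a, ¬ Attached o μ Y a) → p := fun p hc => absurd hat (hc a)
    have hself : D * (Y.card + 10) ≤ 11 * ∑ x ∈ Y, w x → ∃ X ⊆ Y, IsTwoCut o μ A X ∧
        D * (X.card + 10) ≤ 11 * ∑ x ∈ X, w x ∧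
        (Y \ X).card ≤ 2 * ∑ x ∈ Y \ X, w x ∧ ∑ x ∈ Y \ X, w x ≤ 2 ∧
        ((∀ a, ¬ Attached o μ Y a) → D * (Y.card + 11) ≤ 11 * ∑ x ∈ Y, w x ∨
          (Y \ X).card + 1 ≤ 2 * ∑ x ∈ Y \ X, w x) :=
      fun h => ⟨Y, subset_rfl, hY, h, by simp, by simp, himp _⟩
    obtain ⟨P, hP, hd, hU⟩ := hA.exists_pieces hY.1 ha hat
    have haZ : ∀ Z ∈ P, a ∉ Z := fun Z hZ hc => by simpa using (hP Z hZ).2.1 hc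
    have hlt : ∀ Z ∈ P, Z.card < Y.card := fun Z hZ =>
      (Finset.card_le_card (hP Z hZ).2.1).trans_lt (Finset.card_erase_lt_of_mem ha)
    have hP2 : ∀ Z ∈ P, 2 ≤ ∑ x ∈ Z, w x := fun Z hZ =>
      one_lt_sum_piece hA hpos h04 h12 (hP Z hZ).1 (haZ Z hZ) (hP Z hZ).2.2
    have hw := sum_pieces ha hd hU w
    have hc := sum_pieces ha hd hU (fun _ => 1)
    simp only [Finset.sum_const, smul_eq_mul, mul_one] at hc
    have hsum : D * (∑ Z ∈ P, Z.card + 6 * P.card) ≤ 11 * ∑ Z ∈ P, ∑ x ∈ Z, w x := by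
      rw [Finset.card_eq_sum_ones, Finset.mul_sum, ← Finset.sum_add_distrib, Finset.mul_sum,
        Finset.mul_sum]
      exact Finset.sum_le_sum fun Z hZ => hslack Z (hlt Z hZ) (hP Z hZ).1 (hP2 Z hZ)
    rcases Nat.lt_or_ge P.card 2 with h2 | h2
    · interval_cases hPc : P.card
      · rw [Finset.card_eq_zero] at hPc
        subst hPc
        apply hself
        simp only [Finset.sum_empty, add_zero] at hc hw
        -- Here `Y` is the single vertex `a`. Its weight is not one, hence at least `δ`, and one
        -- vertex plus slack ten makes the factor eleven.
        rcases hbig Y hY with h3 | h3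
        · omega
        · rw [hc]; omega
      · obtain ⟨Z, rfl⟩ := Finset.card_eq_one.1 hPc
        simp only [Finset.sum_singleton] at hw hc hsum
        obtain ⟨hZ, hZY, hZa⟩ := hP Z (by simp)
        have hZe : Z = Y.erase a := by simpa using hU
        obtain ⟨X, hXZ, hX, h3, h4, h5, h6⟩ :=
          ih _ (hlt Z (by simp)) Z hZ (hP2 Z (by simp)) rfl
        have hXY : X ⊆ Y := hXZ.trans (hZY.trans (Finset.erase_subset _ _))
        have c1 := Finset.card_sdiff_add_card_eq_card hXZ
        have c2 := Finset.sum_sdiff hXZ (f := w)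
        have c3 := Finset.card_sdiff_add_card_eq_card hXY
        have c4 := Finset.sum_sdiff hXY (f := w)
        by_cases hle : ∑ x ∈ Y \ X, w x ≤ 2
        · by_cases hwa : w a = 0
          · by_cases hZat : ∃ b, Attached o μ Z b
            · obtain ⟨b, hZat⟩ := hZat
              exfalso
              obtain ⟨h, h', hne, h1, h2, h1', h2'⟩ := hZ.exists_pair
              have h4 := hA.out_singleton_eq_four hY ha hat hZ hZe hZa
              have e1 := hA.invol h (hZ.1 h1)
              have e2 := hA.invol h' (hZ.1 h1')
              have := h04 a (hY.1 ha) hwa h4 (μ h) (μ h') (hZa h h1 h2) (hZa h' h1' h2')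
                (fun hc => hne (by rw [← e1, hc, e2]))
                (by rw [e1, e2, hZat h h1 h2, hZat h' h1' h2'])
              rw [e1] at this
              have h3 := hZY h1
              simp [this] at h3
            · push Not at hZat
              rcases h6 hZat with h7 | h7
              · apply hself
                rw [hc, hw, hwa, show 1 + Z.card + 10 = Z.card + 11 by omega, zero_add]
                exact h7
              · exact ⟨X, hXY, hX, h3, by omega, hle, himp _⟩
          · exact ⟨X, hXY, hX, h3, by omega, hle, himp _⟩
        · have h7 := hchain X Y hX hY hXY (by omega)
          apply hself
          -- Five is the vertex `a` together with the at most four vertices of `Z \ X`.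
          have h8 : Y.card + 10 ≤ (X.card + 10) + 5 := by omega
          have h9 := Nat.mul_le_mul_left D h8
          rw [mul_add D (X.card + 10) 5] at h9
          omega
    · apply hself
      have h8 : Y.card + 10 ≤ ∑ Z ∈ P, Z.card + 6 * P.card := by omega
      have h9 := Nat.mul_le_mul_left D h8
      omega
  · push Not at hat
    obtain ⟨Y₁, Y₂, h1, h2, hd, hYe⟩ := hA.exists_split hY hat
    have hsmall : ∀ Y₁ Y₂ : Finset V, IsTwoCut o μ A Y₁ → IsTwoCut o μ A Y₂ → Disjoint Y₁ Y₂ →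
        Y = Y₁ ∪ Y₂ → ∑ x ∈ Y₁, w x = 1 → ∃ X ⊆ Y, IsTwoCut o μ A X ∧
        D * (X.card + 10) ≤ 11 * ∑ x ∈ X, w x ∧
        (Y \ X).card ≤ 2 * ∑ x ∈ Y \ X, w x ∧ ∑ x ∈ Y \ X, w x ≤ 2 ∧
        ((∀ a, ¬ Attached o μ Y a) → D * (Y.card + 11) ≤ 11 * ∑ x ∈ Y, w x ∨
          (Y \ X).card + 1 ≤ 2 * ∑ x ∈ Y \ X, w x) := by
      intro Y₁ Y₂ h1 h2 hd hYe hw1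
      have hc := hYe ▸ Finset.card_union_of_disjoint hd
      have hw := hYe ▸ Finset.sum_union hd (f := w)
      have p1 := h1.nonempty.card_pos
      have hY₁ := (card_twoCut_le hA hpos h04 Y₁ h1).1
      have h2w : 2 ≤ ∑ x ∈ Y₂, w x := by
        rcases hbig Y hY with h | h
        · omega
        · omega
      obtain ⟨X, hXZ, hX, h3, h4, h5, h6⟩ := ih _ (by omega) Y₂ h2 h2w rfl
      have hXY : X ⊆ Y := hXZ.trans (hYe ▸ Finset.subset_union_right)
      have c1 := Finset.card_sdiff_add_card_eq_card hXZ
      have c2 := Finset.sum_sdiff hXZ (f := w)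
      have c3 := Finset.card_sdiff_add_card_eq_card hXY
      have c4 := Finset.sum_sdiff hXY (f := w)
      refine ⟨X, hXY, hX, h3, by omega, ?_, fun _ => Or.inr (by omega)⟩
      -- `Y₁` has weight one, so the weight outside `X` is at most three. Three is impossible:
      -- `hchain` would raise it to `D ≥ 4`.
      by_contra hlt
      have := hchain X Y hX hY hXY (by omega)
      omega
    rcases hbig Y₁ h1 with hw1 | hw1
    · exact hsmall Y₁ Y₂ h1 h2 hd hYe hw1
    rcases hbig Y₂ h2 with hw2 | hw2
    · exact hsmall Y₂ Y₁ h2 h1 hd.symm (hYe.trans (Finset.union_comm _ _)) hw2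
    have hc := hYe ▸ Finset.card_union_of_disjoint hd
    have hw := hYe ▸ Finset.sum_union hd (f := w)
    have p1 := h1.nonempty.card_pos
    have p2 := h2.nonempty.card_pos
    have s1 := hslack Y₁ (by omega) h1 (by omega)
    have s2 := hslack Y₂ (by omega) h2 (by omega)
    -- Both parts are large, so their slacks of six add up to twelve, one more than the eleven
    -- needed for an unattached set.
    have s3 : D * (Y.card + 11) + D ≤ 11 * ∑ x ∈ Y, w x := by
      rw [hc, hw]
      calc D * (Y₁.card + Y₂.card + 11) + D = D * (Y₁.card + 6) + D * (Y₂.card + 6) := by ring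
        _ ≤ _ := by omega
    refine ⟨Y, subset_rfl, hY, ?_, by simp, by simp, fun _ => Or.inl (by omega)⟩
    rw [mul_add] at s3 ⊢
    omega

/-- The number of vertices in terms of the total weight and the least weight of a
non-trivial cut. -/
theorem mul_card_le (hw : δ ≤ ∑ x ∈ A, w x) : D * A.card ≤ 11 * ∑ x ∈ A, w x := by
  obtain ⟨r, hr⟩ := hA.nonempty
  obtain ⟨P, hP, hd, hU⟩ := hA.exists_pieces subset_rfl hr
    (fun h h1 h2 => absurd (hA.mem h h1) h2)
  have hw' := sum_pieces hr hd hU w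
  have hc := sum_pieces hr hd hU (fun _ => 1)
  simp only [Finset.sum_const, smul_eq_mul, mul_one] at hc
  have hsum : D * (∑ Z ∈ P, Z.card + 6 * P.card) ≤ 11 * ∑ Z ∈ P, ∑ x ∈ Z, w x := by
    rw [Finset.card_eq_sum_ones, Finset.mul_sum, ← Finset.sum_add_distrib, Finset.mul_sum,
      Finset.mul_sum]
    refine Finset.sum_le_sum fun Z hZ => ?_
    obtain ⟨X, hXZ, hX, h1, h2, h3, -⟩ := exists_core hA hpos h04 h12 hbig hchain hD hDδ Z
      (hP Z hZ).1 (one_lt_sum_piece hA hpos h04 h12 (hP Z hZ).1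
        (fun hc => by simpa using (hP Z hZ).2.1 hc) (hP Z hZ).2.2)
    have h4 := Finset.card_sdiff_add_card_eq_card hXZ
    have h5 := Finset.sum_sdiff hXZ (f := w)
    have h6 : Z.card + 6 * 1 ≤ X.card + 10 := by omega
    have h7 := Nat.mul_le_mul_left D h6
    omega
  rcases P.eq_empty_or_nonempty with rfl | hne
  · simp only [Finset.sum_empty, add_zero] at hc
    rw [hc]; omega
  · have := hne.card_pos
    have h8 : A.card ≤ ∑ Z ∈ P, Z.card + 6 * P.card := by omega
    have h9 := Nat.mul_le_mul_left D h8
    omega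

end Counting

end HalfEdge

/-! ### Min-cuts of simple graphs and the size bound. -/

namespace CactusRep

open HalfEdge

section SimpleGraph

variable {n : ℕ} (G : SimpleGraph (Fin n)) [DecidableRel G.Adj]

/-- The size of the cut `W` of the simple graph `G`, as a number of darts. -/
def dartCut (W : Finset (Fin n)) : ℕ :=
  out (fun d : G.Dart => d.fst) SimpleGraph.Dart.symm W

theorem cutSize_ofSimpleGraph (W : Finset (Fin n)) :
    cutSize (Graph.ofSimpleGraph G) (W : Set (Fin n)) = dartCut G W := by
  classical
  have h : cutEdges (Graph.ofSimpleGraph G) (W : Set (Fin n)) =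
      ((Finset.univ.filter fun d : G.Dart => d.fst ∈ W ∧ d.symm.fst ∉ W).image
        SimpleGraph.Dart.edge : Finset (Sym2 (Fin n))) := by
    ext e
    simp only [cutEdges, Set.mem_ofPred_eq, Finset.coe_image, Set.mem_image, Finset.mem_coe,
      Finset.mem_filter, Finset.mem_univ, true_and, Graph.ofSimpleGraph]
    constructor
    · rintro ⟨x, hx, y, hy, he⟩
      obtain ⟨rfl, h2⟩ := he
      exact ⟨⟨(x, y), h2⟩, ⟨hx, hy⟩, rfl⟩
    · rintro ⟨d, ⟨h1, h2⟩, rfl⟩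
      refine ⟨d.fst, h1, d.snd, h2, rfl, d.adj⟩
  rw [cutSize, h, Set.encard_coe_eq_coe_finsetCard, Finset.card_image_of_injOn]
  · rfl
  · intro d hd d' hd' he
    simp only [Finset.coe_filter, Finset.mem_univ, true_and, Set.mem_ofPred_eq] at hd hd'
    rcases SimpleGraph.dart_edge_eq_iff d d' |>.1 he with h | h
    · exact h
    · subst h
      exact absurd hd'.1 hd.2

theorem dartCut_compl (W : Finset (Fin n)) : dartCut G Wᶜ = dartCut G W := by
  refine Finset.card_bij' (fun h _ => h.symm) (fun h _ => h.symm) ?_ ?_ ?_ ?_ <;>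
    simp +contextual

/-- Submodularity for `Y` and the complement of `X`. -/
theorem dartCut_sdiff_le (X Y : Finset (Fin n)) :
    dartCut G (Y \ X) ≤ dartCut G Y + dartCut G X := by
  have h := out_submod (fun d : G.Dart => d.fst) SimpleGraph.Dart.symm Y Xᶜ
  have h' := dartCut_compl G X
  rw [dartCut] at h'
  rw [Finset.sdiff_eq_inter_compl]
  unfold dartCut at *
  omega

/-- Simplicity is used here: a vertex of `W` has at most `|W| - 1` neighbours inside `W`, and its
other neighbours give distinct darts that leave `W`. -/
theorem card_mul_minDegree_le (W : Finset (Fin n)) :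
    W.card * G.minDegree ≤ dartCut G W + W.card * (W.card - 1) := by
  have h : ∀ v ∈ W, G.minDegree ≤
      (Finset.univ.filter fun d : G.Dart => d.fst = v ∧ d.snd ∉ W).card + (W.card - 1) := by
    intro v hv
    refine (G.minDegree_le_degree v).trans ?_
    rw [← Finset.card_erase_of_mem hv, ← SimpleGraph.card_neighborFinset_eq_degree]
    have h1 : (G.neighborFinset v \ W).card ≤
        (Finset.univ.filter fun d : G.Dart => d.fst = v ∧ d.snd ∉ W).card := by
      refine (Finset.card_le_card ?_).trans
        (Finset.card_image_le (f := fun d : G.Dart => d.snd))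
      intro u hu
      simp only [Finset.mem_sdiff, SimpleGraph.mem_neighborFinset] at hu
      exact Finset.mem_image.2 ⟨⟨(v, u), hu.1⟩, by simpa using hu.2, rfl⟩
    have h2 : (G.neighborFinset v ∩ W).card ≤ (W.erase v).card := by
      refine Finset.card_le_card fun u hu => ?_
      simp only [Finset.mem_inter, SimpleGraph.mem_neighborFinset] at hu
      exact Finset.mem_erase.2 ⟨hu.1.ne', hu.2⟩
    have := Finset.card_sdiff_add_card_inter (G.neighborFinset v) W
    omega
  have h2 := Finset.sum_le_sum h
  rw [Finset.sum_const, smul_eq_mul, Finset.sum_add_distrib, Finset.sum_const, smul_eq_mul] at h2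
  refine h2.trans (Nat.add_le_add_right (le_of_eq ?_) _)
  rw [dartCut, out, Finset.card_eq_sum_card_fiberwise (f := fun d : G.Dart => d.fst) (t := W)]
  · refine Finset.sum_congr rfl fun v hv => ?_
    congr 1
    ext d
    simp only [Finset.mem_filter, Finset.mem_univ, true_and]
    constructor
    · rintro ⟨rfl, h⟩; exact ⟨⟨hv, h⟩, rfl⟩
    · rintro ⟨⟨_, h⟩, rfl⟩; exact ⟨rfl, h⟩
  · intro d hd
    simp only [Finset.coe_filter, Set.mem_ofPred_eq] at hd
    exact hd.2.1

variable {G} {W X Y : Finset (Fin n)}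

/-- Compare with the cut around a vertex of minimum degree; it is a proper cut because the existence
of `W` shows that there are at least two vertices. -/
theorem dartCut_le_minDegree (hW : (W : Set (Fin n)) ∈ minCuts (Graph.ofSimpleGraph G)) :
    dartCut G W ≤ G.minDegree := by
  obtain ⟨⟨⟨u, hu⟩, hss⟩, hmin⟩ := hW
  have : Nonempty (Fin n) := ⟨u⟩
  obtain ⟨x, -, hx⟩ := Set.exists_of_ssubset hss
  obtain ⟨v, hv⟩ := G.exists_minimal_degree_vertex
  have h1 := hmin (({v} : Finset (Fin n)) : Set (Fin n)) ⟨by simp, by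
    rw [Set.ssubset_iff_of_subset (by intro y _; trivial)]
    by_cases hxv : x = v
    · exact ⟨u, trivial, by
        rw [Finset.coe_singleton, Set.mem_singleton_iff]
        rintro rfl; exact hx (hxv ▸ hu)⟩
    · exact ⟨x, trivial, by simpa using hxv⟩⟩
  rw [cutSize_ofSimpleGraph, cutSize_ofSimpleGraph, Nat.cast_le] at h1
  refine h1.trans ?_
  rw [hv, ← SimpleGraph.card_neighborFinset_eq_degree]
  refine Finset.card_le_card_of_injOn (fun d : G.Dart => d.snd) ?_ ?_
  · intro d hd
    simp only [Finset.coe_filter, Finset.mem_univ, true_and, Set.mem_ofPred_eq,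
      Finset.mem_singleton] at hd
    simp [← hd.1, d.adj]
  · intro d hd d' hd' he
    simp only [Finset.coe_filter, Finset.mem_univ, true_and, Set.mem_ofPred_eq,
      Finset.mem_singleton] at hd hd'
    exact SimpleGraph.Dart.ext _ _ (Prod.ext (hd.1.trans hd'.1.symm) he)

/-- For `s = |W|` the degree count gives `s * δ ≤ δ + s * (s - 1)`, that is, `(s - 1) * δ ≤ (s - 1)
* s`. -/
theorem card_eq_one_or_minDegree_le
    (hW : (W : Set (Fin n)) ∈ minCuts (Graph.ofSimpleGraph G)) :
    W.card = 1 ∨ G.minDegree ≤ W.card := by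
  have h1 := dartCut_le_minDegree hW
  have h2 := card_mul_minDegree_le G W
  have h3 : 0 < W.card := Finset.card_pos.2 (by simpa using hW.1.1)
  by_contra! hc
  obtain ⟨s, hs⟩ : ∃ s, W.card = s + 2 := ⟨W.card - 2, by omega⟩
  obtain ⟨t, ht⟩ : ∃ t, G.minDegree = s + 3 + t := ⟨G.minDegree - (s + 3), by omega⟩
  rw [hs, ht] at h2
  rw [ht] at h1
  have : (s + 2) * (s + 2 - 1) = (s + 2) * (s + 1) := rfl
  rw [this] at h2
  nlinarith

/-- At most `2 * δ` edges leave `Y \ X`, so `(s - 2) * δ ≤ s * (s - 1)` for its size `s`. With `δ ≥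
s + 2` this forces `s ≤ 4`, and for `s = 3` and `s = 4` it forces `δ ≤ 6`; hence the hypothesis `δ ≥
7`. -/
theorem minDegree_le_card_sdiff (h7 : 7 ≤ G.minDegree)
    (hX : (X : Set (Fin n)) ∈ minCuts (Graph.ofSimpleGraph G))
    (hY : (Y : Set (Fin n)) ∈ minCuts (Graph.ofSimpleGraph G)) (h3 : 3 ≤ (Y \ X).card) :
    G.minDegree - 1 ≤ (Y \ X).card := by
  have h1 := dartCut_le_minDegree hX
  have h1' := dartCut_le_minDegree hY
  have h2 := card_mul_minDegree_le G (Y \ X)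
  have h4 := dartCut_sdiff_le G X Y
  by_contra! hc
  obtain ⟨s, hs⟩ : ∃ s, (Y \ X).card = s + 3 := ⟨(Y \ X).card - 3, by omega⟩
  obtain ⟨t, ht⟩ : ∃ t, G.minDegree = s + 5 + t := ⟨G.minDegree - (s + 5), by omega⟩
  rw [hs, ht] at h2
  rw [ht] at h1 h1'
  have : (s + 3) * (s + 3 - 1) = (s + 3) * (s + 2) := rfl
  rw [this] at h2
  nlinarith

/-- The bound on the number of vertices of a reduced cactus. -/
theorem card_mul_minDegree_lt {V H : Type*} [DecidableEq V] [Fintype H] {o : H → V} {μ : H → H}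
    {A : Finset V} (hA : IsHalfCactus o μ A) {ψ : Fin n → V} (hψ : ∀ v, ψ v ∈ A) (hn : 0 < n)
    (hcut : ∀ S, IsTwoCut o μ A S → ψ ⁻¹' S ∈ minCuts (Graph.ofSimpleGraph G))
    (h04 : NoParallel o μ A (fun x => (Finset.univ.filter fun v => ψ v = x).card) 0 4)
    (h12 : NoParallel o μ A (fun x => (Finset.univ.filter fun v => ψ v = x).card) 1 2) :
    A.card * G.minDegree < 30 * n := by
  have hw : ∀ S : Finset V, ∑ x ∈ S, (Finset.univ.filter fun v => ψ v = x).card =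
      (Finset.univ.filter fun v => ψ v ∈ S).card := by
    intro S
    rw [Finset.card_eq_sum_card_fiberwise (f := ψ) (t := S) (by intro v; simp)]
    refine Finset.sum_congr rfl fun x hx => ?_
    congr 1
    ext v
    simp only [Finset.mem_filter, Finset.mem_univ, true_and]
    exact ⟨fun h => ⟨h ▸ hx, h⟩, fun h => h.2⟩
  have hcut' : ∀ S, IsTwoCut o μ A S → ((Finset.univ.filter fun v => ψ v ∈ S : Finset (Fin n)) :
      Set (Fin n)) ∈ minCuts (Graph.ofSimpleGraph G) := by
    intro S hS
    convert hcut S hS using 1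
    ext v; simp
  have hwA : ∑ x ∈ A, (Finset.univ.filter fun v => ψ v = x).card = n := by
    simp [hw, hψ]
  have hpos : ∀ S, IsTwoCut o μ A S → 0 < ∑ x ∈ S, (Finset.univ.filter fun v => ψ v = x).card := by
    intro S hS
    rw [hw, Finset.card_pos, ← Finset.coe_nonempty]
    exact (hcut' S hS).1.1
  -- For `δ ≤ 6` the bound of two vertices per unit of weight gives at most `12 * n`. Otherwise `D =
  -- δ - 1` is used, and `δ ≤ 2 * (δ - 1)` turns `11 * n` into at most `22 * n`.
  rcases Nat.lt_or_ge G.minDegree 7 with h7 | h7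
  · have h1 := card_le_two_mul hA hpos h04 (by omega)
    rw [hwA] at h1
    have := Nat.mul_le_mul h1 (show G.minDegree ≤ 6 by omega)
    omega
  · have : Nonempty (Fin n) := ⟨⟨0, hn⟩⟩
    have hlt : G.minDegree < n := by
      simpa using (G.minDegree_le_degree ⟨0, hn⟩).trans_lt (G.degree_lt_card_verts ⟨0, hn⟩)
    have h1 := mul_card_le hA hpos h04 (δ := G.minDegree) (D := G.minDegree - 1) h12
      (fun S hS => by rw [hw]; exact card_eq_one_or_minDegree_le (hcut' S hS))
      (fun X Y hX hY _ h3 => by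
        rw [hw] at h3 ⊢
        have he : (Finset.univ.filter fun v => ψ v ∈ Y \ X) =
            (Finset.univ.filter fun v => ψ v ∈ Y) \ (Finset.univ.filter fun v => ψ v ∈ X) := by
          ext v; simp
        rw [he] at h3 ⊢
        exact minDegree_le_card_sdiff h7 (hcut' X hX) (hcut' Y hY) h3)
      (by omega) (by omega) (by omega)
    rw [hwA] at h1
    obtain ⟨t, ht⟩ : ∃ t, G.minDegree = t + 7 := ⟨G.minDegree - 7, by omega⟩
    rw [ht] at h1 ⊢
    have : t + 7 - 1 = t + 6 := rfl
    rw [this] at h1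
    nlinarith [Nat.zero_le (A.card * t)]

end SimpleGraph

end CactusRep

/-! ### Cacti characterized by their cuts of size two. -/

namespace CactusRep

open HalfEdge

namespace Data

variable {n : ℕ} (D : Data n)

/-- The vertex of a half-edge. -/
def own (h : Fin D.m × Bool) : Fin D.k := if h.2 then D.snd h.1 else D.fst h.1

/-- The other half of an edge. -/
def flip (h : Fin D.m × Bool) : Fin D.m × Bool := (h.1, !h.2)

/-- The edge `e` has exactly one end in `S`. -/
def Cross (S : Finset (Fin D.k)) (e : Fin D.m) : Prop := ¬ (D.fst e ∈ S ↔ D.snd e ∈ S)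

instance (S : Finset (Fin D.k)) : DecidablePred (D.Cross S) := fun e => by
  unfold Cross; infer_instance

variable {D} {S : Finset (Fin D.k)}

/-- Of the two halves of a crossing edge exactly one starts inside `S`, so half-edges and edges give
the same count. -/
theorem out_eq_card_cross (S : Finset (Fin D.k)) :
    out D.own D.flip S = (Finset.univ.filter (D.Cross S)).card := by
  refine Finset.card_bij (fun h _ => h.1) ?_ ?_ ?_
  · rintro ⟨e, b⟩ h
    cases b <;> simp [own, flip, Cross] at h ⊢ <;> tauto
  · rintro ⟨e, b⟩ h ⟨e', b'⟩ h' rfl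
    cases b <;> cases b' <;> simp [own, flip] at h h' ⊢ <;> tauto
  · intro e he
    simp only [Cross, Finset.mem_filter, Finset.mem_univ, true_and] at he
    by_cases h1 : D.fst e ∈ S
    · exact ⟨(e, false), by simp [own, flip]; tauto, rfl⟩
    · exact ⟨(e, true), by simp [own, flip]; tauto, rfl⟩

theorem mem_cutEdges_iff {e : Fin D.m} {X : Set (Fin D.k)} :
    e ∈ cutEdges D.graph X ↔ ¬ (D.fst e ∈ X ↔ D.snd e ∈ X) := by
  simp only [cutEdges, graph, Set.mem_ofPred_eq]
  constructor
  · rintro ⟨x, hx, y, hy, ⟨rfl, rfl⟩ | ⟨rfl, rfl⟩⟩ <;> tauto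
  · intro h
    by_cases h1 : D.fst e ∈ X
    · exact ⟨_, h1, D.snd e, by tauto, Or.inl ⟨rfl, rfl⟩⟩
    · exact ⟨D.snd e, by tauto, _, h1, Or.inr ⟨rfl, rfl⟩⟩

theorem cutSize_graph (S : Finset (Fin D.k)) :
    cutSize D.graph (S : Set (Fin D.k)) = out D.own D.flip S := by
  have : cutEdges D.graph (S : Set (Fin D.k)) =
      (Finset.univ.filter (D.Cross S) : Finset (Fin D.m)) := by
    ext e
    rw [mem_cutEdges_iff]
    simp [Cross]
  rw [cutSize, this, Set.encard_coe_eq_coe_finsetCard, out_eq_card_cross]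

theorem isCut_graph_iff : IsCut D.graph (S : Set (Fin D.k)) ↔ S.Nonempty ∧ S ≠ Finset.univ := by
  rw [IsCut, Finset.coe_nonempty]
  refine and_congr_right fun _ => ?_
  rw [show D.graph.vertexSet = ((Finset.univ : Finset (Fin D.k)) : Set (Fin D.k)) by
    simp [graph], Finset.coe_ssubset, Finset.ssubset_univ_iff]

variable (D) in
/-- The simple graph of the edges in `P`. -/
def sub (P : Fin D.m → Prop) : SimpleGraph (Fin D.k) where
  Adj x y := x ≠ y ∧ ∃ e, P e ∧ D.graph.IsLink e x y
  symm := ⟨fun _ _ h => ⟨h.1.symm, h.2.imp fun _ he => ⟨he.1, he.2.symm⟩⟩⟩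
  loopless := ⟨fun _ h => h.1 rfl⟩

/-- Otherwise the set of vertices reachable from `x` is a cut that no edge of `P` crosses. -/
theorem exists_path {P : Fin D.m → Prop} {x y : Fin D.k}
    (h : ∀ S : Finset (Fin D.k), x ∈ S → y ∉ S → ∃ e, P e ∧ D.Cross S e) :
    ∃ p : (D.sub P).Walk x y, p.IsPath := by
  classical
  by_contra hc
  have hr : ¬ (D.sub P).Reachable x y := fun hr => hc hr.exists_isPath
  obtain ⟨e, hP, he⟩ := h (Finset.univ.filter fun v => (D.sub P).Reachable x v) (by simp)
    (by simpa using hr)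
  apply he
  simp only [Finset.mem_filter, Finset.mem_univ, true_and]
  by_cases hne : D.fst e = D.snd e
  · rw [hne]
  have hadj : (D.sub P).Adj (D.fst e) (D.snd e) := ⟨hne, e, hP, Or.inl ⟨rfl, rfl⟩⟩
  exact ⟨fun h => h.trans hadj.reachable, fun h => h.trans hadj.symm.reachable⟩

theorem _root_.Fin.val_succ_mod {l : ℕ} (i : Fin (l + 2)) :
    (i.val < l + 1 ∧ (i + 1).val = i.val + 1) ∨ (i.val = l + 1 ∧ i + 1 = 0) := by
  rcases Nat.lt_or_ge i.val (l + 1) with h | h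
  · left
    exact ⟨h, by rw [Fin.val_add_one_of_lt]; exact Fin.lt_def.2 (by simpa using h)⟩
  · right
    have : i = Fin.last (l + 1) := Fin.ext (by simp; omega)
    subst this
    simp

/-- A path closes up to a cycle. -/
theorem exists_cycle {P : Fin D.m → Prop} {x y : Fin D.k} (p : (D.sub P).Walk x y)
    (hp : p.IsPath) (hxy : x ≠ y) {e : Fin D.m} (he : D.graph.IsLink e y x) (hPe : ¬ P e) :
    ∃ C, IsCycle D.graph C ∧ e ∈ C ∧ ∀ f ∈ C, f = e ∨ P f := by
  classical
  obtain ⟨l, hl⟩ : ∃ l, p.length = l + 1 := by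
    refine ⟨p.length - 1, ?_⟩
    have : p.length ≠ 0 := fun h => hxy (SimpleGraph.Walk.eq_of_length_eq_zero h)
    omega
  have hadj : ∀ i, ∃ f, i < l + 1 → P f ∧ D.graph.IsLink f (p.getVert i) (p.getVert (i + 1)) := by
    intro i
    by_cases hi : i < l + 1
    · obtain ⟨-, f, hf⟩ := p.adj_getVert_succ (hl ▸ hi)
      exact ⟨f, fun _ => hf⟩
    · exact ⟨e, fun h => absurd h hi⟩
  choose g hg using hadj
  have hinj : ∀ i j, i ≤ l + 1 → j ≤ l + 1 → p.getVert i = p.getVert j → i = j :=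
    fun i j hi hj h => hp.getVert_injOn (by simpa [hl] using hi) (by simpa [hl] using hj) h
  -- The path has `l + 1` edges and `l + 2` vertices; the last index carries the closing edge `e`.
  refine ⟨Set.range fun i : Fin (l + 2) => if i.val < l + 1 then g i.val else e,
    ⟨l, fun i => p.getVert i.val, _, fun i j h => Fin.ext (hinj i j (by omega) (by omega) h),
      ?_, ?_, rfl⟩, ⟨Fin.last _, by simp⟩, ?_⟩
  · intro i j h
    simp only at h
    split_ifs at h with hi hj hj
    · have h1 := (hg _ hi).2
      have h2 := (hg _ hj).2
      rw [h] at h1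
      apply Fin.ext
      rcases h1 with ⟨h1, h1'⟩ | ⟨h1, h1'⟩ <;> rcases h2 with ⟨h2, h2'⟩ | ⟨h2, h2'⟩
      · exact hinj _ _ (by omega) (by omega) (h1.symm.trans h2)
      · have a := hinj _ _ (by omega) (by omega) (h1.symm.trans h2)
        have b := hinj _ _ (by omega) (by omega) (h1'.symm.trans h2')
        omega
      · have a := hinj _ _ (by omega) (by omega) (h1.symm.trans h2)
        have b := hinj _ _ (by omega) (by omega) (h1'.symm.trans h2')
        omega
      · have a := hinj _ _ (by omega) (by omega) (h1.symm.trans h2)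
        omega
    · exact absurd (h ▸ (hg _ hi).1) hPe
    · exact absurd (h ▸ (hg _ hj).1) hPe
    · exact Fin.ext (by omega)
  · intro i
    beta_reduce
    rcases i.val_succ_mod with ⟨hi, hi'⟩ | ⟨hi, hi'⟩
    · rw [hi', if_pos hi]
      exact (hg _ hi).2
    · rw [hi', if_neg (by omega), hi, ← hl, p.getVert_length]
      simpa using he
  · rintro f ⟨i, rfl⟩
    simp only
    split_ifs with hi
    · exact Or.inr (hg _ hi).1
    · exact Or.inl rfl

section Cactus

open scoped Fin.CommRing

theorem cross_of_isLink {e : Fin D.m} {x y : Fin D.k} (h : D.graph.IsLink e x y) :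
    D.Cross S e ↔ ¬ (x ∈ S ↔ y ∈ S) := by
  rcases h with ⟨rfl, rfl⟩ | ⟨rfl, rfl⟩
  · rfl
  · rw [Cross, not_iff_not]
    exact Iff.comm

/-- A closed walk that crosses a cut crosses it a second time. -/
theorem exists_second_cross {l : ℕ} {v : Fin (l + 2) → Fin D.k} {c : Fin (l + 2) → Fin D.m}
    (hc : ∀ i, D.graph.IsLink (c i) (v i) (v (i + 1))) {i : Fin (l + 2)}
    (hi : D.Cross S (c i)) : ∃ j ≠ i, D.Cross S (c j) := by
  by_contra! hcon
  -- If no other edge crosses, walking around the cycle from `i + 1` never changes sides; after `l +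
  -- 1` steps the walk is back at `i`, on the wrong side.
  have h1 : ∀ t : ℕ, t ≤ l + 1 → (v (i + 1 + (t : Fin (l + 2))) ∈ S ↔ v (i + 1) ∈ S) := by
    intro t
    induction t with
    | zero => simp
    | succ t ih =>
      intro ht
      rw [← ih (by omega)]
      have hne : i + 1 + (t : Fin (l + 2)) ≠ i := by
        intro h
        have h2 : ((1 + t : ℕ) : Fin (l + 2)) = 0 := by
          push_cast
          rw [add_assoc] at h
          simpa using h
        rw [Fin.natCast_eq_zero] at h2
        exact absurd (Nat.le_of_dvd (by omega) h2) (by omega)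
      have h3 := hcon _ hne
      rw [cross_of_isLink (hc _), not_not] at h3
      rw [h3]
      push_cast
      rw [← add_assoc]
  have h2 := h1 (l + 1) le_rfl
  rw [cross_of_isLink (hc i)] at hi
  have h3 : i + 1 + ((l + 1 : ℕ) : Fin (l + 2)) = i := by
    have : ((l + 2 : ℕ) : Fin (l + 2)) = 0 := Fin.natCast_self _
    rw [add_assoc, show (1 : Fin (l + 2)) + ((l + 1 : ℕ) : Fin (l + 2)) = ((l + 2 : ℕ) : Fin _) by
      push_cast; ring, this, add_zero]
  rw [h3] at h2
  exact hi h2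

theorem eq_or_eq_of_cross (h2 : out D.own D.flip S = 2) {e f g : Fin D.m} (he : D.Cross S e)
    (hf : D.Cross S f) (hef : e ≠ f) (hg : D.Cross S g) : g = e ∨ g = f := by
  by_contra! hc
  rw [out_eq_card_cross] at h2
  have : ({e, f, g} : Finset (Fin D.m)) ⊆ Finset.univ.filter (D.Cross S) := by
    intro x hx
    simp only [Finset.mem_insert, Finset.mem_singleton] at hx
    rcases hx with rfl | rfl | rfl <;> simpa
  have h3 := Finset.card_le_card this
  rw [Finset.card_eq_three.2 ⟨e, f, g, hef, hc.1.symm, hc.2.symm, rfl⟩] at h3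
  omega

/-- A cycle that uses one edge of a two-cut uses a second one, hence both. -/
theorem mem_cycle_of_cross {C : Set (Fin D.m)} (hC : IsCycle D.graph C) {e f : Fin D.m}
    (heC : e ∈ C) (h2 : out D.own D.flip S = 2) (he : D.Cross S e) (hf : D.Cross S f) :
    f ∈ C := by
  obtain ⟨l, v, c, -, hc, hl, rfl⟩ := hC
  obtain ⟨i, rfl⟩ := heC
  obtain ⟨j, hji, hj⟩ := exists_second_cross hl he
  rcases eq_or_eq_of_cross h2 he hj (fun h => hji (hc h).symm) hf with rfl | rfl
  · exact ⟨i, rfl⟩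
  · exact ⟨j, rfl⟩

theorem exists_half {e : Fin D.m} (he : D.Cross S e) :
    ∃ b, D.own (e, b) ∈ S ∧ D.own (D.flip (e, b)) ∉ S := by
  rw [Cross] at he
  by_cases h : D.fst e ∈ S
  · exact ⟨false, by simp [own, flip]; tauto⟩
  · exact ⟨true, by simp [own, flip]; tauto⟩

theorem flip_flip (h : Fin D.m × Bool) : D.flip (D.flip h) = h := by simp [flip]

/-- Consecutive edges of a cycle lie in a common cut of size two. -/
theorem exists_cross_succ (hD : IsHalfCactus D.own D.flip Finset.univ) {l : ℕ}
    {v : Fin (l + 2) → Fin D.k} {c : Fin (l + 2) → Fin D.m} (hv : Function.Injective v)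
    (hc : ∀ i, D.graph.IsLink (c i) (v i) (v (i + 1))) (i : Fin (l + 2)) :
    ∃ S, out D.own D.flip S = 2 ∧ D.Cross S (c i) ∧ D.Cross S (c (i + 1)) := by
  classical
  have hne : v (i + 1) ≠ v i := fun h => by simpa using hv h
  -- Choose the smallest two-cut that has `v (i + 1)` inside and `v i` outside. The second edge of
  -- the cycle that crosses it turns out to be the next one.
  set F := (Finset.univ : Finset (Finset (Fin D.k))).filter fun S =>
    v (i + 1) ∈ S ∧ v i ∉ S ∧ out D.own D.flip S = 2 with hF
  have hFne : F.Nonempty := by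
    obtain ⟨S, -, h1, h2, h3⟩ := hD.sep _ (Finset.mem_univ _) _ (Finset.mem_univ _) hne
    exact ⟨S, by simp [hF, h1, h2, h3]⟩
  obtain ⟨S, hS, hmin⟩ := F.exists_min_image Finset.card hFne
  simp only [hF, Finset.mem_filter, Finset.mem_univ, true_and] at hS hmin
  obtain ⟨h1, h2, h3⟩ := hS
  have hi : D.Cross S (c i) := by rw [cross_of_isLink (hc i)]; tauto
  obtain ⟨j, hji, hj⟩ := exists_second_cross hc hi
  refine ⟨S, h3, hi, ?_⟩
  have hw : ∀ b, D.own (c j, b) = v j ∨ D.own (c j, b) = v (j + 1) := by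
    intro b
    rcases hc j with ⟨ha, hb⟩ | ⟨ha, hb⟩ <;> cases b <;> simp [own, ha, hb]
  obtain ⟨b, hb1, hb2⟩ := exists_half hj
  by_cases hwv : D.own (c j, b) = v (i + 1)
  · rcases hw b with h | h
    · rwa [← hv (h.symm.trans hwv)]
    · exact absurd (add_right_cancel (hv (h.symm.trans hwv))) hji
  -- If the inner end of the second crossing edge is not `v (i + 1)`, a two-cut between these two
  -- vertices cuts a smaller candidate out of `S`.
  · obtain ⟨R, -, hR1, hR2, hR3⟩ :=
      hD.sep _ (Finset.mem_univ (v (i + 1))) _ (Finset.mem_univ (D.own (c j, b))) (Ne.symm hwv)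
    have hRc := hD.isTwoCut_compl (Y := R) ⟨Finset.subset_univ _, hR3⟩
    have h4 := hD.isTwoCut_sdiff (Y := S) ⟨Finset.subset_univ _, h3⟩ hRc hb2
      (by simp [hR2]) ⟨v (i + 1), by simp [h1, hR1]⟩
    have h5 := hmin _ ⟨by simp [h1, hR1], by simp [h2], h4.2⟩
    have h6 : S \ (Finset.univ \ R) ⊂ S := by
      refine Finset.ssubset_iff_subset_ne.2 ⟨Finset.sdiff_subset, fun h => ?_⟩
      rw [← h] at hb1
      simp [hR2] at hb1
    exact absurd (Finset.card_lt_card h6) (by omega)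

/-- Follow the first cycle edge by edge: consecutive edges lie in a common two-cut, and the second
cycle contains both edges of any two-cut that it meets. This gives the uniqueness of the cycle
through an edge. -/
theorem cycle_subset (hD : IsHalfCactus D.own D.flip Finset.univ) {C C' : Set (Fin D.m)}
    (hC : IsCycle D.graph C) (hC' : IsCycle D.graph C') {e : Fin D.m} (he : e ∈ C)
    (he' : e ∈ C') : C ⊆ C' := by
  obtain ⟨l, v, c, hv, -, hl, rfl⟩ := hC
  obtain ⟨i, rfl⟩ := he
  have h : ∀ t : ℕ, c (i + (t : Fin (l + 2))) ∈ C' := by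
    intro t
    induction t with
    | zero => simpa using he'
    | succ t ih =>
      obtain ⟨S, h2, h3, h4⟩ := exists_cross_succ hD hv hl (i + (t : Fin (l + 2)))
      have := mem_cycle_of_cross hC' ih h2 h3 h4
      rw [add_assoc] at this
      simpa using this
  rintro _ ⟨j, rfl⟩
  have := h (j - i).val
  rwa [Fin.cast_val_eq_self, add_sub_cancel] at this

theorem exists_cross_ne (h : 2 ≤ out D.own D.flip S) (e : Fin D.m) : ∃ f ≠ e, D.Cross S f := by
  rw [out_eq_card_cross] at h
  obtain ⟨f, hf, hne⟩ := Finset.exists_mem_ne (show 1 < _ from h) e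
  exact ⟨f, hne, by simpa using hf⟩

theorem two_le_out (h : ∀ X, IsCut D.graph X → 2 ≤ cutSize D.graph X) (hne : S.Nonempty)
    (hne' : S ≠ Finset.univ) : 2 ≤ out D.own D.flip S := by
  have := h S (isCut_graph_iff.2 ⟨hne, hne'⟩)
  rw [cutSize_graph] at this
  exact_mod_cast this

/-- Let `e` be the first edge of a path from `x` to `y`, and `f` the other edge at `x` of the unique
cycle through `e`. Without `e` and `f`, the other end `u` of `e` is still connected to `y` along the
path but no longer to `x`, since otherwise a cycle through `e` would avoid `f`. So the component of
`u` is left by at most the two edges `e` and `f`. -/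
theorem exists_sep_of_isCactus (hD : IsCactus D.graph) {x y : Fin D.k} (hxy : x ≠ y) :
    ∃ S : Finset (Fin D.k), x ∈ S ∧ y ∉ S ∧ out D.own D.flip S = 2 := by
  classical
  have h2 : ∀ S : Finset (Fin D.k), S.Nonempty → S ≠ Finset.univ → 2 ≤ out D.own D.flip S :=
    fun S => two_le_out hD.two_le_cutSize
  obtain ⟨p, hp⟩ := exists_path (D := D) (P := fun _ => True) (x := x) (y := y)
    fun S hx hy => by
      have h := h2 S ⟨x, hx⟩ (fun hc => hy (hc ▸ Finset.mem_univ y))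
      rw [out_eq_card_cross] at h
      obtain ⟨e, he⟩ := Finset.card_pos.1 (Nat.zero_lt_of_lt h)
      exact ⟨e, trivial, by simpa using he⟩
  cases p with
  | nil => exact absurd rfl hxy
  | @cons _ u _ hadj p =>
    rw [SimpleGraph.Walk.cons_isPath_iff] at hp
    obtain ⟨hxu, e, -, he⟩ := hadj
    obtain ⟨C, ⟨hC, heC⟩, huniq⟩ := hD.existsUnique_cycle e ⟨_, _, he⟩
    have hC0 := hC
    obtain ⟨l, v, c, hv, hc, hl, hCr⟩ := hC
    obtain ⟨f, hfC, hfe, z, hf⟩ : ∃ f ∈ C, f ≠ e ∧ ∃ z, D.graph.IsLink f x z := by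
      rw [hCr] at heC
      obtain ⟨i, rfl⟩ := heC
      rcases (hl i).left_eq_or_eq he with h | h
      · refine ⟨c (i - 1), hCr ▸ ⟨_, rfl⟩, fun h' => by simpa using hc h', v (i - 1), ?_⟩
        have := hl (i - 1)
        rw [sub_add_cancel, h] at this
        exact this.symm
      · refine ⟨c (i + 1), hCr ▸ ⟨_, rfl⟩, fun h' => by simpa using hc h', v (i + 1 + 1), ?_⟩
        have h3 : v (i + 1) = x := by
          rcases (hl i).right_eq_or_eq he with h4 | h4
          · exact h4
          · have := hv (h.trans h4.symm)
            simp at this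
        rw [← h3]
        exact hl (i + 1)
    set P : Fin D.m → Prop := fun g => g ≠ e ∧ g ≠ f with hP
    set S : Finset (Fin D.k) := Finset.univ.filter fun a => (D.sub P).Reachable u a with hS
    have hxS : x ∉ S := by
      simp only [hS, Finset.mem_filter, Finset.mem_univ, true_and]
      intro hr
      obtain ⟨q, hq⟩ := hr.exists_isPath
      obtain ⟨C', hC', heC', hfC'⟩ := exists_cycle q hq hxu.symm he (by simp [hP])
      have := huniq C' ⟨hC', heC'⟩
      subst this
      rcases hfC' f hfC with h | h
      · exact hfe h
      · exact h.2 rfl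
    have hyS : y ∈ S := by
      simp only [hS, Finset.mem_filter, Finset.mem_univ, true_and]
      have hx : ∀ a b (q : (D.sub fun _ => True).Walk a b), x ∉ q.support →
          (D.sub P).Reachable a b := by
        intro a b q
        induction q with
        | nil => exact fun _ => SimpleGraph.Reachable.refl _
        | @cons a b _ hab q ih =>
          intro hx
          rw [SimpleGraph.Walk.support_cons, List.mem_cons, not_or] at hx
          refine SimpleGraph.Reachable.trans (SimpleGraph.Adj.reachable ?_) (ih hx.2)
          obtain ⟨hne, g, -, hg⟩ := hab
          have hbx : x ≠ b := fun h => hx.2 (h ▸ q.start_mem_support)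
          refine ⟨hne, g, ⟨?_, ?_⟩, hg⟩
          · rintro rfl
            rcases he.left_eq_or_eq hg with h | h
            · exact hx.1 h
            · exact hbx h
          · rintro rfl
            rcases hf.left_eq_or_eq hg with h | h
            · exact hx.1 h
            · exact hbx h
      exact hx _ _ p hp.2
    have hle : out D.own D.flip S ≤ 2 := by
      rw [out_eq_card_cross]
      refine (Finset.card_le_card (t := {e, f}) fun g hg => ?_).trans Finset.card_le_two
      simp only [Finset.mem_filter, Finset.mem_univ, true_and] at hg
      by_contra hgef
      simp only [Finset.mem_insert, Finset.mem_singleton, not_or] at hgef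
      apply hg
      simp only [hS, Finset.mem_filter, Finset.mem_univ, true_and]
      by_cases hne : D.fst g = D.snd g
      · rw [hne]
      have hadj : (D.sub P).Adj (D.fst g) (D.snd g) := ⟨hne, g, hgef, Or.inl ⟨rfl, rfl⟩⟩
      exact ⟨fun h => h.trans hadj.reachable, fun h => h.trans hadj.symm.reachable⟩
    have hge := h2 Sᶜ ⟨x, by simp [hxS]⟩ (fun hc => by
      have := Finset.mem_univ y; rw [← hc] at this; simp [hyS] at this)
    have heq : out D.own D.flip Sᶜ = out D.own D.flip S := by
      rw [out_eq_card_cross, out_eq_card_cross]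
      congr 1
      ext g
      simp [Cross, not_iff_not]
    exact ⟨Sᶜ, by simp [hxS], by simp [hyS], by omega⟩

/-- Cacti are the loopless multigraphs in which all cuts have size at least two and any two
vertices are separated by a cut of size two. -/
theorem isCactus_iff : IsCactus D.graph ↔
    (∀ e, D.fst e ≠ D.snd e) ∧ IsHalfCactus D.own D.flip Finset.univ := by
  classical
  constructor
  · intro h
    refine ⟨fun e he => h.loopless.not_isLoopAt e (D.fst e) (Or.inl ⟨rfl, he.symm⟩), ?_, ?_, ?_,
      ?_, ?_⟩
    · obtain ⟨x, -⟩ := h.nonempty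
      exact ⟨x, Finset.mem_univ x⟩
    · simp
    · exact fun h _ => flip_flip h
    · exact fun S _ => two_le_out h.two_le_cutSize
    · intro x _ y _ hxy
      obtain ⟨S, h1, h2, h3⟩ := exists_sep_of_isCactus h hxy
      exact ⟨S, Finset.subset_univ _, h1, h2, h3⟩
  · rintro ⟨hl, hD⟩
    refine ⟨?_, ?_, ⟨?_⟩, ?_⟩
    · obtain ⟨x, -⟩ := hD.nonempty
      exact ⟨x, trivial⟩
    · intro X hX
      have hXe : X = (X.toFinset : Set (Fin D.k)) := by simp
      rw [hXe] at hX ⊢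
      rw [cutSize_graph]
      rw [isCut_graph_iff] at hX
      exact_mod_cast hD.two_le _ (Finset.subset_univ _) hX.1 hX.2
    · rintro e x (⟨h1, h2⟩ | ⟨h1, h2⟩) <;> exact hl e (h1.trans h2.symm)
    · intro e _
      -- Every cut that `e` crosses has another edge, so the ends of `e` are still joined by a path
      -- that avoids `e`.
      obtain ⟨p, hp⟩ := exists_path (D := D) (P := fun f => f ≠ e) (x := D.snd e) (y := D.fst e)
        fun S hx hy => exists_cross_ne (hD.two_le S (Finset.subset_univ _) ⟨_, hx⟩
          (fun hc => hy (hc ▸ Finset.mem_univ _))) e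
      obtain ⟨C, hC, heC, -⟩ :=
        exists_cycle p hp (hl e).symm (e := e) (Or.inl ⟨rfl, rfl⟩) (by simp)
      exact ⟨C, ⟨hC, heC⟩, fun C' h => (cycle_subset hD h.1 hC h.2 heC).antisymm
        (cycle_subset hD hC h.1 heC h.2)⟩

/-- The minimum cuts of a cactus are its cuts of size two. -/
theorem mem_minCuts_iff (hD : IsHalfCactus D.own D.flip Finset.univ) :
    (S : Set (Fin D.k)) ∈ minCuts D.graph ↔ out D.own D.flip S = 2 := by
  classical
  constructor
  · rintro ⟨h1, h2⟩
    rw [isCut_graph_iff] at h1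
    have h3 := hD.two_le S (Finset.subset_univ _) h1.1 h1.2
    obtain ⟨x, hx⟩ := h1.1
    obtain ⟨y, -, hy⟩ := Finset.exists_of_ssubset (Finset.ssubset_univ_iff.2 h1.2)
    obtain ⟨T, -, hxT, hyT, hT⟩ := hD.sep x (Finset.mem_univ _) y (Finset.mem_univ _)
      (fun h => hy (h ▸ hx))
    have h4 := h2 T (isCut_graph_iff.2 ⟨⟨x, hxT⟩, fun hc => hyT (hc ▸ Finset.mem_univ _)⟩)
    rw [cutSize_graph, cutSize_graph, Nat.cast_le] at h4
    omega
  · intro h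
    have hS : IsTwoCut D.own D.flip Finset.univ S := ⟨Finset.subset_univ _, h⟩
    refine ⟨isCut_graph_iff.2 ⟨hS.nonempty, hD.ne_of_isTwoCut hS⟩, fun Y hY => ?_⟩
    have hYe : Y = (Y.toFinset : Set (Fin D.k)) := by simp
    rw [hYe] at hY ⊢
    rw [isCut_graph_iff] at hY
    rw [cutSize_graph, cutSize_graph, h]
    exact_mod_cast hD.two_le _ (Finset.subset_univ _) hY.1 hY.2

end Cactus

end Data

end CactusRep

/-! ### Contractions that keep all non-trivial min-cuts. -/

namespace CactusRep

open HalfEdge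

namespace Data

variable {n : ℕ} {D : Data n} {G : SimpleGraph (Fin n)}

/-- Redirect the vertices over `x` to `z`. -/
def merge {V : Type*} [DecidableEq V] (π : V → V) (x z v : V) : V := if π v = x then z else π v

/-- The half-edge structure `μ` on `A` is a contraction of the multigraph of `D` along `π` that
still represents all non-trivial minimum cuts of `G`. -/
structure IsReduction (D : Data n) (G : SimpleGraph (Fin n)) (μ : Fin D.m × Bool → Fin D.m × Bool)
    (A : Finset (Fin D.k)) (π : Fin D.k → Fin D.k) : Prop where
  cactus : IsHalfCactus D.own μ A
  mem : ∀ v, π v ∈ A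
  fix : ∀ v ∈ A, π v = v
  out_eq : ∀ S ⊆ A, out D.own μ S = out D.own D.flip (Finset.univ.filter fun v => π v ∈ S)
  exists_cut : ∀ X ∈ nontrivialMinCuts (Graph.ofSimpleGraph G),
    ∃ S, IsTwoCut D.own μ A S ∧ X = (fun v => π (D.map v)) ⁻¹' S
  minCut : ∀ S, IsTwoCut D.own μ A S →
    (fun v => π (D.map v)) ⁻¹' S ∈ minCuts (Graph.ofSimpleGraph G)

variable {μ : Fin D.m × Bool → Fin D.m × Bool} {A : Finset (Fin D.k)} {π : Fin D.k → Fin D.k}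

theorem Represents.isReduction (h : D.Represents G (minCuts (Graph.ofSimpleGraph G))) :
    IsReduction D G D.flip Finset.univ id := by
  classical
  obtain ⟨-, hc⟩ := isCactus_iff.1 h.isCactus
  refine ⟨hc, by simp, by simp, by simp, fun X hX => ?_, fun S hS => ?_⟩
  · obtain ⟨Y, hY, hXY⟩ := h.exists_minCut X hX.1
    have hYe : Y = (Y.toFinset : Set (Fin D.k)) := by simp
    rw [hYe, mem_minCuts_iff hc] at hY
    exact ⟨Y.toFinset, ⟨Finset.subset_univ _, hY⟩, by simp [hXY]⟩
  · exact h.preimage_mem S ((mem_minCuts_iff hc).2 hS.2)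

namespace IsReduction

variable {x z : Fin D.k} {σ : Fin D.m × Bool → Fin D.m × Bool}

/-- Sets of remaining vertices correspond to sets that do not separate `x` from `z`, with equal
sizes of cuts and equal preimages. What can be lost is a cut represented only by sets that separate
`x` from `z`, and `hkeep` rules this out. -/
theorem splice (hR : IsReduction D G μ A π) (hσ : IsPairing D.own μ x z σ) (hxz : x ≠ z)
    (hlx : ∀ h, D.own h = x → D.own (μ h) ≠ x) (hx : x ∈ A) {h : Fin D.m × Bool}
    (hh : D.own h = x) (hhz : D.own (μ h) = z)
    (hkeep : ∀ X ∈ nontrivialMinCuts (Graph.ofSimpleGraph G), ∃ S, IsTwoCut D.own μ A S ∧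
      (x ∈ S ↔ z ∈ S) ∧ X = (fun v => π (D.map v)) ⁻¹' S) :
    IsReduction D G (splice D.own μ x σ) (A.erase x) (merge π x z) := by
  have hz : z ∈ A := hhz ▸ hR.cactus.mem h (hh ▸ hx)
  have hpre : ∀ (S : Finset (Fin D.k)), (x ∈ S ↔ z ∈ S) → ∀ v,
      merge π x z v ∈ S.erase x ↔ π v ∈ S := by
    intro S hS v
    unfold merge
    split_ifs with h1
    · simp [h1, hxz.symm, hS]
    · simp [h1]
  have hlift : ∀ S ⊆ A.erase x, ∃ T ⊆ A, (x ∈ T ↔ z ∈ T) ∧ S = T.erase x := by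
    intro S hS
    have hxS : x ∉ S := fun hc => by simpa using hS hc
    have hSA := hS.trans (Finset.erase_subset _ _)
    by_cases hzS : z ∈ S
    · exact ⟨insert x S, Finset.insert_subset hx hSA, by simp [hzS],
        (Finset.erase_insert hxS).symm⟩
    · exact ⟨S, hSA, by simp [hzS, hxS], (Finset.erase_eq_of_notMem hxS).symm⟩
  refine ⟨hR.cactus.splice hσ hxz hlx hx hh hhz, fun v => ?_, fun v hv => ?_, fun S hS => ?_,
    fun X hX => ?_, fun S hS => ?_⟩
  · unfold merge
    split_ifs with h1
    · simp [hxz.symm, hz]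
    · simp [h1, hR.mem v]
  · rw [Finset.mem_erase] at hv
    simp [merge, hR.fix v hv.2, hv.1]
  · obtain ⟨T, hT, hxT, rfl⟩ := hlift S hS
    rw [out_splice hR.cactus hσ hlx hT hxT, hR.out_eq T hT]
    simp only [hpre T hxT]
  · obtain ⟨S, hS, hxS, rfl⟩ := hkeep X hX
    refine ⟨S.erase x, ⟨Finset.erase_subset_erase x hS.1, ?_⟩, ?_⟩
    · rw [out_splice hR.cactus hσ hlx hS.1 hxS, hS.2]
    · ext v
      exact (hpre S hxS _).symm
  · obtain ⟨T, hT, hxT, rfl⟩ := hlift S hS.1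
    have h2 := hS.2
    rw [out_splice hR.cactus hσ hlx hT hxT] at h2
    have h3 : (fun v => merge π x z (D.map v)) ⁻¹' (T.erase x : Finset (Fin D.k)) =
        (fun v => π (D.map v)) ⁻¹' T := by
      ext v
      exact hpre T hxT _
    rw [h3]
    exact hR.minCut T ⟨hT, h2⟩

theorem out_sdiff_compl (hR : IsReduction D G μ A π) (hx : x ∈ A) {S : Finset (Fin D.k)}
    (hS : S ⊆ A) :
    out D.own μ (insert x S) = out D.own μ ((A \ S).erase x) := by
  rw [← hR.cactus.out_compl (Finset.insert_subset hx hS)]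
  congr 1
  ext y
  simp only [Finset.mem_sdiff, Finset.mem_insert, Finset.mem_erase]
  tauto

/-- A vertex of degree four without weight can be split off at a double edge. -/
theorem keep_of_empty (hR : IsReduction D G μ A π) (hx : x ∈ A)
    (hemp : ∀ v, π (D.map v) ≠ x)
    {h₀ h₁ h₂ h₃ : Fin D.m × Bool} (hne : h₀ ≠ h₁)
    (hmem : ∀ h, D.own h = x ↔ h = h₀ ∨ h = h₁ ∨ h = h₂ ∨ h = h₃)
    (hz₀ : D.own (μ h₀) = z) (hz₁ : D.own (μ h₁) = z) :
    ∀ X ∈ nontrivialMinCuts (Graph.ofSimpleGraph G), ∃ S, IsTwoCut D.own μ A S ∧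
      (x ∈ S ↔ z ∈ S) ∧ X = (fun v => π (D.map v)) ⁻¹' S := by
  have hx₀ := (hmem h₀).2 (by simp)
  have hx₁ := (hmem h₁).2 (by simp)
  have hz : z ∈ A := hz₀ ▸ hR.cactus.mem h₀ (hx₀ ▸ hx)
  -- The two parallel edges are all edges that leave `T`. Without `x` they no longer leave, and only
  -- the other two edges at `x` can take their place. The preimage of `T` is non-empty and
  -- unaffected by `x`, so `T.erase x` is non-empty.
  have key : ∀ T, IsTwoCut D.own μ A T → x ∈ T → z ∉ T →
      IsTwoCut D.own μ A (T.erase x) := by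
    intro T hT hxT hzT
    have hTx : T.erase x ⊆ A := (Finset.erase_subset _ _).trans hT.1
    refine ⟨hTx, ?_⟩
    have hle : out D.own μ (T.erase x) ≤ 2 := by
      refine (Finset.card_le_card (t := {μ h₂, μ h₃}) fun h hh => ?_).trans Finset.card_le_two
      simp only [Finset.mem_filter, Finset.mem_univ, true_and, Finset.mem_erase, not_and] at hh
      have hhA := hT.1 hh.1.2
      by_cases h1 : D.own (μ h) = x
      · have h2 := hR.cactus.invol h hhA
        rcases (hmem _).1 h1 with h3 | h3 | h3 | h3
        · rw [h3] at h2
          exact absurd (by rw [← hz₀, h2]; exact hh.1.2) hzT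
        · rw [h3] at h2
          exact absurd (by rw [← hz₁, h2]; exact hh.1.2) hzT
        · simp [← h3, h2]
        · simp [← h3, h2]
      · exfalso
        have h2 := hT.2
        have : ({h, h₀, h₁} : Finset (Fin D.m × Bool)) ⊆
            Finset.univ.filter fun h => D.own h ∈ T ∧ D.own (μ h) ∉ T := by
          intro e he
          simp only [Finset.mem_insert, Finset.mem_singleton] at he
          rcases he with rfl | rfl | rfl
          · simp [hh.1.2, hh.2 h1]
          · simp [hx₀, hxT, hz₀, hzT]
          · simp [hx₁, hxT, hz₁, hzT]
        have h4 := Finset.card_le_card this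
        rw [Finset.card_eq_three.2 ⟨h, h₀, h₁, fun hc => hh.1.1 (hc ▸ hx₀),
          fun hc => hh.1.1 (hc ▸ hx₁), hne, rfl⟩] at h4
        rw [out] at h2
        omega
    have hge := hR.cactus.two_le (T.erase x) hTx ?_
      (fun hc => by have := hc ▸ hx; simp at this)
    · omega
    · obtain ⟨v, hv⟩ := (hR.minCut T hT).1.1
      exact ⟨_, Finset.mem_erase.2 ⟨hemp v, hv⟩⟩
  intro X hX
  obtain ⟨S, hS, rfl⟩ := hR.exists_cut X hX
  by_cases hxS : x ∈ S <;> by_cases hzS : z ∈ S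
  · exact ⟨S, hS, by simp [hxS, hzS], rfl⟩
  · refine ⟨S.erase x, key S hS hxS hzS, by simp [hzS], ?_⟩
    ext v
    simp [hemp v]
  · have h1 := (key (A \ S) (hR.cactus.isTwoCut_compl hS) (by simp [hx, hxS]) (by simp [hzS])).2
    rw [← hR.out_sdiff_compl hx hS.1] at h1
    refine ⟨insert x S, ⟨Finset.insert_subset hx hS.1, h1⟩, by simp [hzS], ?_⟩
    ext v
    simp [hemp v]
  · exact ⟨S, hS, by simp [hxS, hzS], rfl⟩

/-- A vertex of degree two and weight one can be split off at a double edge. -/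
theorem keep_of_leaf (hR : IsReduction D G μ A π) (hx : x ∈ A)
    (hone : (Finset.univ.filter fun v => π (D.map v) = x).card = 1)
    (hz : ∀ h, D.own h = x → D.own (μ h) = z) :
    ∀ X ∈ nontrivialMinCuts (Graph.ofSimpleGraph G), ∃ S, IsTwoCut D.own μ A S ∧
      (x ∈ S ↔ z ∈ S) ∧ X = (fun v => π (D.map v)) ⁻¹' S := by
  have hpre : ((fun v => π (D.map v)) ⁻¹' {x}).encard = 1 := by
    have : (fun v => π (D.map v)) ⁻¹' {x} =
        ((Finset.univ.filter fun v => π (D.map v) = x : Finset (Fin n)) : Set (Fin n)) := by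
      ext v; simp
    rw [this, Set.encard_coe_eq_coe_finsetCard, hone]
    rfl
  -- The edges at `x` are already all edges that leave `T`, so no edge would leave the rest of `T`;
  -- hence there is no rest.
  have key : ∀ T, IsTwoCut D.own μ A T → x ∈ T → z ∉ T → T = {x} := by
    intro T hT hxT hzT
    have hTx : T.erase x ⊆ A := (Finset.erase_subset _ _).trans hT.1
    by_contra hne
    have hnonempty : (T.erase x).Nonempty := by
      rw [Finset.nonempty_iff_ne_empty]
      intro hc
      rw [Finset.erase_eq_empty_iff] at hc
      rcases hc with rfl | hc
      · simp at hxT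
      · exact hne hc
    have hge := hR.cactus.two_le (T.erase x) hTx hnonempty
      (fun hc => by have := hc ▸ hx; simp at this)
    have hx2 := hR.cactus.two_le {x} (by simpa using hx) (by simp) fun hc => hne <|
      Finset.eq_singleton_iff_unique_mem.2
        ⟨hxT, fun y hy => by have := hT.1 hy; rw [← hc] at this; simpa using this⟩
    have hsub := Finset.eq_of_subset_of_card_le
      (s := Finset.univ.filter fun h => D.own h ∈ ({x} : Finset _) ∧
        D.own (μ h) ∉ ({x} : Finset _))
      (t := Finset.univ.filter fun h => D.own h ∈ T ∧ D.own (μ h) ∉ T) (fun h hh => by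
        simp only [Finset.mem_filter, Finset.mem_univ, true_and, Finset.mem_singleton] at hh ⊢
        rw [hh.1, hz h hh.1]
        exact ⟨hxT, hzT⟩) (by rw [← out, ← out, hT.2]; exact hx2)
    have h0 : out D.own μ (T.erase x) = 0 := by
      rw [out, Finset.card_eq_zero, Finset.filter_eq_empty_iff]
      rintro h - ⟨h1, h2⟩
      have h3 : D.own (μ h) ≠ x := fun h4 => by
        have h5 := hz _ h4
        rw [hR.cactus.invol h (hTx h1)] at h5
        rw [h5] at h1
        exact hzT (Finset.mem_of_mem_erase h1)
      have h4 := (Finset.ext_iff.1 hsub h).2 (by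
        simp only [Finset.mem_filter, Finset.mem_univ, true_and]
        exact ⟨Finset.mem_of_mem_erase h1, fun h5 => h2 (Finset.mem_erase.2 ⟨h3, h5⟩)⟩)
      simp only [Finset.mem_filter, Finset.mem_singleton] at h4
      simp [h4.2.1] at h1
    omega
  intro X hX
  obtain ⟨S, hS, rfl⟩ := hR.exists_cut X hX
  by_cases hxS : x ∈ S <;> by_cases hzS : z ∈ S
  · exact ⟨S, hS, by simp [hxS, hzS], rfl⟩
  · exfalso
    have := key S hS hxS hzS
    subst this
    exact hX.2.1 (by simpa using hpre)
  · exfalso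
    have := key (A \ S) (hR.cactus.isTwoCut_compl hS) (by simp [hx, hxS]) (by simp [hzS])
    apply hX.2.2
    rw [← hpre]
    congr 1
    ext v
    have h1 := Finset.ext_iff.1 this (π (D.map v))
    simp only [Finset.mem_sdiff, hR.mem, true_and, Finset.mem_singleton] at h1
    simp [Graph.ofSimpleGraph, h1]
  · exact ⟨S, hS, by simp [hxS, hzS], rfl⟩

end IsReduction

end Data

end CactusRep

/-! ### The two passes of contractions. -/

namespace CactusRep

open HalfEdge

namespace Data

variable {n : ℕ} {D : Data n} {G : SimpleGraph (Fin n)}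

/-- The degree of a vertex. -/
def deg (D : Data n) (x : Fin D.k) : ℕ := (Finset.univ.filter fun h => D.own h = x).card

/-- The number of elements of `{0, …, n - 1}` that `ψ` maps to a vertex. -/
def weight {k : ℕ} (ψ : Fin n → Fin k) (x : Fin k) : ℕ :=
  (Finset.univ.filter fun v => ψ v = x).card

/-- The permutation that exchanges `a` with `b` and `c` with `d`. -/
def swapPairs {H : Type*} [DecidableEq H] (a b c d h : H) : H :=
  if h = a then b else if h = b then a else if h = c then d else if h = d then c else h

/-- The state after the vertices below `j` were considered for being split off as superfluous
vertices of degree four. -/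
structure SuppressInv (D : Data n) (G : SimpleGraph (Fin n)) (j : ℕ)
    (μ : Fin D.m × Bool → Fin D.m × Bool) (A : Finset (Fin D.k)) (π : Fin D.k → Fin D.k) :
    Prop where
  red : IsReduction D G μ A π
  loopless : ∀ h, D.own h ∈ A → D.own (μ h) ≠ D.own h
  map_fix : ∀ v, π (D.map v) = D.map v
  todo : ∀ y : Fin D.k, j ≤ y → y ∈ A
  done : ∀ y ∈ A, y.val < j → weight D.map y = 0 → D.deg y = 4 →
    ∀ h h', D.own h = y → D.own h' = y → h ≠ h' → D.own (μ h) ≠ D.own (μ h')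

variable {j : ℕ} {μ : Fin D.m × Bool → Fin D.m × Bool} {A : Finset (Fin D.k)}
  {π : Fin D.k → Fin D.k}

theorem own_flip_ne (h : ∀ e, D.fst e ≠ D.snd e) (a : Fin D.m × Bool) :
    D.own (D.flip a) ≠ D.own a := by
  obtain ⟨e, b⟩ := a
  cases b
  · simpa [own, flip] using (h e).symm
  · simpa [own, flip] using h e

namespace SuppressInv

theorem init (h : D.Represents G (minCuts (Graph.ofSimpleGraph G))) :
    SuppressInv D G 0 D.flip Finset.univ id where
  red := h.isReduction
  loopless a _ := own_flip_ne (isCactus_iff.1 h.isCactus).1 a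
  map_fix _ := rfl
  todo y _ := Finset.mem_univ y
  done y _ hy := absurd hy (by simp)

theorem skip (hI : SuppressInv D G j μ A π) {x : Fin D.k} (hx : x.val = j)
    (h : weight D.map x = 0 → D.deg x = 4 →
      ∀ h h', D.own h = x → D.own h' = x → h ≠ h' → D.own (μ h) ≠ D.own (μ h')) :
    SuppressInv D G (j + 1) μ A π where
  red := hI.red
  loopless := hI.loopless
  map_fix := hI.map_fix
  todo y hy := hI.todo y (by omega)
  done y hyA hy := by
    rcases Nat.lt_or_ge y j with h1 | h1
    · exact hI.done y hyA h1
    · have : y = x := Fin.ext (by omega)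
      exact this ▸ h

/-- The half-edges to `z` are paired with the other two. By `no_third_path` those do not lead to
`z`, so no loop arises. A vertex treated earlier gets no parallel edges either: they would come from
a path of length two between `x` and `z` beside the double edge. As `x` has weight zero, no vertex
of `G` changes its image. -/
theorem step (hI : SuppressInv D G j μ A π) {x z : Fin D.k} (hx : x.val = j)
    (hw : weight D.map x = 0) {h₀ h₁ h₂ h₃ : Fin D.m × Bool} (h01 : h₀ ≠ h₁) (h02 : h₀ ≠ h₂)
    (h03 : h₀ ≠ h₃) (h12 : h₁ ≠ h₂) (h13 : h₁ ≠ h₃) (h23 : h₂ ≠ h₃)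
    (hmem : ∀ h, D.own h = x ↔ h = h₀ ∨ h = h₁ ∨ h = h₂ ∨ h = h₃)
    (hz₀ : D.own (μ h₀) = z) (hz₁ : D.own (μ h₁) = z) :
    SuppressInv D G (j + 1) (splice D.own μ x (swapPairs h₀ h₂ h₁ h₃)) (A.erase x)
      (merge π x z) := by
  have hxA := hI.todo x hx.ge
  have hA := hI.red.cactus
  have hx₀ := (hmem h₀).2 (by simp)
  have hx₁ := (hmem h₁).2 (by simp)
  have hx₂ := (hmem h₂).2 (by simp)
  have hx₃ := (hmem h₃).2 (by simp)
  have hxz : x ≠ z := fun hc => hI.loopless h₀ (hx₀ ▸ hxA) (by rw [hz₀, hx₀, hc])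
  have hemp : ∀ v, D.map v ≠ x := by
    intro v hv
    rw [weight, Finset.card_eq_zero, Finset.filter_eq_empty_iff] at hw
    exact hw (Finset.mem_univ v) hv
  have s0 : swapPairs h₀ h₂ h₁ h₃ h₀ = h₂ := by simp [swapPairs]
  have s1 : swapPairs h₀ h₂ h₁ h₃ h₁ = h₃ := by simp [swapPairs, h01.symm, h12]
  have s2 : swapPairs h₀ h₂ h₁ h₃ h₂ = h₀ := by simp [swapPairs, h02.symm]
  have s3 : swapPairs h₀ h₂ h₁ h₃ h₃ = h₁ := by
    simp [swapPairs, h03.symm, h13.symm, h23.symm]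
  have hσ : IsPairing D.own μ x z (swapPairs h₀ h₂ h₁ h₃) := by
    constructor
    · intro h hh
      rcases (hmem h).1 hh with rfl | rfl | rfl | rfl <;> simp only [s0, s1, s2, s3] <;>
        assumption
    · intro h hh
      rcases (hmem h).1 hh with rfl | rfl | rfl | rfl <;> simp only [s0, s1, s2, s3]
    · intro h hh
      rcases (hmem h).1 hh with rfl | rfl | rfl | rfl <;> simp only [s0, s1, s2, s3] <;> tauto
  have hlx : ∀ h, D.own h = x → D.own (μ h) ≠ x := fun h hh hc =>
    hI.loopless h (hh ▸ hxA) (by rw [hc, hh])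
  have hno : ∀ {q e f}, D.own e = x → D.own (μ e) = q →
      (q ≠ z → D.own f = q ∧ D.own (μ f) = z) → (q = z → e ≠ h₀ ∧ e ≠ h₁) → q ≠ x → False :=
    fun he hq hf hqz hqx => hA.no_third_path hxA hxz h01 hx₀ hx₁ hz₀ hz₁ he hq hf hqz hqx
  have h2z : D.own (μ h₂) ≠ z := fun hc => hno (f := h₀) hx₂ hc (fun h => absurd rfl h)
    (fun _ => ⟨h02.symm, h12.symm⟩) hxz.symm
  have h3z : D.own (μ h₃) ≠ z := fun hc => hno (f := h₀) hx₃ hc (fun h => absurd rfl h)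
    (fun _ => ⟨h03.symm, h13.symm⟩) hxz.symm
  have hσz : ∀ e, D.own e = x → D.own (μ e) = z →
      D.own (μ (swapPairs h₀ h₂ h₁ h₃ e)) ≠ z := by
    intro e he hez
    rcases (hmem e).1 he with rfl | rfl | rfl | rfl
    · rwa [s0]
    · rwa [s1]
    · exact absurd hez h2z
    · exact absurd hez h3z
  refine ⟨hI.red.splice hσ hxz hlx hxA hx₀ hz₀
    (hI.red.keep_of_empty hxA (fun v => by rw [hI.map_fix]; exact hemp v) h01 hmem hz₀ hz₁),
    ?_, ?_, ?_, ?_⟩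
  · intro h hh
    have hhA := Finset.mem_of_mem_erase hh
    unfold splice
    split_ifs with h1
    · intro hc
      have h2 := hA.invol h hhA
      rcases hσ.link _ h1 with h3 | h3
      · refine hσz _ h1 h3 ?_
        rw [hc, ← h2, h3]
      · rw [hc] at h3
        refine hσz _ h1 (by rw [h2, h3]) (by rw [hc, h3])
    · exact hI.loopless h hhA
  · intro v
    rw [merge, hI.map_fix, if_neg (hemp v)]
  · intro y hy
    exact Finset.mem_erase.2 ⟨fun hc => by omega, hI.todo y (by omega)⟩
  · intro y hyA hy hwy hdy
    rw [Finset.mem_erase] at hyA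
    have hyx : y.val ≠ x.val := fun hc => hyA.1 (Fin.ext hc)
    have hdone := hI.done y hyA.2 (by omega) hwy hdy
    -- Suppose a redirected half-edge becomes parallel to an old one. For `y = z` their common end
    -- `q` is adjacent to both `x` and `z`; for `y ≠ z` the vertex `y` itself is. Either contradicts
    -- `no_third_path`.
    have key : ∀ h h', D.own h = y → D.own h' = y → D.own (μ h) = x → D.own (μ h') ≠ x →
        D.own (μ (swapPairs h₀ h₂ h₁ h₃ (μ h))) ≠ D.own (μ h') := by
      intro h h' hh hh' hhx hhx' heq
      have i1 := hA.invol h (hh ▸ hyA.2)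
      have i2 := hA.invol h' (hh' ▸ hyA.2)
      by_cases hyz : y = z
      · refine hno (f := μ h') (hσ.owner _ hhx) heq (fun _ => ⟨rfl, by rw [i2, hh', hyz]⟩) ?_ hhx'
        intro hc
        exact absurd (hc.trans (hyz.symm.trans hh'.symm)) (hI.loopless h' (hh' ▸ hyA.2))
      · rcases hσ.link _ hhx with h3 | h3
        · rw [i1, hh] at h3
          exact hyz h3
        · exact hno (f := h') hhx (by rw [i1, hh]) (fun _ => ⟨hh', heq ▸ h3⟩)
            (fun hc => absurd hc hyz) hyA.1
    intro h h' hh hh' hne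
    unfold splice
    split_ifs with h1 h2 h2
    · exact absurd (h1.trans h2.symm) (hdone h h' hh hh' hne)
    · exact key h h' hh hh' h1 h2
    · exact (key h' h hh' hh h2 h1).symm
    · exact hdone h h' hh hh' hne

end SuppressInv

/-- The state after the vertices below `j` were considered for being split off as leaves. -/
structure LeafInv (D : Data n) (G : SimpleGraph (Fin n)) (j : ℕ)
    (μ : Fin D.m × Bool → Fin D.m × Bool) (A : Finset (Fin D.k)) (π : Fin D.k → Fin D.k) :
    Prop where
  red : IsReduction D G μ A π
  noParallel : NoParallel D.own μ A (weight fun v => π (D.map v)) 0 4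
  deg_eq : ∀ y ∈ A, weight (fun v => π (D.map v)) y = 1 → out D.own μ {y} = 2 → D.deg y = 2
  done : ∀ y ∈ A, y.val < j → weight (fun v => π (D.map v)) y = 1 → out D.own μ {y} = 2 →
    ∀ h h', D.own h = y → D.own h' = y → h ≠ h' → D.own (μ h) = D.own (μ h') →
      D.own (μ h) = y

/-- Without loops the degree equals the size of the cut around the vertex. This fails in the second
pass, where contracting a leaf produces loops; `deg_eq` keeps it for the candidates. -/
theorem SuppressInv.leafInv (hI : SuppressInv D G D.k μ A π) : LeafInv D G 0 μ A π := by
  have hw : (fun v => π (D.map v)) = D.map := funext hI.map_fix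
  have hout : ∀ y ∈ A, out D.own μ {y} = D.deg y := by
    intro y hy
    unfold out deg
    congr 1
    ext h
    simp only [Finset.mem_filter, Finset.mem_univ, true_and, Finset.mem_singleton,
      and_iff_left_iff_imp]
    intro hh hc
    exact hI.loopless h (hh ▸ hy) (hc.trans hh.symm)
  refine ⟨hI.red, ?_, ?_, fun y _ hy => absurd hy (by simp)⟩
  · intro y hy hwy hd h h' hh hh' hne heq
    rw [hw] at hwy
    rw [hout y hy] at hd
    exact absurd heq (hI.done y hy y.2 hwy hd h h' hh hh' hne)
  · intro y hy _ hd
    rw [← hout y hy, hd]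

theorem weight_merge_self {x z : Fin D.k} (hxz : x ≠ z)
    (hw : weight (fun v => π (D.map v)) x = 1) :
    weight (fun v => merge π x z (D.map v)) z = weight (fun v => π (D.map v)) z + 1 := by
  rw [← hw]
  unfold weight
  rw [← Finset.card_union_of_disjoint]
  · congr 1
    ext v
    rw [Finset.mem_union, Finset.mem_filter, Finset.mem_filter, Finset.mem_filter]
    by_cases h : π (D.map v) = x <;> simp [merge, h]
  · rw [Finset.disjoint_left]
    intro v hv hv'
    simp only [Finset.mem_filter, Finset.mem_univ, true_and] at hv hv'
    exact hxz (hv'.symm.trans hv)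

theorem weight_merge_of_ne {x y z : Fin D.k} (hyx : y ≠ x) (hyz : y ≠ z) :
    weight (fun v => merge π x z (D.map v)) y = weight (fun v => π (D.map v)) y := by
  unfold weight
  congr 1
  ext v
  rw [Finset.mem_filter, Finset.mem_filter]
  by_cases h : π (D.map v) = x <;> simp [merge, h, hyx.symm, hyz.symm]

namespace LeafInv

theorem skip (hI : LeafInv D G j μ A π) {x : Fin D.k} (hx : x.val = j)
    (h : x ∈ A → weight (fun v => π (D.map v)) x = 1 → D.deg x = 2 →
      ∀ h h', D.own h = x → D.own h' = x → h ≠ h' → D.own (μ h) = D.own (μ h') →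
        D.own (μ h) = x) :
    LeafInv D G (j + 1) μ A π where
  red := hI.red
  noParallel := hI.noParallel
  deg_eq := hI.deg_eq
  done y hyA hy := by
    rcases Nat.lt_or_ge y j with h1 | h1
    · exact hI.done y hyA h1
    · have : y = x := Fin.ext (by omega)
      subst this
      exact fun hw ho => h hyA hw (hI.deg_eq y hyA hw ho)

/-- Only `z` changes its surroundings or its weight, so it is enough that `z` does not become a leaf
candidate. If it had weight one and two leaving edges afterwards, it had weight zero and four
leaving edges before, two of them parallel edges to `x`; `noParallel` excludes this. -/
theorem step (hI : LeafInv D G j μ A π) {x z : Fin D.k} (hx : x.val = j) (hxA : x ∈ A)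
    (hw : weight (fun v => π (D.map v)) x = 1) {h₀ h₁ : Fin D.m × Bool} (h01 : h₀ ≠ h₁)
    (hmem : ∀ h, D.own h = x ↔ h = h₀ ∨ h = h₁)
    (hz₀ : D.own (μ h₀) = z) (hz₁ : D.own (μ h₁) = z) (hxz : x ≠ z) :
    LeafInv D G (j + 1) (splice D.own μ x (Equiv.swap h₀ h₁)) (A.erase x) (merge π x z) := by
  have hA := hI.red.cactus
  have hx₀ := (hmem h₀).2 (by simp)
  have hx₁ := (hmem h₁).2 (by simp)
  have hzall : ∀ h, D.own h = x → D.own (μ h) = z := by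
    intro h hh
    rcases (hmem h).1 hh with rfl | rfl <;> assumption
  have hσ : IsPairing D.own μ x z (Equiv.swap h₀ h₁) := by
    refine ⟨fun h hh => ?_, fun h hh => Equiv.swap_apply_self _ _ _, fun h hh => Or.inl (hzall h hh)⟩
    rcases (hmem h).1 hh with rfl | rfl
    · rwa [Equiv.swap_apply_left]
    · rwa [Equiv.swap_apply_right]
  have hlx : ∀ h, D.own h = x → D.own (μ h) ≠ x := fun h hh => by
    rw [hzall h hh]; exact hxz.symm
  have hzA : z ∈ A := hz₀ ▸ hA.mem h₀ (hx₀ ▸ hxA)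
  -- All half-edges at `x` lead to `z`, so only half-edges at `z` get new mates.
  have hsame : ∀ h, D.own h ∈ A → D.own h ≠ z → splice D.own μ x (Equiv.swap h₀ h₁) h = μ h := by
    intro h hh hhz
    unfold splice
    rw [if_neg]
    intro hc
    have := hzall _ hc
    rw [hA.invol h hh] at this
    exact hhz this
  have hout : ∀ y ∈ A, y ≠ x → y ≠ z →
      out D.own (splice D.own μ x (Equiv.swap h₀ h₁)) {y} = out D.own μ {y} := by
    intro y hy hyx hyz
    have := out_splice hA hσ hlx (T := {y}) (by simpa using hy) (by simp [hyx.symm, hyz.symm])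
    rwa [Finset.erase_eq_of_notMem (by simp [hyx.symm])] at this
  have hwz := weight_merge_self hxz hw
  have hz12 : weight (fun v => merge π x z (D.map v)) z = 1 →
      out D.own (splice D.own μ x (Equiv.swap h₀ h₁)) {z} = 2 → False := by
    intro hw1 ho
    have h1 := out_splice hA hσ hlx (T := {x, z}) (by
      intro y hy
      simp only [Finset.mem_insert, Finset.mem_singleton] at hy
      rcases hy with rfl | rfl <;> assumption) (by simp)
    rw [Finset.erase_insert (by simpa using hxz), ho] at h1
    have i₀ := hA.invol h₀ (hx₀ ▸ hxA)
    have i₁ := hA.invol h₁ (hx₁ ▸ hxA)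
    have hne : μ h₀ ≠ μ h₁ := fun hc => h01 (by rw [← i₀, hc, i₁])
    have h2 : out D.own μ {z} = out D.own μ {x, z} + ({μ h₀, μ h₁} : Finset _).card := by
      unfold out
      rw [← Finset.card_union_of_disjoint]
      · congr 1
        ext h
        simp only [Finset.mem_filter, Finset.mem_univ, true_and, Finset.mem_union,
          Finset.mem_insert, Finset.mem_singleton]
        constructor
        · rintro ⟨h3, h4⟩
          by_cases h5 : D.own (μ h) = x
          · right
            rw [← hA.invol h (h3 ▸ hzA)]
            rcases (hmem _).1 h5 with h6 | h6 <;> simp [h6]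
          · exact Or.inl ⟨Or.inr h3, by tauto⟩
        · rintro (⟨h3 | h3, h4⟩ | h3 | h3)
          · exact absurd (hzall h h3) (by tauto)
          · exact ⟨h3, by tauto⟩
          · rw [h3, i₀, hx₀]; exact ⟨hz₀, hxz⟩
          · rw [h3, i₁, hx₁]; exact ⟨hz₁, hxz⟩
      · rw [Finset.disjoint_left]
        intro h hh hh'
        simp only [Finset.mem_filter, Finset.mem_univ, true_and,
          Finset.mem_insert, Finset.mem_singleton] at hh hh'
        rcases hh' with rfl | rfl
        · exact hh.2 (by rw [i₀]; exact Or.inl hx₀)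
        · exact hh.2 (by rw [i₁]; exact Or.inl hx₁)
    rw [← h1, Finset.card_pair hne] at h2
    have := hI.noParallel z hzA (by omega) h2 (μ h₀) (μ h₁) hz₀ hz₁ hne (by rw [i₀, i₁, hx₀, hx₁])
    rw [i₀, hx₀] at this
    exact hxz this
  refine ⟨hI.red.splice hσ hxz hlx hxA hx₀ hz₀ (hI.red.keep_of_leaf hxA hw hzall), ?_, ?_, ?_⟩
  · intro y hyA hwy ho h h' hh hh'
    rw [Finset.mem_erase] at hyA
    by_cases hyz : y = z
    · rw [hyz] at hwy; omega
    rw [weight_merge_of_ne hyA.1 hyz] at hwy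
    rw [hout y hyA.2 hyA.1 hyz] at ho
    rw [hsame h (hh ▸ hyA.2) (hh ▸ hyz), hsame h' (hh' ▸ hyA.2) (hh' ▸ hyz)]
    exact hI.noParallel y hyA.2 hwy ho h h' hh hh'
  · intro y hyA hwy ho
    rw [Finset.mem_erase] at hyA
    by_cases hyz : y = z
    · exact (hz12 (hyz ▸ hwy) (hyz ▸ ho)).elim
    rw [weight_merge_of_ne hyA.1 hyz] at hwy
    rw [hout y hyA.2 hyA.1 hyz] at ho
    exact hI.deg_eq y hyA.2 hwy ho
  · intro y hyA hy hwy ho h h' hh hh'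
    rw [Finset.mem_erase] at hyA
    by_cases hyz : y = z
    · exact (hz12 (hyz ▸ hwy) (hyz ▸ ho)).elim
    rw [weight_merge_of_ne hyA.1 hyz] at hwy
    rw [hout y hyA.2 hyA.1 hyz] at ho
    rw [hsame h (hh ▸ hyA.2) (hh ▸ hyz), hsame h' (hh' ▸ hyA.2) (hh' ▸ hyz)]
    have hyx : y.val ≠ x.val := fun hc => hyA.1 (Fin.ext hc)
    exact hI.done y hyA.2 (by omega) hwy ho h h' hh hh'

theorem card_mul_lt [DecidableRel G.Adj] (hI : LeafInv D G D.k μ A π) (hn : 0 < n) :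
    A.card * G.minDegree < 30 * n :=
  card_mul_minDegree_lt hI.red.cactus (ψ := fun v => π (D.map v)) (fun _ => hI.red.mem _) hn
    hI.red.minCut hI.noParallel (fun y hy => hI.done y hy y.2)

end LeafInv

end Data

end CactusRep

/-! ### The quotient as a cactus representation. -/

namespace CactusRep

open HalfEdge

namespace Data

variable {n : ℕ} {D D' : Data n} {G : SimpleGraph (Fin n)}

/-- `D'` arises from `D` by identifying vertices as prescribed by `ν` and deleting loops. -/
structure IsQuotient (D D' : Data n) (ν : Fin D.k → Fin D'.k) : Prop where
  surj : Function.Surjective ν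
  exists_edges : ∃ c : Fin D'.m → Fin D.m, Function.Injective c ∧
    (∀ j, (∃ i, c i = j) ↔ ν (D.fst j) ≠ ν (D.snd j)) ∧
    (∀ i, D'.fst i = ν (D.fst (c i))) ∧ ∀ i, D'.snd i = ν (D.snd (c i))
  map_eq : ∀ v, D'.map v = ν (D.map v)

variable {μ : Fin D.m × Bool → Fin D.m × Bool} {A : Finset (Fin D.k)} {π : Fin D.k → Fin D.k}
  {ν : Fin D.k → Fin D'.k}

namespace IsQuotient

/-- The deleted edges have both ends in one class and therefore cross no union of classes. -/
theorem out_eq (h : IsQuotient D D' ν) (S : Finset (Fin D'.k)) :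
    out D'.own D'.flip S = out D.own D.flip (Finset.univ.filter fun v => ν v ∈ S) := by
  obtain ⟨c, hc, hr, h1, h2⟩ := h.exists_edges
  rw [out_eq_card_cross, out_eq_card_cross]
  refine Finset.card_bij (fun i _ => c i) ?_ ?_ ?_
  · intro i hi
    simpa [Cross, h1, h2] using hi
  · exact fun i _ j _ hij => hc hij
  · intro j hj
    simp only [Cross, Finset.mem_filter, Finset.mem_univ, true_and] at hj
    obtain ⟨i, rfl⟩ := (hr j).2 (fun hc => hj (by rw [hc]))
    exact ⟨i, by simpa [Cross, h1, h2] using hj, rfl⟩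

variable (hR : IsReduction D G μ A π) (hν : ∀ v w, ν v = ν w ↔ π v = π w)

include hR hν

theorem filter_image {S : Finset (Fin D.k)} (hS : S ⊆ A) :
    (A.filter fun v => ν v ∈ S.image ν) = S := by
  ext v
  simp only [Finset.mem_filter, Finset.mem_image]
  constructor
  · rintro ⟨hv, w, hw, hwv⟩
    rw [hν, hR.fix _ (hS hw), hR.fix _ hv] at hwv
    exact hwv ▸ hw
  · exact fun hv => ⟨hS hv, v, hv, rfl⟩

variable (h : IsQuotient D D' ν)

include h

/-- Both sides count the edges of the original multigraph that cross the same union of classes.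
Hence the output can be read off from the original edges, although the contraction was carried out
on the mates `μ`. -/
theorem out_eq_filter (S : Finset (Fin D'.k)) :
    out D'.own D'.flip S = out D.own μ (A.filter fun v => ν v ∈ S) := by
  rw [h.out_eq, hR.out_eq _ (Finset.filter_subset _ _)]
  congr 1
  ext v
  have : ν (π v) = ν v := (hν _ _).2 (hR.fix _ (hR.mem v))
  simp [hR.mem v, this]

theorem exists_mem (a : Fin D'.k) : ∃ x ∈ A, ν x = a := by
  obtain ⟨v, rfl⟩ := h.surj a
  exact ⟨π v, hR.mem v, (hν _ _).2 (hR.fix _ (hR.mem v))⟩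

theorem isHalfCactus : IsHalfCactus D'.own D'.flip Finset.univ where
  nonempty := by
    obtain ⟨x, -⟩ := hR.cactus.nonempty
    exact ⟨ν x, Finset.mem_univ _⟩
  mem _ _ := Finset.mem_univ _
  invol a _ := flip_flip a
  two_le S _ hne hne' := by
    rw [out_eq_filter hR hν h]
    obtain ⟨a, ha⟩ := hne
    obtain ⟨x, hx, rfl⟩ := exists_mem hR hν h a
    refine hR.cactus.two_le _ (Finset.filter_subset _ _) ⟨x, by simp [hx, ha]⟩ fun hc => hne' ?_
    ext b
    obtain ⟨y, hy, rfl⟩ := exists_mem hR hν h b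
    rw [← hc] at hy
    simpa using (Finset.mem_filter.1 hy).2
  sep a _ b _ hab := by
    obtain ⟨x, hx, rfl⟩ := exists_mem hR hν h a
    obtain ⟨y, hy, rfl⟩ := exists_mem hR hν h b
    obtain ⟨S, hS, h1, h2, h3⟩ := hR.cactus.sep x hx y hy (fun hc => hab (by rw [hc]))
    refine ⟨S.image ν, Finset.subset_univ _, Finset.mem_image_of_mem _ h1, fun hc => h2 ?_, ?_⟩
    · rw [← filter_image hR hν hS]
      exact Finset.mem_filter.2 ⟨hy, hc⟩
    · rw [out_eq_filter hR hν h, filter_image hR hν hS, h3]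

theorem represents : D'.Represents G (nontrivialMinCuts (Graph.ofSimpleGraph G)) := by
  classical
  have hc := isHalfCactus hR hν h
  have hpre : ∀ S : Finset (Fin D'.k), D'.map ⁻¹' S =
      (fun v => π (D.map v)) ⁻¹' (A.filter fun v => ν v ∈ S : Finset (Fin D.k)) := by
    intro S
    ext v
    have : ν (π (D.map v)) = ν (D.map v) := (hν _ _).2 (hR.fix _ (hR.mem _))
    simp [hR.mem, this, h.map_eq]
  refine ⟨isCactus_iff.2 ⟨?_, hc⟩, fun _ => trivial, ?_, ?_⟩
  · obtain ⟨c, -, hr, h1, h2⟩ := h.exists_edges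
    intro i
    rw [h1, h2]
    exact (hr _).1 ⟨i, rfl⟩
  · intro X hX
    obtain ⟨S, hS, rfl⟩ := hR.exists_cut X hX
    refine ⟨(S.image ν : Finset (Fin D'.k)), (mem_minCuts_iff hc).2 ?_, ?_⟩
    · rw [out_eq_filter hR hν h, filter_image hR hν hS.1, hS.2]
    · rw [hpre, filter_image hR hν hS.1]
  · intro Y hY
    have hYe : Y = (Y.toFinset : Set (Fin D'.k)) := by simp
    rw [hYe] at hY ⊢
    rw [mem_minCuts_iff hc, out_eq_filter hR hν h] at hY
    rw [hpre]
    exact hR.minCut _ ⟨Finset.filter_subset _ _, hY⟩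

end IsQuotient

end Data

end CactusRep

/-! ### Reasoning about programs and their running times. -/

namespace RAM

variable {W : ℕ} {s : State} {Q : State → Prop}

section State

variable (s)

@[simp] theorem State.setVar_var (x k y : ℕ) :
    (s.setVar x k).var y = if y = x then k else s.var y := by
  simp [State.setVar, Function.update_apply]

@[simp] theorem State.setVar_arr (x k : ℕ) : (s.setVar x k).arr = s.arr := rfl

@[simp] theorem State.setArr_var (a i k : ℕ) : (s.setArr a i k).var = s.var := rfl

@[simp] theorem State.setArr_arr (a i k b : ℕ) :
    (s.setArr a i k).arr b = if b = a then Function.update (s.arr a) i k else s.arr b := by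
  unfold State.setArr
  by_cases h : b = a
  · subst h; simp
  · simp [h]

end State

/-- A sufficient condition for a loop-free program to halt with `Q`, writing no value beyond
`W`. -/
def wp (W : ℕ) : Program → State → (State → Prop) → Prop
  | .skip, s, Q => Q s
  | .instr i, s, Q => i.value s ≤ W ∧ Q (i.run s)
  | .seq p q, s, Q => wp W p s fun s' => wp W q s' Q
  | .ite b p q, s, Q => (b.Holds s → wp W p s Q) ∧ (¬ b.Holds s → wp W q s Q)
  | .while _ _, _, _ => False

/-- The maximal number of steps of a loop-free program. -/
def cost : Program → ℕ
  | .skip => 1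
  | .instr _ => 1
  | .seq p q => cost p + cost q
  | .ite _ p q => max (cost p) (cost q) + 1
  | .while _ _ => 0

/-- The program `p` halts after at most `T` steps in a state that satisfies `Q`. -/
def Ends (W : ℕ) (p : Program) (s : State) (T : ℕ) (Q : State → Prop) : Prop :=
  ∃ t s', Exec W p s t s' ∧ t ≤ T ∧ Q s'

theorem wp.ends {p : Program} (h : wp W p s Q) : Ends W p s (cost p) Q := by
  induction p generalizing s Q with
  | skip => exact ⟨1, s, .skip s, le_rfl, h⟩
  | instr i => exact ⟨1, _, .instr i s h.1, le_rfl, h.2⟩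
  | seq p q ihp ihq =>
    obtain ⟨t, s', h1, h2, h3⟩ := ihp h
    obtain ⟨t', s'', h4, h5, h6⟩ := ihq h3
    exact ⟨_, _, .seq h1 h4, Nat.add_le_add h2 h5, h6⟩
  | ite b p q ihp ihq =>
    by_cases hb : b.Holds s
    · obtain ⟨t, s', h1, h2, h3⟩ := ihp (h.1 hb)
      exact ⟨_, _, .ite_true hb h1, by simp only [cost]; omega, h3⟩
    · obtain ⟨t, s', h1, h2, h3⟩ := ihq (h.2 hb)
      exact ⟨_, _, .ite_false hb h1, by simp only [cost]; omega, h3⟩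
  | _ => exact h.elim

theorem Ends.seq {p q : Program} {T T' : ℕ} {R : State → Prop} (h : Ends W p s T R)
    (h' : ∀ s', R s' → Ends W q s' T' Q) : Ends W (.seq p q) s (T + T') Q := by
  obtain ⟨t, s', h1, h2, h3⟩ := h
  obtain ⟨t', s'', h4, h5, h6⟩ := h' s' h3
  exact ⟨_, _, .seq h1 h4, Nat.add_le_add h2 h5, h6⟩

theorem Ends.mono {p : Program} {T T' : ℕ} {R : State → Prop} (h : Ends W p s T R)
    (hT : T ≤ T') (h' : ∀ s', R s' → Q s') : Ends W p s T' Q := by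
  obtain ⟨t, s', h1, h2, h3⟩ := h
  exact ⟨t, s', h1, h2.trans hT, h' _ h3⟩

/-- Perform instructions one after the other and continue with `p`. -/
def after : List Instr → Program → Program
  | [], p => p
  | i :: l, p => .seq (.instr i) (after l p)

section Instructions

variable {l : List Instr} {p q : Program} {x y z a k v i : ℕ}

theorem wp_const (hW : k ≤ W) (h : wp W (after l p) (s.setVar x k) Q) :
    wp W (after (.const x k :: l) p) s Q := ⟨hW, h⟩

theorem wp_copy (hv : s.var y = v) (hW : v ≤ W) (h : wp W (after l p) (s.setVar x v) Q) :
    wp W (after (.copy x y :: l) p) s Q := by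
  subst hv; exact ⟨hW, h⟩

theorem wp_add (hv : s.var y + s.var z = v) (hW : v ≤ W)
    (h : wp W (after l p) (s.setVar x v) Q) : wp W (after (.add x y z :: l) p) s Q := by
  subst hv; exact ⟨hW, h⟩

theorem wp_sub (hv : s.var y - s.var z = v) (hW : v ≤ W)
    (h : wp W (after l p) (s.setVar x v) Q) : wp W (after (.sub x y z :: l) p) s Q := by
  subst hv; exact ⟨hW, h⟩

theorem wp_load (hv : s.arr a (s.var y) = v) (hW : v ≤ W)
    (h : wp W (after l p) (s.setVar x v) Q) : wp W (after (.load x a y :: l) p) s Q := by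
  subst hv; exact ⟨hW, h⟩

theorem wp_store (hi : s.var x = i) (hv : s.var y = v) (hW : v ≤ W)
    (h : wp W (after l p) (s.setArr a i v) Q) : wp W (after (.store a x y :: l) p) s Q := by
  subst hi hv; exact ⟨hW, h⟩

theorem wp_eq (h : s.var x = s.var y → wp W p s Q) (h' : s.var x ≠ s.var y → wp W q s Q) :
    wp W (.ite (.eq x y) p q) s Q := ⟨h, h'⟩

theorem wp_lt (h : s.var x < s.var y → wp W p s Q) (h' : ¬ s.var x < s.var y → wp W q s Q) :
    wp W (.ite (.lt x y) p q) s Q := ⟨h, h'⟩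

end Instructions

/-- Run `p` with the variable `10` ranging over the numbers below the value of `b`. The
variable `3` has to have the value one. -/
def forLoop (b : ℕ) (p : Program) : Program :=
  .seq (.instr (.const 10 0)) (.while (.lt 10 b) (.seq p (.instr (.add 10 10 3))))

/-- `d` is the number of rounds left. A round costs the body, one test and one increment; the final
failing test is the summand one. -/
theorem Ends.while {b N : ℕ} {p : Program} {Inv : ℕ → State → Prop} (hNW : N ≤ W)
    (hb : ∀ j s, Inv j s → s.var b = N)
    (hstep : ∀ j s, j < N → Inv j s → s.var 10 = j →
      wp W p s fun s' => s'.var 10 = j ∧ s'.var 3 = 1 ∧ Inv (j + 1) (s'.setVar 10 (j + 1)))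
    (d : ℕ) : ∀ j s, j + d = N → Inv j s → s.var 10 = j →
      Ends W (.while (.lt 10 b) (.seq p (.instr (.add 10 10 3)))) s (d * (cost p + 2) + 1)
        (Inv N) := by
  induction d with
  | zero =>
    intro j s hj hI h10
    refine ⟨1, s, .while_false ?_, by omega, ?_⟩
    · simp only [Test.Holds, hb j s hI]; omega
    · rw [← hj]; exact hI
  | succ d ih =>
    intro j s hj hI h10
    obtain ⟨t, s', h1, h2, h3, h4, h5⟩ := (hstep j s (by omega) hI h10).ends
    have h6 : (Instr.add 10 10 3).run s' = s'.setVar 10 (j + 1) := by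
      simp [Instr.run, Instr.value, h3, h4]
    obtain ⟨t', s'', h7, h8, h9⟩ := ih (j + 1) (s'.setVar 10 (j + 1)) (by omega) h5 (by simp)
    refine ⟨_, s'', .while_true ?_ (.seq h1 (.instr _ _ ?_)) (h6 ▸ h7), ?_, h9⟩
    · simp only [Test.Holds, hb j s hI]; omega
    · simp only [Instr.value, h3, h4]; omega
    · rw [add_mul]; omega

theorem Ends.forLoop {b N : ℕ} {p : Program} {Inv : ℕ → State → Prop} (hNW : N ≤ W)
    (hb : ∀ j s, Inv j s → s.var b = N) (h0 : Inv 0 (s.setVar 10 0))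
    (hstep : ∀ j s, j < N → Inv j s → s.var 10 = j →
      wp W p s fun s' => s'.var 10 = j ∧ s'.var 3 = 1 ∧ Inv (j + 1) (s'.setVar 10 (j + 1))) :
    Ends W (forLoop b p) s (N * (cost p + 2) + 2) (Inv N) := by
  obtain ⟨t, s', h1, h2, h3⟩ := Ends.while hNW hb hstep N 0 _ (by omega) h0 (by simp)
  exact ⟨_, s', .seq (.instr _ _ (by simp [Instr.value])) h1, by omega, h3⟩

end RAM

/-! ### The program. -/

namespace CactusRep

open RAM

/-! The variables of the program are `0, 1, 2` for the input sizes, `3, 4, 5, 6` for the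
constants `1, 2, 4, 0`, `7` for the number of vertices that were split off, `8` and `9` for the
output sizes, `10` for the loop index, and scratch variables. The arrays are `0, 1, 2` for the
input and the output, `3` for the vertex of a half-edge, `4` for its other half, `5` for the
degrees, `6` for the first four half-edges at every vertex, `7` for the weights, `8` for the
vertex into which a vertex was merged, `9` for the mark of the vertices that were split off,
`10` for the list of these vertices, and `11` for the new names of the vertices. -/

namespace Prog

/-- Record the half-edge in variable `h`, with other half `g`, at the vertex in `x`. -/
def half (h g x : ℕ) : Program :=
  after [.store 3 h x, .store 4 h g, .load 15 5 x]
    (.seq (.ite (.lt 15 5)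
      (after [.add 16 x x, .add 16 16 16, .add 16 16 15, .store 6 16 h] .skip) .skip)
      (after [.add 15 15 3, .store 5 x 15] .skip))

/-- Record the two half-edges of an edge. -/
def edge : Program :=
  after [.add 11 10 10, .add 12 11 3, .load 13 0 10, .load 14 1 10]
    (.seq (half 11 12 13) (half 12 11 14))

/-- Count an element of `{0, …, n - 1}` at its vertex. -/
def count : Program :=
  after [.load 11 2 10, .load 12 7 11, .add 12 12 3, .store 7 11 12] .skip

/-- Merge the current vertex into the one in `z`. -/
def remove (z : ℕ) : Program :=
  after [.store 8 10 z, .store 9 10 3, .store 10 7 10, .add 7 7 3] .skip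

/-- Join the half-edge in `a` to the one in `c`, and `b` to `d`. -/
def rejoin (a b c d z : ℕ) : Program :=
  after [.store 4 a c, .store 4 c a, .store 4 b d, .store 4 d b] (remove z)

/-- Split off the current vertex if it is superfluous, that is, of degree four and weight zero
and incident with a double edge. -/
def suppress : Program :=
  after [.load 11 5 10, .load 12 7 10] (.ite (.eq 11 5) (.ite (.eq 12 6)
    (after [.add 13 10 10, .add 13 13 13, .load 14 6 13, .add 13 13 3, .load 15 6 13,
      .add 13 13 3, .load 16 6 13, .add 13 13 3, .load 17 6 13, .load 18 4 14, .load 19 4 15,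
      .load 20 4 16, .load 21 4 17, .load 22 3 18, .load 23 3 19, .load 24 3 20, .load 25 3 21]
      (.ite (.eq 22 23) (rejoin 18 19 20 21 22)
      (.ite (.eq 22 24) (rejoin 18 20 19 21 22)
      (.ite (.eq 22 25) (rejoin 18 21 19 20 22)
      (.ite (.eq 23 24) (rejoin 19 20 18 21 23)
      (.ite (.eq 23 25) (rejoin 19 21 18 20 23)
      (.ite (.eq 24 25) (rejoin 20 21 18 19 24) .skip))))))) .skip) .skip)

/-- Split off the current vertex if it is of degree two and weight one and incident with a
double edge. -/
def leaf : Program :=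
  after [.load 11 9 10, .load 12 5 10, .load 13 7 10] (.ite (.eq 11 6) (.ite (.eq 12 4)
    (.ite (.eq 13 3)
    (after [.add 14 10 10, .add 14 14 14, .load 15 6 14, .add 14 14 3, .load 16 6 14,
      .load 17 4 15, .load 18 4 16, .load 19 3 17, .load 20 3 18]
      (.ite (.eq 19 20) (.ite (.eq 19 10) .skip
        (after [.store 4 17 18, .store 4 18 17, .load 21 7 19, .add 21 21 3, .store 7 19 21]
          (remove 19))) .skip)) .skip) .skip) .skip)

/-- Name the current vertex if it was not split off. -/
def name : Program :=
  after [.load 11 9 10] (.ite (.eq 11 6) (after [.store 11 10 8, .add 8 8 3] .skip) .skip)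

/-- Name the vertices that were split off, the last one first. -/
def rename : Program :=
  after [.sub 11 7 10, .sub 11 11 3, .load 12 10 11, .load 13 8 12, .load 14 11 13,
    .store 11 12 14] .skip

/-- Write the current edge to the output if it is not a loop. -/
def emit : Program :=
  after [.add 11 10 10, .load 12 3 11, .load 13 11 12, .add 11 11 3, .load 12 3 11,
    .load 14 11 12] (.ite (.eq 13 14) .skip
      (after [.store 0 9 13, .store 1 9 14, .add 9 9 3] .skip))

/-- Write the vertex of the current element of `{0, …, n - 1}` to the output. -/
def place : Program :=
  after [.load 11 2 10, .load 12 11 11, .store 2 10 12] .skip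

/-- The program. -/
def main : Program :=
  .seq (after [.const 3 1, .const 4 2, .const 5 4] .skip)
    (.seq (forLoop 1 edge) (.seq (forLoop 2 count) (.seq (forLoop 0 suppress)
      (.seq (forLoop 0 leaf) (.seq (forLoop 0 name) (.seq (forLoop 7 rename)
        (.seq (forLoop 1 emit) (.seq (forLoop 2 place)
          (after [.copy 0 8, .copy 1 9] .skip)))))))))

end Prog

end CactusRep

/-! ### Recording the half-edges. -/

namespace CactusRep

open HalfEdge RAM

namespace Data

variable {n : ℕ} {D : Data n} {G : SimpleGraph (Fin n)} {W : ℕ} {s : State} {Q : State → Prop}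

/-- The number of a half-edge. -/
def code (h : Fin D.m × Bool) : ℕ := h.1 + h.1 + if h.2 then 1 else 0

theorem code_lt (h : Fin D.m × Bool) : code h < D.m + D.m := by
  have := h.1.2
  unfold code
  split_ifs <;> omega

theorem code_inj {h h' : Fin D.m × Bool} : code h = code h' ↔ h = h' := by
  obtain ⟨e, b⟩ := h
  obtain ⟨e', b'⟩ := h'
  simp only [code, Prod.mk.injEq, Fin.ext_iff]
  cases b <;> cases b' <;> simp <;> omega

/-- The input sizes, the constants and the output sizes are stored in `s`. -/
structure Base (D : Data n) (c a b : ℕ) (s : State) : Prop where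
  k : s.var 0 = D.k
  m : s.var 1 = D.m
  n : s.var 2 = n
  one : s.var 3 = 1
  two : s.var 4 = 2
  four : s.var 5 = 4
  zero : s.var 6 = 0
  log : s.var 7 = c
  newk : s.var 8 = a
  newm : s.var 9 = b

variable {c a b : ℕ}

theorem Base.congr (h : Base D c a b s) {s' : State} (hs : ∀ y < 10, s'.var y = s.var y) :
    Base D c a b s' := by
  constructor <;> rw [hs _ (by norm_num)]
  exacts [h.k, h.m, h.n, h.one, h.two, h.four, h.zero, h.log, h.newk, h.newm]

theorem Base.setVar (h : Base D c a b s) {x v : ℕ} (hx : 10 ≤ x) :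
    Base D c a b (s.setVar x v) :=
  h.congr fun y hy => by simp [show y ≠ x by omega]

/-- The list `L x` consists of the half-edges recorded at `x`, `d` is the array of degrees, and
`f` is the array of the first four half-edges at every vertex. -/
def IncArr (L : Fin D.k → List (Fin D.m × Bool)) (d f : ℕ → ℕ) : Prop :=
  ∀ x : Fin D.k, d x = (L x).length ∧ ∀ i h, (L x)[i]? = some h → i < 4 →
    f (x + x + (x + x) + i) = code h

theorem IncArr.push {L : Fin D.k → List (Fin D.m × Bool)} {d f : ℕ → ℕ} (hL : IncArr L d f)
    (v : Fin D.k) (h : Fin D.m × Bool) :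
    IncArr (Function.update L v (L v ++ [h])) (Function.update d v (d v + 1))
      (if d v < 4 then Function.update f (v + v + (v + v) + d v) (code h) else f) := by
  intro x
  by_cases hx : x = v
  · subst hx
    refine ⟨by simp [(hL x).1], fun i h' hi hi4 => ?_⟩
    rw [Function.update_self, List.getElem?_append] at hi
    split_ifs at hi ⊢ with h1 h2 h2
    · rw [Function.update_of_ne (by rw [(hL x).1]; omega)]
      exact (hL x).2 i h' hi hi4
    · rw [List.getElem?_singleton] at hi
      split_ifs at hi with h3
      · have : i = d x := by rw [(hL x).1]; omega
        simp only [Option.some.injEq] at hi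
        simp [this, hi]
    · exact (hL x).2 i h' hi hi4
    · rw [(hL x).1] at h1; omega
  · have hxv : (x : ℕ) ≠ v := fun hc => hx (Fin.ext hc)
    rw [Function.update_of_ne hx, Function.update_of_ne hxv]
    refine ⟨(hL x).1, fun i h' hi hi4 => ?_⟩
    split_ifs with h2
    · rw [Function.update_of_ne (by omega)]
      exact (hL x).2 i h' hi hi4
    · exact (hL x).2 i h' hi hi4

theorem push_mem {L : Fin D.k → List (Fin D.m × Bool)} {S : Fin D.m × Bool → Prop}
    (hnd : ∀ x, (L x).Nodup) (hmem : ∀ x h, h ∈ L x ↔ D.own h = x ∧ S h) {v : Fin D.k}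
    {h₀ : Fin D.m × Bool} (hv : D.own h₀ = v) (h0 : ¬ S h₀) :
    (∀ x, (Function.update L v (L v ++ [h₀]) x).Nodup) ∧
      ∀ x h, h ∈ Function.update L v (L v ++ [h₀]) x ↔ D.own h = x ∧ (S h ∨ h = h₀) := by
  constructor <;> intro x <;> by_cases hx : x = v
  · subst hx
    rw [Function.update_self, List.nodup_append]
    refine ⟨hnd x, List.nodup_singleton _, fun a ha b hb hab => ?_⟩
    rw [List.mem_singleton] at hb
    subst hab hb
    exact h0 ((hmem _ _).1 ha).2
  · rw [Function.update_of_ne hx]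
    exact hnd x
  · subst hx
    intro h
    rw [Function.update_self, List.mem_append, hmem, List.mem_singleton]
    constructor
    · rintro (h1 | rfl)
      · exact ⟨h1.1, Or.inl h1.2⟩
      · exact ⟨hv, Or.inr rfl⟩
    · rintro ⟨h1, h2 | h2⟩
      · exact Or.inl ⟨h1, h2⟩
      · exact Or.inr h2
  · intro h
    rw [Function.update_of_ne hx, hmem]
    refine and_congr_right fun h1 => ⟨Or.inl, fun h2 => h2.resolve_right ?_⟩
    rintro rfl
    exact hx (h1.symm.trans hv)

/-- Stated with a continuation `H` that forgets the scratch variables from `15` on. The address of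
the `i`-th half-edge at `v` is `4 * v + i`, built from two doublings; only the first four are kept,
since larger degrees are never inspected. -/
theorem wp_half {h g x p q v : ℕ} (hh : h < 15) (hx : x < 15)
    (one : s.var 3 = 1) (four : s.var 5 = 4)
    (hp : s.var h = p) (hq : s.var g = q) (hv : s.var x = v) (hpW : p ≤ W) (hqW : q ≤ W)
    (hvW : v + v + (v + v) + 4 ≤ W) (hdW : s.arr 5 v + 1 ≤ W)
    (H : ∀ s' : State, (∀ y < 15, s'.var y = s.var y) →
      s'.arr 3 = Function.update (s.arr 3) p v → s'.arr 4 = Function.update (s.arr 4) p q →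
      s'.arr 5 = Function.update (s.arr 5) v (s.arr 5 v + 1) →
      s'.arr 6 = (if s.arr 5 v < 4 then
        Function.update (s.arr 6) (v + v + (v + v) + s.arr 5 v) p else s.arr 6) →
      (∀ y, y < 3 ∨ 6 < y → s'.arr y = s.arr y) → Q s') :
    wp W (Prog.half h g x) s Q := by
  have h1 : ∀ y < 15, y ≠ 15 := by omega
  have h2 : ∀ y < 15, y ≠ 16 := by omega
  have e1 := h1 h hh
  have e2 := h2 h hh
  have e3 := h1 x hx
  have e4 := h2 x hx
  refine wp_store hp hv (by omega) ?_
  refine wp_store hp hq (by omega) ?_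
  refine wp_load (v := s.arr 5 v) (by simp [hv]) (by omega) ?_
  refine wp_lt (fun hlt => ?_) (fun hlt => ?_)
  · replace hlt : s.arr 5 v < 4 := by simpa [four] using hlt
    refine wp_add (v := v + v) (by simp [hv, e3]) (by omega) ?_
    refine wp_add (v := v + v + (v + v)) (by simp) (by omega) ?_
    refine wp_add (v := v + v + (v + v) + s.arr 5 v) (by simp) (by omega) ?_
    refine wp_store (i := v + v + (v + v) + s.arr 5 v) (v := p) (by simp) (by simp [hp, e1, e2])
      (by omega) ?_
    refine wp_add (v := s.arr 5 v + 1) (by simp [one]) hdW ?_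
    refine wp_store (i := v) (v := s.arr 5 v + 1) (by simp [hv, e3, e4]) (by simp) hdW ?_
    refine H _ ?_ (by simp) (by simp) (by simp) (by simp [hlt]) ?_
    · intro y hy; simp [h1 y hy, h2 y hy]
    · intro y hy
      simp [show y ≠ 3 by omega, show y ≠ 4 by omega, show y ≠ 5 by omega, show y ≠ 6 by omega]
  · replace hlt : ¬ s.arr 5 v < 4 := by simpa [four] using hlt
    refine wp_add (v := s.arr 5 v + 1) (by simp [one]) hdW ?_
    refine wp_store (i := v) (v := s.arr 5 v + 1) (by simp [hv, e3]) (by simp) hdW ?_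
    refine H _ ?_ (by simp) (by simp) (by simp) (by simp [hlt]) ?_
    · intro y hy; simp [h1 y hy]
    · intro y hy
      simp [show y ≠ 3 by omega, show y ≠ 4 by omega, show y ≠ 5 by omega]

/-- The half-edges at every vertex of degree two or four are stored in the array `f`, and the
degrees in the array `d`. -/
structure Incident (D : Data n) (d f : ℕ → ℕ) : Prop where
  deg : ∀ x : Fin D.k, d x = D.deg x
  four : ∀ x : Fin D.k, D.deg x = 4 → ∃ h₀ h₁ h₂ h₃, h₀ ≠ h₁ ∧ h₀ ≠ h₂ ∧ h₀ ≠ h₃ ∧ h₁ ≠ h₂ ∧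
    h₁ ≠ h₃ ∧ h₂ ≠ h₃ ∧ (∀ h, D.own h = x ↔ h = h₀ ∨ h = h₁ ∨ h = h₂ ∨ h = h₃) ∧
    f (x + x + (x + x)) = code h₀ ∧ f (x + x + (x + x) + 1) = code h₁ ∧
    f (x + x + (x + x) + 2) = code h₂ ∧ f (x + x + (x + x) + 3) = code h₃
  two : ∀ x : Fin D.k, D.deg x = 2 → ∃ h₀ h₁, h₀ ≠ h₁ ∧
    (∀ h, D.own h = x ↔ h = h₀ ∨ h = h₁) ∧
    f (x + x + (x + x)) = code h₀ ∧ f (x + x + (x + x) + 1) = code h₁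

theorem IncArr.incident {L : Fin D.k → List (Fin D.m × Bool)} {d f : ℕ → ℕ} (hL : IncArr L d f)
    (hnd : ∀ x, (L x).Nodup) (hmem : ∀ x h, h ∈ L x ↔ D.own h = x) : Incident D d f := by
  have hlen : ∀ x, (L x).length = D.deg x := by
    intro x
    rw [← List.toFinset_card_of_nodup (hnd x), deg]
    congr 1
    ext h
    simp [hmem]
  refine ⟨fun x => by rw [(hL x).1, hlen], fun x hx => ?_, fun x hx => ?_⟩
  · rw [← hlen] at hx
    obtain ⟨h₀, h₁, h₂, h₃, hl⟩ : ∃ h₀ h₁ h₂ h₃, L x = [h₀, h₁, h₂, h₃] := by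
      match L x, hx with
      | [h₀, h₁, h₂, h₃], _ => exact ⟨_, _, _, _, rfl⟩
    have h1 := hnd x
    have h2 := hmem x
    have h3 := (hL x).2
    rw [hl] at h1 h2 h3
    simp only [List.nodup_cons, List.mem_cons, not_or, List.not_mem_nil, or_false] at h1 h2
    exact ⟨h₀, h₁, h₂, h₃, h1.1.1, h1.1.2.1, h1.1.2.2, h1.2.1.1, h1.2.1.2, h1.2.2.1,
      fun h => (h2 h).symm, h3 0 _ rfl (by omega), h3 1 _ rfl (by omega), h3 2 _ rfl (by omega),
      h3 3 _ rfl (by omega)⟩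
  · rw [← hlen] at hx
    obtain ⟨h₀, h₁, hl⟩ := List.length_eq_two.1 hx
    have h1 := hnd x
    have h2 := hmem x
    have h3 := (hL x).2
    rw [hl] at h1 h2 h3
    simp only [List.nodup_cons, List.mem_cons, List.not_mem_nil, or_false] at h1 h2
    exact ⟨h₀, h₁, h1.1, fun h => (h2 h).symm, h3 0 _ rfl (by omega), h3 1 _ rfl (by omega)⟩

/-- The facts that are stored by the first loop and not changed later. -/
structure Static (D : Data n) (s : State) : Prop where
  own : ∀ h, s.arr 3 (code h) = D.own h
  inc : Incident D (s.arr 5) (s.arr 6)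
  map : ∀ i : Fin n, s.arr 2 i = D.map i

theorem Static.congr (h : Static D s) {s' : State} (h2 : s'.arr 2 = s.arr 2)
    (h3 : s'.arr 3 = s.arr 3) (h5 : s'.arr 5 = s.arr 5) (h6 : s'.arr 6 = s.arr 6) :
    Static D s' :=
  ⟨h3 ▸ h.own, h5 ▸ h6 ▸ h.inc, h2 ▸ h.map⟩

/-- The half-edges of the edges below `j` are recorded. -/
structure EdgeInv (D : Data n) (j : ℕ) (s : State) : Prop where
  base : Base D 0 0 0 s
  own : ∀ h : Fin D.m × Bool, h.1.val < j → s.arr 3 (code h) = D.own h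
  mate : ∀ h : Fin D.m × Bool, h.1.val < j → s.arr 4 (code h) = code (D.flip h)
  inc : ∃ L : Fin D.k → List (Fin D.m × Bool), (∀ x, (L x).Nodup) ∧
    (∀ x h, h ∈ L x ↔ D.own h = x ∧ h.1.val < j) ∧ IncArr L (s.arr 5) (s.arr 6)
  fst : ∀ e : Fin D.m, s.arr 0 e = D.fst e
  snd : ∀ e : Fin D.m, s.arr 1 e = D.snd e
  map : ∀ i : Fin n, s.arr 2 i = D.map i
  zero : s.arr 7 = 0 ∧ s.arr 9 = 0

theorem EdgeInv.step {j : ℕ} (hW : 8 * D.size ≤ W) (hj : j < D.m) (hI : EdgeInv D j s)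
    (h10 : s.var 10 = j) :
    wp W Prog.edge s fun s' => s'.var 10 = j ∧ s'.var 3 = 1 ∧
      EdgeInv D (j + 1) (s'.setVar 10 (j + 1)) := by
  set e : Fin D.m := ⟨j, hj⟩ with he
  have hs : n + D.k + D.m = D.size := rfl
  have hk1 := (D.fst e).2
  have hk2 := (D.snd e).2
  obtain ⟨L, hnd, hmem, hL⟩ := hI.inc
  have hlen : ∀ x, (L x).length ≤ D.m + D.m := by
    intro x
    have := (hnd x).length_le_card
    simp only [Fintype.card_prod, Fintype.card_fin, Fintype.card_bool] at this
    omega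
  have hone := hI.base.one
  have hfour := hI.base.four
  have d1 := (hL (D.fst e)).1
  have d2 := (hL (D.snd e)).1
  have l1 := hlen (D.fst e)
  have l2 := hlen (D.snd e)
  have c0 : code (e, false) = j + j := by simp [code, he]
  have c1 : code (e, true) = j + j + 1 := by simp [code, he]
  refine wp_add (v := j + j) (by simp [h10]) (by omega) ?_
  refine wp_add (v := j + j + 1) (by simp [hone]) (by omega) ?_
  refine wp_load (v := D.fst e) (by simpa [h10] using hI.fst e) (by omega) ?_
  refine wp_load (v := D.snd e) (by simpa [h10] using hI.snd e) (by omega) ?_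
  refine wp_half (p := j + j) (q := j + j + 1) (v := D.fst e) (by simp) (by simp)
    (by simp [hone]) (by simp [hfour]) (by simp) (by simp) (by simp) (by omega) (by omega)
    (by omega) (by simp only [State.setVar_arr]; omega) ?_
  intro s₁ v1 a3 a4 a5 a6 ao
  simp only [State.setVar_arr] at a3 a4 a5 a6 ao
  have p1 : IncArr (Function.update L (D.fst e) (L (D.fst e) ++ [(e, false)])) (s₁.arr 5)
      (s₁.arr 6) := by
    have := hL.push (D.fst e) (e, false)
    rw [c0] at this
    rw [a5, a6]
    convert this using 1
    split_ifs with hd <;> simp [hd]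
  obtain ⟨n1, m1⟩ := push_mem hnd hmem (h₀ := (e, false)) (v := D.fst e) (by simp [Data.own])
    (by simp [he])
  set L₁ := Function.update L (D.fst e) (L (D.fst e) ++ [(e, false)]) with hL₁
  have hlen₁ : (L₁ (D.snd e)).length ≤ D.m + D.m + 1 := by
    rw [hL₁, Function.update_apply]
    split_ifs
    · rw [List.length_append, List.length_singleton]; omega
    · omega
  refine wp_half (p := j + j + 1) (q := j + j) (v := D.snd e) (by simp) (by simp)
    (by simp [v1, hone]) (by simp [v1, hfour]) (by simp [v1]) (by simp [v1]) (by simp [v1])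
    (by omega) (by omega) (by omega) (by rw [(p1 (D.snd e)).1]; omega) ?_
  intro s₂ w1 b3 b4 b5 b6 bo
  have p2 : IncArr (Function.update L₁ (D.snd e) (L₁ (D.snd e) ++ [(e, true)])) (s₂.arr 5)
      (s₂.arr 6) := by
    have := p1.push (D.snd e) (e, true)
    rw [c1] at this
    rw [b5, b6]
    convert this using 1
  obtain ⟨n2, m2⟩ := push_mem n1 m1 (h₀ := (e, true)) (v := D.snd e) (by simp [Data.own])
    (by simp [he])
  have hne : ∀ {h : Fin D.m × Bool}, h.1.val < j → code h ≠ j + j ∧ code h ≠ j + j + 1 := by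
    intro h hh
    have : code h < j + j := by unfold code; split_ifs <;> omega
    omega
  have hcase : ∀ h : Fin D.m × Bool, h.1.val < j + 1 →
      h.1.val < j ∨ h = (e, false) ∨ h = (e, true) := by
    rintro ⟨e', b⟩ hh
    rcases Nat.lt_or_ge e' j with h | h
    · exact Or.inl h
    · have : e' = e := Fin.ext (by simp [he]; simp at hh; omega)
      subst this
      cases b <;> simp
  refine ⟨by simp [w1, v1, h10], by simp [w1, v1, hone], ?_, ?_, ?_, ?_, ?_, ?_, ?_, ?_⟩
  · refine (hI.base.congr (s' := s₂) fun y hy => ?_).setVar le_rfl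
    rw [w1 y (by omega), v1 y (by omega)]
    simp [show y ≠ 11 by omega, show y ≠ 12 by omega, show y ≠ 13 by omega, show y ≠ 14 by omega]
  · intro h hh
    simp only [State.setVar_arr, b3, a3]
    rcases hcase h hh with h1 | rfl | rfl
    · rw [Function.update_of_ne (hne h1).2, Function.update_of_ne (hne h1).1, hI.own h h1]
    · rw [c0, Function.update_of_ne (by omega), Function.update_self]; simp [Data.own]
    · rw [c1, Function.update_self]; simp [Data.own]
  · intro h hh
    simp only [State.setVar_arr, b4, a4]
    rcases hcase h hh with h1 | rfl | rfl
    · rw [Function.update_of_ne (hne h1).2, Function.update_of_ne (hne h1).1, hI.mate h h1]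
    · rw [c0, Function.update_of_ne (by omega), Function.update_self]; simp [Data.flip, c1]
    · rw [c1, Function.update_self]; simp [Data.flip, c0]
  · refine ⟨_, n2, fun x h => (m2 x h).trans (and_congr_right fun _ => ?_), p2⟩
    constructor
    · rintro ((h1 | rfl) | rfl)
      · omega
      · simp [he]
      · simp [he]
    · intro h1
      rcases hcase h h1 with h2 | h2 | h2 <;> tauto
  · intro e'
    simp only [State.setVar_arr]
    rw [bo 0 (by simp), ao 0 (by simp), hI.fst]
  · intro e'
    simp only [State.setVar_arr]
    rw [bo 1 (by simp), ao 1 (by simp), hI.snd]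
  · intro e'
    simp only [State.setVar_arr]
    rw [bo 2 (by simp), ao 2 (by simp), hI.map]
  · simp only [State.setVar_arr]
    rw [bo 7 (by simp), ao 7 (by simp), bo 9 (by simp), ao 9 (by simp)]
    exact hI.zero

end Data
end CactusRep

/-! ### Counting the weights and storing a contraction. -/

namespace CactusRep

open HalfEdge RAM

namespace Data

variable {n : ℕ} {D : Data n} {G : SimpleGraph (Fin n)} {W : ℕ} {s : State} {Q : State → Prop}

/-- The elements of `{0, …, n - 1}` below `j` are counted at their vertices. -/
structure CountInv (D : Data n) (j : ℕ) (s : State) : Prop where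
  base : Base D 0 0 0 s
  static : Static D s
  mate : ∀ h : Fin D.m × Bool, s.arr 4 (code h) = code (D.flip h)
  weight : ∀ x : Fin D.k, s.arr 7 x =
    (Finset.univ.filter fun v : Fin n => v.val < j ∧ D.map v = x).card
  alive : s.arr 9 = 0

theorem EdgeInv.countInv (hI : EdgeInv D D.m s) : CountInv D 0 (s.setVar 10 0) := by
  obtain ⟨L, hnd, hmem, hL⟩ := hI.inc
  refine ⟨hI.base.setVar le_rfl, ⟨fun h => hI.own h h.1.2,
    hL.incident hnd fun x h => by simp [hmem], hI.map⟩, fun h => hI.mate h h.1.2, fun x => ?_,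
    hI.zero.2⟩
  simp [hI.zero.1]

theorem CountInv.step {j : ℕ} (hW : 8 * D.size ≤ W) (hj : j < n) (hI : CountInv D j s)
    (h10 : s.var 10 = j) :
    wp W Prog.count s fun s' => s'.var 10 = j ∧ s'.var 3 = 1 ∧
      CountInv D (j + 1) (s'.setVar 10 (j + 1)) := by
  set v : Fin n := ⟨j, hj⟩ with hv
  have hs : n + D.k + D.m = D.size := rfl
  have hk := (D.map v).2
  have hone := hI.base.one
  have hmap : s.arr 2 j = D.map v := hI.static.map v
  have hle : s.arr 7 (D.map v) ≤ n := by
    rw [hI.weight]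
    exact (Finset.card_le_univ _).trans (by simp)
  refine wp_load (v := D.map v) (by simp [h10, hmap]) (by omega) ?_
  refine wp_load (v := s.arr 7 (D.map v)) (by simp) (by omega) ?_
  refine wp_add (v := s.arr 7 (D.map v) + 1) (by simp [hone]) (by omega) ?_
  refine wp_store (i := D.map v) (v := s.arr 7 (D.map v) + 1) (by simp) (by simp) (by omega) ?_
  refine ⟨by simp [h10], by simp [hone], ?_, hI.static.congr (by simp) (by simp) (by simp)
    (by simp), by simpa using hI.mate, fun x => ?_, by simp [hI.alive]⟩
  · exact hI.base.congr fun y hy => by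
      simp [show y ≠ 10 by omega, show y ≠ 11 by omega, show y ≠ 12 by omega]
  · simp only [State.setVar_arr, State.setArr_arr, if_true]
    by_cases hx : x = D.map v
    · subst hx
      have : (Finset.univ.filter fun u : Fin n => u.val < j + 1 ∧ D.map u = D.map v) =
          insert v (Finset.univ.filter fun u : Fin n => u.val < j ∧ D.map u = D.map v) := by
        ext u
        simp only [Finset.mem_insert, Finset.mem_filter, Finset.mem_univ, true_and]
        constructor
        · rintro ⟨h1, h2⟩
          rcases Nat.lt_succ_iff_lt_or_eq.1 h1 with h | h
          · exact Or.inr ⟨h, h2⟩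
          · exact Or.inl (Fin.ext h)
        · rintro (h | h)
          · rw [h]
            exact ⟨j.lt_succ_self, rfl⟩
          · exact ⟨h.1.trans j.lt_succ_self, h.2⟩
      rw [Function.update_self, hI.weight, this, Finset.card_insert_of_notMem (by simp [hv])]
    · rw [Function.update_of_ne (fun hc => hx (Fin.ext hc)), hI.weight]
      congr 1
      ext u
      simp only [Finset.mem_filter, Finset.mem_univ, true_and]
      refine ⟨fun h => ⟨by omega, h.2⟩, fun h => ⟨?_, h.2⟩⟩
      have : u.val ≠ j := fun hc => hx (h.2.symm.trans (congrArg D.map (Fin.ext hc)))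
      omega

/-- The state in which the half-edge structure `μ` on the set `A`, the list `l` of the vertices
outside `A`, and vertices into which these were merged are stored. -/
structure Stored (D : Data n) (μ : Fin D.m × Bool → Fin D.m × Bool) (A : Finset (Fin D.k))
    (π : Fin D.k → Fin D.k) (l : List (Fin D.k)) (s : State) : Prop where
  base : Base D l.length 0 0 s
  static : Static D s
  mate : ∀ h, D.own h ∈ A → s.arr 4 (code h) = code (μ h)
  nodup : l.Nodup
  mem : ∀ x, x ∈ l ↔ x ∉ A
  log : ∀ (i : ℕ) (hi : i < l.length), s.arr 10 i = l[i]
  dead : ∀ x : Fin D.k, s.arr 9 x = if x ∈ A then 0 else 1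
  par : ∀ (i : ℕ) (hi : i < l.length), ∃ z : Fin D.k, s.arr 8 l[i] = z ∧ π z = π l[i] ∧
    (z ∈ A ∨ ∃ (i' : ℕ) (h : i' < l.length), i < i' ∧ l[i'] = z)

variable {μ μ' : Fin D.m × Bool → Fin D.m × Bool} {A : Finset (Fin D.k)} {π : Fin D.k → Fin D.k}
  {l : List (Fin D.k)}

theorem Stored.congr (h : Stored D μ A π l s) {s' : State} (hv : ∀ y < 10, s'.var y = s.var y)
    (ha : ∀ y ≠ 7, s'.arr y = s.arr y) : Stored D μ A π l s' where
  base := h.base.congr hv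
  static := h.static.congr (ha 2 (by simp)) (ha 3 (by simp)) (ha 5 (by simp)) (ha 6 (by simp))
  mate := by rw [ha 4 (by simp)]; exact h.mate
  nodup := h.nodup
  mem := h.mem
  log := by rw [ha 10 (by simp)]; exact h.log
  dead := by rw [ha 9 (by simp)]; exact h.dead
  par := by rw [ha 8 (by simp)]; exact h.par

theorem CountInv.stored (hI : CountInv D n s) :
    Stored D D.flip Finset.univ id [] s ∧ ∀ x : Fin D.k, s.arr 7 x = Data.weight D.map x := by
  refine ⟨⟨hI.base, hI.static, fun h _ => hI.mate h, List.nodup_nil, by simp, by simp,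
    by simp [hI.alive], by simp⟩, fun x => ?_⟩
  rw [hI.weight, Data.weight]
  congr 1
  ext v
  simp

theorem Stored.length_le (h : Stored D μ A π l s) : l.length ≤ D.k := by
  simpa using h.nodup.length_le_card

/-- The state `s₀` may differ from `s` in the mates, the weights and the variables from `10` on,
because the callers rewrite these just before. Mates are claimed only for half-edges of remaining
vertices, so stale entries at `x` do no harm. -/
theorem Stored.wp_remove (hS : Stored D μ A π l s) (hW : 8 * D.size ≤ W)
    (hfix : ∀ y ∈ A, π y = y) {s₀ : State} (hv₀ : ∀ y < 10, s₀.var y = s.var y)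
    (ha₀ : ∀ y, y ≠ 4 → y ≠ 7 → s₀.arr y = s.arr y) {x y : Fin D.k} (hx : x ∈ A) (hy : y ∈ A)
    (hxy : x ≠ y) (h10 : s₀.var 10 = x) {z : ℕ} (hzy : s₀.var z = y)
    (hmate : ∀ h, D.own h ∈ A.erase x → s₀.arr 4 (code h) = code (μ' h))
    (H : ∀ s' : State, s'.var 10 = x → s'.arr 7 = s₀.arr 7 →
      Stored D μ' (A.erase x) (merge π x y) (l ++ [x]) s' → Q s') :
    wp W (Prog.remove z) s₀ Q := by
  have hs : n + D.k + D.m = D.size := rfl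
  have hk := x.2
  have hk' := y.2
  have hone : s₀.var 3 = 1 := by rw [hv₀ 3 (by simp), hS.base.one]
  have hlog : s₀.var 7 = l.length := by rw [hv₀ 7 (by simp), hS.base.log]
  have hxl : x ∉ l := fun hc => (hS.mem x).1 hc hx
  have hlen := hS.length_le
  refine wp_store (i := x) (v := y) h10 hzy (by omega) ?_
  refine wp_store (i := x) (v := 1) (by simp [h10]) (by simp [hone]) (by omega) ?_
  refine wp_store (i := l.length) (v := x) (by simp [hlog]) (by simp [h10]) (by omega) ?_
  refine wp_add (v := l.length + 1) (by simp [hlog, hone]) (by omega) ?_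
  have hget : ∀ (i : ℕ) (hi : i < l.length), (l ++ [x])[i]'(by simp; omega) = l[i] :=
    fun i hi => List.getElem_append_left hi
  have hget' : (l ++ [x])[l.length]'(by simp) = x := by simp
  have hπ : ∀ a b, π a = π b → merge π x y a = merge π x y b := by
    intro a b h
    simp [merge, h]
  refine H _ (by simp [h10]) (by simp) ⟨?_, ?_, ?_, ?_, ?_, ?_, ?_, ?_⟩
  · have := hS.base
    constructor <;> simp [hv₀]
    exacts [this.k, this.m, this.n, this.one, this.two, this.four, this.zero, this.newk, this.newm]
  · exact hS.static.congr (by simp [ha₀]) (by simp [ha₀]) (by simp [ha₀]) (by simp [ha₀])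
  · simpa using hmate
  · rw [List.nodup_append]
    refine ⟨hS.nodup, List.nodup_singleton _, fun a ha b hb hab => ?_⟩
    rw [List.mem_singleton] at hb
    exact hxl (hb ▸ hab ▸ ha)
  · intro u
    rw [List.mem_append, hS.mem, List.mem_singleton, Finset.mem_erase]
    tauto
  · intro i hi
    simp only [State.setVar_arr, State.setArr_arr, if_true]
    rw [List.length_append, List.length_singleton] at hi
    rcases Nat.lt_or_ge i l.length with h | h
    · rw [Function.update_of_ne h.ne, hget i h]
      simpa [ha₀] using hS.log i h
    · obtain rfl : i = l.length := by omega
      rw [Function.update_self, hget']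
  · intro u
    simp only [State.setVar_arr, State.setArr_arr, if_true]
    by_cases hu : u = x
    · simp [hu]
    · simp [Function.update_of_ne (fun hc => hu (Fin.ext hc)), hu, ha₀, hS.dead]
  · intro i hi
    have e8 : (8 : ℕ) ≠ 10 ∧ (8 : ℕ) ≠ 9 := by simp
    simp only [State.setVar_arr, State.setArr_arr, if_true, if_neg e8.1, if_neg e8.2]
    rw [List.length_append, List.length_singleton] at hi
    rcases Nat.lt_or_ge i l.length with h | h
    · rw [hget i h, Function.update_of_ne fun hc => hxl ((Fin.ext hc : l[i] = x) ▸ List.getElem_mem h),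
        ha₀ 8 (by simp) (by simp)]
      obtain ⟨u, h1, h2, h3⟩ := hS.par i h
      refine ⟨u, h1, hπ _ _ h2, ?_⟩
      -- A vertex merged earlier into `x` keeps its entry; `x` has now become the last, hence a
      -- later, member of the list.
      by_cases hu : u = x
      · exact Or.inr ⟨l.length, by simp, h, hget'.trans hu.symm⟩
      · rcases h3 with h3 | ⟨i', h4, h5, h6⟩
        · exact Or.inl (Finset.mem_erase.2 ⟨hu, h3⟩)
        · exact Or.inr ⟨i', by simp; omega, h5, (hget i' h4).trans h6⟩
    · obtain rfl : i = l.length := by omega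
      rw [hget', Function.update_self]
      refine ⟨y, rfl, ?_, Or.inl (Finset.mem_erase.2 ⟨hxy.symm, hy⟩)⟩
      simp [merge, hfix y hy, hfix x hx, hxy.symm]

/-- The only half-edges whose mates change are the four old mates of the half-edges at `x`. They are
distinct because `μ` is an involution, so the four writes do not interfere. -/
theorem Stored.wp_rejoin (hS : Stored D μ A π l s) (hW : 8 * D.size ≤ W)
    (hA : IsHalfCactus D.own μ A) (hfix : ∀ y ∈ A, π y = y) {x y : Fin D.k} (hx : x ∈ A)
    (hxy : x ≠ y) (h10 : s.var 10 = x) {h₀ h₁ h₂ h₃ : Fin D.m × Bool} (h01 : h₀ ≠ h₁)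
    (h02 : h₀ ≠ h₂) (h03 : h₀ ≠ h₃) (h12 : h₁ ≠ h₂) (h13 : h₁ ≠ h₃) (h23 : h₂ ≠ h₃)
    (hmem : ∀ h, D.own h = x ↔ h = h₀ ∨ h = h₁ ∨ h = h₂ ∨ h = h₃)
    {a b c d z : ℕ} (ha : s.var a = code (μ h₀)) (hb : s.var b = code (μ h₁))
    (hc : s.var c = code (μ h₂)) (hd : s.var d = code (μ h₃))
    (hzy : s.var z = y) (hy : y ∈ A)
    (H : ∀ s' : State, s'.var 10 = x → s'.arr 7 = s.arr 7 →
      Stored D (splice D.own μ x (swapPairs h₀ h₂ h₁ h₃)) (A.erase x) (merge π x y) (l ++ [x]) s' →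
        Q s') :
    wp W (Prog.rejoin a b c d z) s Q := by
  have hs : n + D.k + D.m = D.size := rfl
  have hW' : ∀ h : Fin D.m × Bool, code h ≤ W := fun h => by have := code_lt h; omega
  refine wp_store ha hc (hW' _) ?_
  refine wp_store (i := code (μ h₂)) (v := code (μ h₀)) (by simp [hc]) (by simp [ha]) (hW' _) ?_
  refine wp_store (i := code (μ h₁)) (v := code (μ h₃)) (by simp [hb]) (by simp [hd]) (hW' _) ?_
  refine wp_store (i := code (μ h₃)) (v := code (μ h₁)) (by simp [hd]) (by simp [hb]) (hW' _) ?_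
  refine hS.wp_remove hW hfix (by simp) (fun y h4 _ => by simp [h4]) hx hy hxy (by simpa using h10)
    (by simpa using hzy) ?_ (fun s' h1 h2 => H s' h1 (by simpa using h2))
  intro h hh
  have hhA := Finset.mem_of_mem_erase hh
  have hinj : ∀ {u v}, D.own u = x → D.own v = x → u ≠ v → code (μ u) ≠ code (μ v) := by
    intro u v hu hv huv hc
    rw [code_inj] at hc
    exact huv (by rw [← hA.invol u (hu ▸ hx), hc, hA.invol v (hv ▸ hx)])
  have o₀ := (hmem h₀).2 (by simp)
  have o₁ := (hmem h₁).2 (by simp)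
  have o₂ := (hmem h₂).2 (by simp)
  have o₃ := (hmem h₃).2 (by simp)
  have k01 := hinj o₀ o₁ h01
  have k02 := hinj o₀ o₂ h02
  have k03 := hinj o₀ o₃ h03
  have k12 := hinj o₁ o₂ h12
  have k13 := hinj o₁ o₃ h13
  have k23 := hinj o₂ o₃ h23
  simp only [State.setArr_arr, if_true]
  unfold splice
  split_ifs with h1
  · have h2 := hA.invol h hhA
    have h4 : ∀ u, μ h = u → h = μ u := fun u hu => by rw [← hu, h2]
    rcases (hmem _).1 h1 with h3 | h3 | h3 | h3 <;> rw [h3, h4 _ h3]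
    · simp [swapPairs, k01, k02, k03]
    · simp [swapPairs, h01.symm, h12, k13]
    · simp [swapPairs, h02.symm, k12.symm, k23]
    · simp [swapPairs, h03.symm, h13.symm, h23.symm]
  · have : ∀ u, D.own u = x → code h ≠ code (μ u) := by
      intro u hu hc
      rw [code_inj] at hc
      exact h1 (by rw [hc, hA.invol u (hu ▸ hx), hu])
    rw [Function.update_of_ne (this _ o₃), Function.update_of_ne (this _ o₁),
      Function.update_of_ne (this _ o₂), Function.update_of_ne (this _ o₀), hS.mate h hhA]

end Data
end CactusRep

/-! ### Correctness of the two contraction loops. -/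

namespace CactusRep

open HalfEdge RAM

namespace Data

variable {n : ℕ} {D : Data n} {G : SimpleGraph (Fin n)} {W : ℕ} {s : State} {Q : State → Prop}
  {μ : Fin D.m × Bool → Fin D.m × Bool} {A : Finset (Fin D.k)} {π : Fin D.k → Fin D.k}
  {l : List (Fin D.k)}

theorem code_le (hW : 8 * D.size ≤ W) (h : Fin D.m × Bool) : code h ≤ W := by
  have := code_lt h
  unfold size at hW
  omega

theorem val_le (hW : 8 * D.size ≤ W) (x : Fin D.k) : (x : ℕ) ≤ W := by
  have := x.2
  unfold size at hW
  omega

/-- The stored structure and weights are those after the vertices below `j` were considered for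
being split off as superfluous vertices of degree four. -/
def SuppressState (D : Data n) (G : SimpleGraph (Fin n)) (j : ℕ) (s : State) : Prop :=
  ∃ μ A π l, SuppressInv D G j μ A π ∧ Stored D μ A π l s ∧
    ∀ x : Fin D.k, s.arr 7 x = weight D.map x

theorem SuppressInv.skip_state {j : ℕ} (hI : SuppressInv D G j μ A π) (hS : Stored D μ A π l s)
    (hwt : ∀ x : Fin D.k, s.arr 7 x = weight D.map x) {x : Fin D.k} (hx : x.val = j)
    {s' : State} (hv : ∀ y ≤ 10, s'.var y = s.var y) (ha : s'.arr = s.arr) (h10 : s.var 10 = j)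
    (h : weight D.map x = 0 → D.deg x = 4 →
      ∀ h h', D.own h = x → D.own h' = x → h ≠ h' → D.own (μ h) ≠ D.own (μ h')) :
    s'.var 10 = j ∧ s'.var 3 = 1 ∧ SuppressState D G (j + 1) (s'.setVar 10 (j + 1)) := by
  refine ⟨by rw [hv 10 le_rfl, h10], by rw [hv 3 (by simp), hS.base.one], μ, A, π, l,
    hI.skip hx h, hS.congr (fun y hy => ?_) (by simp [ha]), by simpa [ha] using hwt⟩
  simp [hv y (by omega), show y ≠ 10 by omega]

theorem SuppressInv.rejoin_state {j : ℕ} (hW : 8 * D.size ≤ W) (hI : SuppressInv D G j μ A π)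
    (hS : Stored D μ A π l s) (hwt : ∀ x : Fin D.k, s.arr 7 x = weight D.map x) {x : Fin D.k}
    (hx : x.val = j) (h10 : s.var 10 = j) (hw : weight D.map x = 0)
    {h₀ h₁ h₂ h₃ : Fin D.m × Bool} (h01 : h₀ ≠ h₁)
    (h02 : h₀ ≠ h₂) (h03 : h₀ ≠ h₃) (h12 : h₁ ≠ h₂) (h13 : h₁ ≠ h₃) (h23 : h₂ ≠ h₃)
    (hmem : ∀ h, D.own h = x ↔ h = h₀ ∨ h = h₁ ∨ h = h₂ ∨ h = h₃)
    {a b c d z : ℕ} (ha : s.var a = code (μ h₀)) (hb : s.var b = code (μ h₁))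
    (hc : s.var c = code (μ h₂)) (hd : s.var d = code (μ h₃))
    (hz : s.var z = D.own (μ h₀)) (heq : D.own (μ h₀) = D.own (μ h₁)) :
    wp W (Prog.rejoin a b c d z) s fun s' => s'.var 10 = j ∧ s'.var 3 = 1 ∧
      SuppressState D G (j + 1) (s'.setVar 10 (j + 1)) := by
  have hxA := hI.todo x hx.ge
  have hx₀ := (hmem h₀).2 (by simp)
  have hy : D.own (μ h₀) ∈ A := hI.red.cactus.mem h₀ (hx₀ ▸ hxA)
  refine hS.wp_rejoin hW hI.red.cactus hI.red.fix hxA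
    (fun hc => hI.loopless h₀ (hx₀ ▸ hxA) (by rw [← hc, hx₀])) (h10.trans hx.symm) h01 h02 h03 h12
    h13 h23 hmem ha hb hc hd hz hy ?_
  intro s' h1 h2 h3
  refine ⟨h1.trans hx, h3.base.one, _, _, _, _,
    hI.step hx hw h01 h02 h03 h12 h13 h23 hmem rfl heq.symm, h3.congr (fun y hy => ?_) (by simp), ?_⟩
  · simp [show y ≠ 10 by omega]
  · simpa [h2] using hwt

theorem SuppressState.step {j : ℕ} (hW : 8 * D.size ≤ W) (hj : j < D.k)
    (hI : SuppressState D G j s) (h10 : s.var 10 = j) :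
    wp W Prog.suppress s fun s' => s'.var 10 = j ∧ s'.var 3 = 1 ∧
      SuppressState D G (j + 1) (s'.setVar 10 (j + 1)) := by
  obtain ⟨μ, A, π, l, hI, hS, hwt⟩ := hI
  set x : Fin D.k := ⟨j, hj⟩ with hx
  have hs : n + D.k + D.m = D.size := rfl
  have hdeg : s.arr 5 j = D.deg x := hS.static.inc.deg x
  have hdle : D.deg x ≤ D.m + D.m := by
    refine (Finset.card_le_univ _).trans ?_
    simp only [Fintype.card_prod, Fintype.card_fin, Fintype.card_bool]
    omega
  have hwle : weight D.map x ≤ n := (Finset.card_le_univ _).trans (by simp)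
  have hw : s.arr 7 j = weight D.map x := hwt x
  refine wp_load (v := D.deg x) (by simp [h10, hdeg]) (by omega) ?_
  refine wp_load (v := weight D.map x) (by simp [h10, hw]) (by omega) ?_
  refine wp_eq (fun h4 => ?_) (fun h4 => ?_)
  swap
  · refine hI.skip_state hS hwt (x := x) rfl (fun y hy => ?_) rfl h10 fun _ hc => ?_
    · simp [show y ≠ 12 by omega, show y ≠ 11 by omega]
    · simp [hS.base.four, hc] at h4
  replace h4 : D.deg x = 4 := by simpa [hS.base.four] using h4
  refine wp_eq (fun h0 => ?_) (fun h0 => ?_)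
  swap
  · refine hI.skip_state hS hwt (x := x) rfl (fun y hy => ?_) rfl h10 fun hc => ?_
    · simp [show y ≠ 12 by omega, show y ≠ 11 by omega]
    · simp [hS.base.zero, hc] at h0
  replace h0 : weight D.map x = 0 := by simpa [hS.base.zero] using h0
  obtain ⟨h₀, h₁, h₂, h₃, h01, h02, h03, h12, h13, h23, hmem, f0, f1, f2, f3⟩ :=
    hS.static.inc.four x h4
  rw [show (x : ℕ) = j from rfl] at f0 f1 f2 f3
  have hone := hS.base.one
  have hxA := hI.todo x le_rfl
  have m0 := hS.mate h₀ ((hmem h₀).2 (by simp) ▸ hxA)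
  have m1 := hS.mate h₁ ((hmem h₁).2 (by simp) ▸ hxA)
  have m2 := hS.mate h₂ ((hmem h₂).2 (by simp) ▸ hxA)
  have m3 := hS.mate h₃ ((hmem h₃).2 (by simp) ▸ hxA)
  have ho := hS.static.own
  refine wp_add (v := j + j) (by simp [h10]) (by omega) ?_
  refine wp_add (v := j + j + (j + j)) (by simp) (by omega) ?_
  refine wp_load (v := code h₀) (by simp [f0]) (code_le hW _) ?_
  refine wp_add (v := j + j + (j + j) + 1) (by simp [hone]) (by omega) ?_
  refine wp_load (v := code h₁) (by simp [f1]) (code_le hW _) ?_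
  refine wp_add (v := j + j + (j + j) + 2) (by simp [hone]) (by omega) ?_
  refine wp_load (v := code h₂) (by simp [f2]) (code_le hW _) ?_
  refine wp_add (v := j + j + (j + j) + 3) (by simp [hone]) (by omega) ?_
  refine wp_load (v := code h₃) (by simp [f3]) (code_le hW _) ?_
  refine wp_load (v := code (μ h₀)) (by simp [m0]) (code_le hW _) ?_
  refine wp_load (v := code (μ h₁)) (by simp [m1]) (code_le hW _) ?_
  refine wp_load (v := code (μ h₂)) (by simp [m2]) (code_le hW _) ?_
  refine wp_load (v := code (μ h₃)) (by simp [m3]) (code_le hW _) ?_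
  refine wp_load (v := D.own (μ h₀)) (by simp [ho]) (val_le hW _) ?_
  refine wp_load (v := D.own (μ h₁)) (by simp [ho]) (val_le hW _) ?_
  refine wp_load (v := D.own (μ h₂)) (by simp [ho]) (val_le hW _) ?_
  refine wp_load (v := D.own (μ h₃)) (by simp [ho]) (val_le hW _) ?_
  generalize hs' : State.setVar _ 25 _ = s'
  have v10 : s'.var 10 = j := by rw [← hs']; simp [h10]
  have v18 : s'.var 18 = code (μ h₀) := by rw [← hs']; simp
  have v19 : s'.var 19 = code (μ h₁) := by rw [← hs']; simp
  have v20 : s'.var 20 = code (μ h₂) := by rw [← hs']; simp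
  have v21 : s'.var 21 = code (μ h₃) := by rw [← hs']; simp
  have v22 : s'.var 22 = D.own (μ h₀) := by rw [← hs']; simp
  have v23 : s'.var 23 = D.own (μ h₁) := by rw [← hs']; simp
  have v24 : s'.var 24 = D.own (μ h₂) := by rw [← hs']; simp
  have v25 : s'.var 25 = D.own (μ h₃) := by rw [← hs']; simp
  have hv : ∀ y ≤ 10, s'.var y = s.var y := by
    intro y hy
    rw [← hs']
    simp [show ∀ i, 10 < i → y ≠ i by omega]
  have ha : s'.arr = s.arr := by rw [← hs']; simp
  clear hs'
  have hS' : Stored D μ A π l s' := hS.congr (fun y hy => hv y (by omega)) (by simp [ha])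
  have hwt' : ∀ x : Fin D.k, s'.arr 7 x = weight D.map x := ha ▸ hwt
  -- Each of the six tests below finds one parallel pair; `key` is used with the four half-edges
  -- permuted so that this pair comes first.
  have key := @SuppressInv.rejoin_state n D G W s' μ A π l j hW hI hS' hwt' x rfl v10 h0
  refine wp_eq (fun h => ?_) (fun n01 => ?_)
  · rw [v22, v23, ← Fin.ext_iff] at h
    exact key h01 h02 h03 h12 h13 h23 hmem v18 v19 v20 v21 v22 h
  refine wp_eq (fun h => ?_) (fun n02 => ?_)
  · rw [v22, v24, ← Fin.ext_iff] at h
    exact key h02 h01 h03 h12.symm h23 h13 (fun h => by rw [hmem]; tauto) v18 v20 v19 v21 v22 h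
  refine wp_eq (fun h => ?_) (fun n03 => ?_)
  · rw [v22, v25, ← Fin.ext_iff] at h
    exact key h03 h01 h02 h13.symm h23.symm h12 (fun h => by rw [hmem]; tauto) v18 v21 v19 v20 v22 h
  refine wp_eq (fun h => ?_) (fun n12 => ?_)
  · rw [v23, v24, ← Fin.ext_iff] at h
    exact key h12 h01.symm h13 h02.symm h23 h03 (fun h => by rw [hmem]; tauto) v19 v20 v18 v21 v23 h
  refine wp_eq (fun h => ?_) (fun n13 => ?_)
  · rw [v23, v25, ← Fin.ext_iff] at h
    exact key h13 h01.symm h12 h03.symm h23.symm h02 (fun h => by rw [hmem]; tauto) v19 v21 v18 v20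
      v23 h
  refine wp_eq (fun h => ?_) (fun n23 => ?_)
  · rw [v24, v25, ← Fin.ext_iff] at h
    exact key h23 h02.symm h12.symm h03.symm h13.symm h01 (fun h => by rw [hmem]; tauto) v20 v21 v18
      v19 v24 h
  rw [v22, v23, ← Fin.ext_iff.ne] at n01
  rw [v22, v24, ← Fin.ext_iff.ne] at n02
  rw [v22, v25, ← Fin.ext_iff.ne] at n03
  rw [v23, v24, ← Fin.ext_iff.ne] at n12
  rw [v23, v25, ← Fin.ext_iff.ne] at n13
  rw [v24, v25, ← Fin.ext_iff.ne] at n23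
  refine hI.skip_state hS hwt (x := x) rfl hv ha h10 fun _ _ h h' hh hh' hne => ?_
  rcases (hmem h).1 hh with rfl | rfl | rfl | rfl <;>
    rcases (hmem h').1 hh' with rfl | rfl | rfl | rfl <;> first
    | exact absurd rfl hne
    | assumption
    | (apply Ne.symm; assumption)

/-- The stored structure and weights are those after the vertices below `j` were considered for
being split off as leaves. -/
def LeafState (D : Data n) (G : SimpleGraph (Fin n)) (j : ℕ) (s : State) : Prop :=
  ∃ μ A π l, LeafInv D G j μ A π ∧ Stored D μ A π l s ∧
    (∀ x ∈ A, s.arr 7 x = weight (fun v => π (D.map v)) x) ∧ ∀ x : Fin D.k, s.arr 7 x ≤ n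

theorem SuppressState.leafState (h : SuppressState D G D.k s) :
    LeafState D G 0 (s.setVar 10 0) := by
  obtain ⟨μ, A, π, l, hI, hS, hwt⟩ := h
  refine ⟨μ, A, π, l, hI.leafInv, hS.congr (fun y hy => ?_) (by simp), fun x _ => ?_,
    fun x => ?_⟩
  · simp [show y ≠ 10 by omega]
  · simp only [hI.map_fix]
    exact hwt x
  · exact (hwt x).trans_le ((Finset.card_le_univ _).trans (by simp))

theorem LeafInv.skip_state {j : ℕ} (hI : LeafInv D G j μ A π) (hS : Stored D μ A π l s)
    (hwt : ∀ x ∈ A, s.arr 7 x = weight (fun v => π (D.map v)) x)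
    (hle : ∀ x : Fin D.k, s.arr 7 x ≤ n) {x : Fin D.k} (hx : x.val = j)
    {s' : State} (hv : ∀ y ≤ 10, s'.var y = s.var y) (ha : s'.arr = s.arr) (h10 : s.var 10 = j)
    (h : x ∈ A → weight (fun v => π (D.map v)) x = 1 → D.deg x = 2 →
      ∀ h h', D.own h = x → D.own h' = x → h ≠ h' → D.own (μ h) = D.own (μ h') →
        D.own (μ h) = x) :
    s'.var 10 = j ∧ s'.var 3 = 1 ∧ LeafState D G (j + 1) (s'.setVar 10 (j + 1)) := by
  refine ⟨by rw [hv 10 le_rfl, h10], by rw [hv 3 (by simp), hS.base.one], μ, A, π, l,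
    hI.skip hx h, hS.congr (fun y hy => ?_) (by simp [ha]), by simpa [ha] using hwt,
    by simpa [ha] using hle⟩
  simp [hv y (by omega), show y ≠ 10 by omega]

theorem LeafState.step {j : ℕ} (hW : 8 * D.size ≤ W) (hj : j < D.k)
    (hI : LeafState D G j s) (h10 : s.var 10 = j) :
    wp W Prog.leaf s fun s' => s'.var 10 = j ∧ s'.var 3 = 1 ∧
      LeafState D G (j + 1) (s'.setVar 10 (j + 1)) := by
  obtain ⟨μ, A, π, l, hI, hS, hwt, hle⟩ := hI
  set x : Fin D.k := ⟨j, hj⟩ with hx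
  have hs : n + D.k + D.m = D.size := rfl
  have hdeg : s.arr 5 j = D.deg x := hS.static.inc.deg x
  have hdle : D.deg x ≤ D.m + D.m := by
    refine (Finset.card_le_univ _).trans ?_
    simp only [Fintype.card_prod, Fintype.card_fin, Fintype.card_bool]
    omega
  -- The weight is loaded before it is known whether the vertex still exists, so its bound is needed
  -- for removed vertices as well.
  have hlx : s.arr 7 j ≤ n := hle x
  have hdead : s.arr 9 j = if x ∈ A then 0 else 1 := hS.dead x
  have hone := hS.base.one
  refine wp_load (v := if x ∈ A then 0 else 1) (by simp [h10, hdead]) (by split_ifs <;> omega) ?_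
  refine wp_load (v := D.deg x) (by simp [h10, hdeg]) (by omega) ?_
  refine wp_load (v := s.arr 7 j) (by simp [h10]) (by omega) ?_
  refine wp_eq (fun hxA => ?_) (fun hxA => ?_)
  swap
  · refine hI.skip_state hS hwt hle (x := x) rfl (fun y hy => ?_) rfl h10 fun hc => ?_
    · simp [show y ≠ 13 by omega, show y ≠ 12 by omega, show y ≠ 11 by omega]
    · simp [hS.base.zero, hc] at hxA
  replace hxA : x ∈ A := by simpa [hS.base.zero] using hxA
  refine wp_eq (fun h2 => ?_) (fun h2 => ?_)
  swap
  · refine hI.skip_state hS hwt hle (x := x) rfl (fun y hy => ?_) rfl h10 fun _ _ hc => ?_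
    · simp [show y ≠ 13 by omega, show y ≠ 12 by omega, show y ≠ 11 by omega]
    · simp [hS.base.two, hc] at h2
  replace h2 : D.deg x = 2 := by simpa [hS.base.two] using h2
  have hwx : s.arr 7 j = weight (fun v => π (D.map v)) x := hwt x hxA
  refine wp_eq (fun hw => ?_) (fun hw => ?_)
  swap
  · refine hI.skip_state hS hwt hle (x := x) rfl (fun y hy => ?_) rfl h10 fun _ hc => ?_
    · simp [show y ≠ 13 by omega, show y ≠ 12 by omega, show y ≠ 11 by omega]
    · simp [hone, hwx, hc] at hw
  replace hw : weight (fun v => π (D.map v)) x = 1 := by simpa [hone, hwx] using hw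
  obtain ⟨h₀, h₁, h01, hmem, f0, f1⟩ := hS.static.inc.two x h2
  rw [show (x : ℕ) = j from rfl] at f0 f1
  have hx₀ := (hmem h₀).2 (by simp)
  have hx₁ := (hmem h₁).2 (by simp)
  have hA := hI.red.cactus
  have m0 := hS.mate h₀ (hx₀ ▸ hxA)
  have m1 := hS.mate h₁ (hx₁ ▸ hxA)
  have ho := hS.static.own
  refine wp_add (v := j + j) (by simp [h10]) (by omega) ?_
  refine wp_add (v := j + j + (j + j)) (by simp) (by omega) ?_
  refine wp_load (v := code h₀) (by simp [f0]) (code_le hW _) ?_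
  refine wp_add (v := j + j + (j + j) + 1) (by simp [hone]) (by omega) ?_
  refine wp_load (v := code h₁) (by simp [f1]) (code_le hW _) ?_
  refine wp_load (v := code (μ h₀)) (by simp [m0]) (code_le hW _) ?_
  refine wp_load (v := code (μ h₁)) (by simp [m1]) (code_le hW _) ?_
  refine wp_load (v := D.own (μ h₀)) (by simp [ho]) (val_le hW _) ?_
  refine wp_load (v := D.own (μ h₁)) (by simp [ho]) (val_le hW _) ?_
  generalize hs' : State.setVar _ 20 _ = s'
  have v17 : s'.var 17 = code (μ h₀) := by rw [← hs']; simp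
  have v18 : s'.var 18 = code (μ h₁) := by rw [← hs']; simp
  have v19 : s'.var 19 = D.own (μ h₀) := by rw [← hs']; simp
  have v20 : s'.var 20 = D.own (μ h₁) := by rw [← hs']; simp
  have hv : ∀ y ≤ 10, s'.var y = s.var y := by
    intro y hy
    rw [← hs']
    simp [show ∀ i, 10 < i → y ≠ i by omega]
  have ha : s'.arr = s.arr := by rw [← hs']; simp
  clear hs'
  refine wp_eq (fun heq => ?_) (fun hne => ?_)
  swap
  · rw [v19, v20, ← Fin.ext_iff.ne] at hne
    refine hI.skip_state hS hwt hle (x := x) rfl hv ha h10 fun _ _ _ h h' hh hh' hhh heq => ?_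
    rcases (hmem h).1 hh with rfl | rfl <;> rcases (hmem h').1 hh' with rfl | rfl <;> first
      | exact absurd rfl hhh
      | exact absurd heq hne
      | exact absurd heq.symm hne
  rw [v19, v20, ← Fin.ext_iff] at heq
  refine wp_eq (fun hx => ?_) (fun hx => ?_)
  · rw [v19, hv 10 le_rfl, h10] at hx
    refine hI.skip_state hS hwt hle (x := x) rfl hv ha h10 fun _ _ _ h h' hh hh' hhh heq' => ?_
    have hx : D.own (μ h₀) = x := Fin.ext hx
    rcases (hmem h).1 hh with rfl | rfl
    · exact hx
    · exact heq ▸ hx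
  obtain ⟨z, hz⟩ : ∃ z, D.own (μ h₀) = z := ⟨_, rfl⟩
  have hz₁ : D.own (μ h₁) = z := heq ▸ hz
  have hxz : x ≠ z := by
    intro hc
    rw [v19, hv 10 le_rfl, h10, hz, ← hc] at hx
    exact hx rfl
  have hzA : z ∈ A := hz ▸ hA.mem h₀ (hx₀ ▸ hxA)
  have hwz := weight_merge_self hxz hw
  have hwz' : weight (fun v => merge π x z (D.map v)) z ≤ n :=
    (Finset.card_le_univ _).trans (by simp)
  have hne : code (μ h₀) ≠ code (μ h₁) := by
    intro hc
    rw [code_inj] at hc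
    exact h01 (by rw [← hA.invol h₀ (hx₀ ▸ hxA), hc, hA.invol h₁ (hx₁ ▸ hxA)])
  rw [hz] at v19
  refine wp_store (i := code (μ h₀)) (v := code (μ h₁)) v17 v18 (code_le hW _) ?_
  refine wp_store (i := code (μ h₁)) (v := code (μ h₀)) v18 v17 (code_le hW _) ?_
  refine wp_load (v := weight (fun v => π (D.map v)) z) (by simp [v19, ha, hwt z hzA]) (by omega) ?_
  refine wp_add (v := weight (fun v => merge π x z (D.map v)) z)
    (by simp [hv 3, hone, hwz]) (by omega) ?_
  refine wp_store (i := z) (v := weight (fun v => merge π x z (D.map v)) z) (by simp [v19])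
    (by simp) (by omega) ?_
  refine hS.wp_remove hW hI.red.fix (fun y hy => ?_) (fun y h4 h7 => ?_) hxA hzA hxz ?_ (y := z) ?_
    (μ' := splice D.own μ x (Equiv.swap h₀ h₁)) (fun h hh => ?_) ?_
  · simp [show y ≠ 21 by omega, hv y (by omega)]
  · simp [h4, h7, ha]
  · simp [hv 10, h10]
    rfl
  · simp [v19]
  · have hhA := Finset.mem_of_mem_erase hh
    simp only [State.setArr_arr, State.setVar_arr, ha]
    unfold splice
    simp only [if_true, if_neg (show (4 : ℕ) ≠ 7 by simp)]
    split_ifs with h1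
    · have h2 := hA.invol h hhA
      have h4 : ∀ u, μ h = u → h = μ u := fun u hu => by rw [← hu, h2]
      rcases (hmem _).1 h1 with h3 | h3 <;> rw [h3, h4 _ h3]
      · simp [hne]
      · simp
    · have : ∀ u, D.own u = x → code h ≠ code (μ u) := by
        intro u hu hc
        rw [code_inj] at hc
        exact h1 (by rw [hc, hA.invol u (hu ▸ hxA), hu])
      rw [Function.update_of_ne (this _ hx₁), Function.update_of_ne (this _ hx₀), hS.mate h hhA]
  · intro s' h1 h2 h3
    refine ⟨h1, h3.base.one, _, _, _, _, hI.step rfl hxA hw h01 hmem hz hz₁ hxz,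
      h3.congr (fun y hy => ?_) (by simp), fun y hy => ?_, fun y => ?_⟩
    · simp [show y ≠ 10 by omega]
    · rw [State.setVar_arr, h2]
      by_cases hyz : y = z
      · simp [hyz]
      · have hyA := Finset.mem_erase.1 hy
        rw [weight_merge_of_ne hyA.1 hyz, ← hwt y hyA.2]
        simp [Function.update_of_ne (fun hc => hyz (Fin.ext hc)), ha]
    · rw [State.setVar_arr, h2]
      by_cases hyz : y = z
      · simpa [hyz] using hwz'
      · simpa [Function.update_of_ne (fun hc => hyz (Fin.ext hc)), ha] using hle y

end Data
end CactusRep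

/-! ### New names and output. -/

namespace CactusRep

open HalfEdge RAM

namespace Data

variable {n : ℕ} {D : Data n} {G : SimpleGraph (Fin n)} {W : ℕ} {s : State}
  {μ : Fin D.m × Bool → Fin D.m × Bool} {A : Finset (Fin D.k)} {π : Fin D.k → Fin D.k}
  {l : List (Fin D.k)}

/-- The number of elements of `A` below `x`. -/
def rank {k : ℕ} (A : Finset (Fin k)) (x : Fin k) : ℕ := (A.filter (· < x)).card

theorem rank_lt {k : ℕ} {A : Finset (Fin k)} {x : Fin k} (hx : x ∈ A) : rank A x < A.card :=
  Finset.card_lt_card ⟨Finset.filter_subset _ _, fun h => by simpa using h hx⟩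

theorem rank_strictMonoOn {k : ℕ} (A : Finset (Fin k)) : StrictMonoOn (rank A) A := by
  intro x hx y _ hxy
  refine Finset.card_lt_card ⟨fun a ha => ?_, fun h => ?_⟩
  · rw [Finset.mem_filter] at ha ⊢
    exact ⟨ha.1, ha.2.trans hxy⟩
  · simpa using h (Finset.mem_filter.2 ⟨hx, hxy⟩)

theorem exists_rank_eq {k : ℕ} (A : Finset (Fin k)) {r : ℕ} (hr : r < A.card) :
    ∃ x ∈ A, rank A x = r := by
  have h := Finset.eq_of_subset_of_card_le (s := A.image (rank A)) (t := Finset.range A.card)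
    (Finset.image_subset_iff.2 fun x hx => Finset.mem_range.2 (rank_lt hx))
    (by rw [Finset.card_image_of_injOn (rank_strictMonoOn A).injOn, Finset.card_range])
  rw [← Finset.mem_range, ← h] at hr
  exact Finset.mem_image.1 hr

/-- The vertices with the property `P` have received their new names. -/
structure Naming (D : Data n) (A : Finset (Fin D.k)) (π : Fin D.k → Fin D.k)
    (l : List (Fin D.k)) (a : ℕ) (P : Fin D.k → Prop) (s : State) : Prop where
  base : Base D l.length a 0 s
  own : ∀ h, s.arr 3 (code h) = D.own h
  map : ∀ i : Fin n, s.arr 2 i = D.map i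
  log : ∀ (i : ℕ) (hi : i < l.length), s.arr 10 i = l[i]
  dead : ∀ x : Fin D.k, s.arr 9 x = if x ∈ A then 0 else 1
  par : ∀ (i : ℕ) (hi : i < l.length), ∃ z : Fin D.k, s.arr 8 l[i] = z ∧ π z = π l[i] ∧
    (z ∈ A ∨ ∃ (i' : ℕ) (h : i' < l.length), i < i' ∧ l[i'] = z)
  label : ∀ x, P x → s.arr 11 x = rank A (π x)

theorem Stored.naming (hS : Stored D μ A π l s) :
    Naming D A π l (A.filter fun x => x.val < 0).card (fun x => x ∈ A ∧ x.val < 0)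
      (s.setVar 10 0) where
  base := by simpa using hS.base.setVar le_rfl
  own := hS.static.own
  map := hS.static.map
  log := hS.log
  dead := hS.dead
  par := hS.par
  label x hx := absurd hx.2 (by simp)

theorem Naming.congr {a b : ℕ} {P P' : Fin D.k → Prop} (h : Naming D A π l a P s) {s' : State}
    (hb : Base D l.length b 0 s') (ha : ∀ y ≠ 11, s'.arr y = s.arr y)
    (hl : ∀ x, P' x → s'.arr 11 x = rank A (π x)) : Naming D A π l b P' s' where
  base := hb
  own := by rw [ha 3 (by simp)]; exact h.own
  map := by rw [ha 2 (by simp)]; exact h.map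
  log := by rw [ha 10 (by simp)]; exact h.log
  dead := by rw [ha 9 (by simp)]; exact h.dead
  par := by rw [ha 8 (by simp)]; exact h.par
  label := hl

/-- The counter of named vertices equals the rank of the current vertex, and `π` fixes the vertices
of `A`. -/
theorem Naming.name_step {j : ℕ} (hW : 8 * D.size ≤ W) (hfix : ∀ y ∈ A, π y = y) (hj : j < D.k)
    (hI : Naming D A π l (A.filter fun x => x.val < j).card (fun x => x ∈ A ∧ x.val < j) s)
    (h10 : s.var 10 = j) :
    wp W Prog.name s fun s' => s'.var 10 = j ∧ s'.var 3 = 1 ∧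
      Naming D A π l (A.filter fun x => x.val < j + 1).card (fun x => x ∈ A ∧ x.val < j + 1)
        (s'.setVar 10 (j + 1)) := by
  set x : Fin D.k := ⟨j, hj⟩ with hx
  have hs : n + D.k + D.m = D.size := rfl
  have hdead : s.arr 9 j = if x ∈ A then 0 else 1 := hI.dead x
  have hone := hI.base.one
  have hc : (A.filter fun x => x.val < j).card ≤ D.k := (Finset.card_le_univ _).trans (by simp)
  have hlt : ∀ y : Fin D.k, y.val < j + 1 → y ≠ x → y.val < j := by
    intro y h1 h2
    have : y.val ≠ j := fun hc => h2 (Fin.ext hc)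
    omega
  refine wp_load (v := if x ∈ A then 0 else 1) (by simp [h10, hdead]) (by split_ifs <;> omega) ?_
  refine wp_eq (fun hxA => ?_) (fun hxA => ?_)
  · replace hxA : x ∈ A := by simpa [hI.base.zero] using hxA
    have hf : (A.filter fun x => x.val < j + 1) = insert x (A.filter fun x => x.val < j) := by
      ext y
      simp only [Finset.mem_insert, Finset.mem_filter]
      constructor
      · rintro ⟨h1, h2⟩
        by_cases h : y = x
        · exact Or.inl h
        · exact Or.inr ⟨h1, hlt y h2 h⟩
      · rintro (rfl | h)
        · exact ⟨hxA, by simp [hx]⟩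
        · exact ⟨h.1, by omega⟩
    have hr : (A.filter fun x => x.val < j).card = rank A x := rfl
    refine wp_store (i := j) (v := (A.filter fun x => x.val < j).card) (by simp [h10])
      (by simp [hI.base.newk]) (by omega) ?_
    refine wp_add (v := (A.filter fun x => x.val < j + 1).card)
      (by rw [hf, Finset.card_insert_of_notMem (by simp [hx])]; simp [hI.base.newk, hone])
      (by rw [hf, Finset.card_insert_of_notMem (by simp [hx])]; omega) ?_
    refine ⟨by simp [h10], by simp [hone], hI.congr ?_ (fun y hy => by simp [hy]) fun y hy => ?_⟩
    · have := hI.base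
      constructor <;> simp
      exacts [this.k, this.m, this.n, this.one, this.two, this.four, this.zero, this.log, this.newm]
    · simp only [State.setArr_arr, State.setVar_arr, if_true]
      by_cases hyx : y = x
      · rw [hyx, show (x : ℕ) = j from rfl, Function.update_self, hfix x hxA, hr]
      · rw [Function.update_of_ne (fun hc => hyx (Fin.ext hc))]
        exact hI.label y ⟨hy.1, hlt y hy.2 hyx⟩
  · replace hxA : x ∉ A := by simpa [hI.base.zero] using hxA
    have hf : (A.filter fun x => x.val < j + 1) = A.filter fun x => x.val < j := by
      ext y
      simp only [Finset.mem_filter]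
      exact ⟨fun h => ⟨h.1, hlt y h.2 fun hc => hxA (hc ▸ h.1)⟩, fun h => ⟨h.1, by omega⟩⟩
    rw [hf]
    exact ⟨by simp [h10], by simp [hone], hI.congr ((hI.base.setVar (by simp)).setVar le_rfl)
      (fun y hy => by simp) fun y hy => hI.label y ⟨hy.1, hlt y hy.2 fun hc => hxA (hc ▸ hy.1)⟩⟩

theorem Naming.rename_start
    (hI : Naming D A π l (A.filter fun x => x.val < D.k).card (fun x => x ∈ A ∧ x.val < D.k) s) :
    Naming D A π l A.card
      (fun x => x ∈ A ∨ ∃ (i : ℕ) (h : i < l.length), l.length ≤ i + 0 ∧ l[i] = x)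
      (s.setVar 10 0) := by
  have hf : (A.filter fun x => x.val < D.k) = A := Finset.filter_true_of_mem fun x _ => x.2
  rw [hf] at hI
  refine hI.congr (hI.base.setVar le_rfl) (fun y _ => by simp) fun x hx => hI.label x ?_
  rcases hx with hx | ⟨i, h, h1, -⟩
  · exact ⟨hx, x.2⟩
  · omega

/-- A removed vertex was merged into a remaining vertex or one that was removed later. Going through
the list backwards, the name of its target is already known, so one lookup per vertex suffices. -/
theorem Naming.rename_step {j : ℕ} (hW : 8 * D.size ≤ W) (hj : j < l.length)
    (hll : l.length ≤ D.k) (hπ : ∀ x, π x ∈ A)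
    (hI : Naming D A π l A.card
      (fun x => x ∈ A ∨ ∃ (i : ℕ) (h : i < l.length), l.length ≤ i + j ∧ l[i] = x) s)
    (h10 : s.var 10 = j) :
    wp W Prog.rename s fun s' => s'.var 10 = j ∧ s'.var 3 = 1 ∧
      Naming D A π l A.card
        (fun x => x ∈ A ∨ ∃ (i : ℕ) (h : i < l.length), l.length ≤ i + (j + 1) ∧ l[i] = x)
        (s'.setVar 10 (j + 1)) := by
  have hs : n + D.k + D.m = D.size := rfl
  have hone := hI.base.one
  have hlog := hI.base.log
  obtain ⟨p, hp⟩ : ∃ p, p = l.length - j - 1 := ⟨_, rfl⟩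
  have hpl : p < l.length := by omega
  obtain ⟨z, hz, hzπ, hz'⟩ := hI.par p hpl
  have hA : A.card ≤ D.k := (Finset.card_le_univ _).trans (by simp)
  have hr := rank_lt (hπ z)
  have hzl : s.arr 11 z = rank A (π z) := hI.label z <| by
    rcases hz' with h | ⟨i, h1, h2, h3⟩
    · exact Or.inl h
    · exact Or.inr ⟨i, h1, by omega, h3⟩
  refine wp_sub (v := l.length - j) (by simp [h10, hlog]) (by omega) ?_
  refine wp_sub (v := p) (by simp [hone, hp]) (by omega) ?_
  refine wp_load (v := l[p]) (by simp [hI.log p hpl]) (val_le hW _) ?_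
  refine wp_load (v := z) (by simp [hz]) (val_le hW _) ?_
  refine wp_load (v := rank A (π z)) (by simp [hzl]) (by omega) ?_
  refine wp_store (i := l[p]) (v := rank A (π z)) (by simp) (by simp) (by omega) ?_
  refine ⟨by simp [h10], by simp [hone], hI.congr (hI.base.congr fun y hy => ?_)
    (fun y hy => by simp [hy]) fun y hy => ?_⟩
  · simp [show ∀ i, 10 ≤ i → y ≠ i by omega]
  · simp only [State.setArr_arr, State.setVar_arr, if_true]
    by_cases hyp : y = l[p]
    · rw [hyp, Function.update_self, hzπ]
    · rw [Function.update_of_ne (fun hc => hyp (Fin.ext hc))]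
      refine hI.label y (hy.imp_right ?_)
      rintro ⟨i, h1, h2, rfl⟩
      refine ⟨i, h1, ?_, rfl⟩
      have : i ≠ p := fun hc => hyp (by simp [hc])
      omega

variable {k' : ℕ} {ν : Fin D.k → Fin k'} {c : ℕ} {es : List (Fin D.m)}

/-- All vertices have new names, given by `ν`, and the edges in `es` were written to the
output. -/
structure Emitted (D : Data n) (ν : Fin D.k → Fin k') (c : ℕ) (es : List (Fin D.m)) (s : State) :
    Prop where
  base : Base D c k' es.length s
  own : ∀ h, s.arr 3 (code h) = D.own h
  map : ∀ i : Fin n, s.arr 2 i = D.map i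
  label : ∀ x : Fin D.k, s.arr 11 x = ν x
  fst : ∀ (i : ℕ) (hi : i < es.length), s.arr 0 i = ν (D.fst es[i])
  snd : ∀ (i : ℕ) (hi : i < es.length), s.arr 1 i = ν (D.snd es[i])

/-- The edges below `j` that `ν` does not turn into loops were written to the output. -/
def EmitState (D : Data n) (ν : Fin D.k → Fin k') (c j : ℕ) (s : State) : Prop :=
  ∃ es : List (Fin D.m), es.Nodup ∧
    (∀ e, e ∈ es ↔ e.val < j ∧ ν (D.fst e) ≠ ν (D.snd e)) ∧ Emitted D ν c es s

theorem EmitState.step {j : ℕ} (hW : 8 * D.size ≤ W) (hk : k' ≤ D.k) (hj : j < D.m)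
    (hI : EmitState D ν c j s) (h10 : s.var 10 = j) :
    wp W Prog.emit s fun s' => s'.var 10 = j ∧ s'.var 3 = 1 ∧
      EmitState D ν c (j + 1) (s'.setVar 10 (j + 1)) := by
  obtain ⟨es, hnd, hmem, hI⟩ := hI
  set e : Fin D.m := ⟨j, hj⟩ with he
  have hs : n + D.k + D.m = D.size := rfl
  have hone := hI.base.one
  have hlt : ∀ e' : Fin D.m, e'.val < j + 1 ↔ e'.val < j ∨ e' = e := by
    intro e'
    rw [Fin.ext_iff, Nat.lt_succ_iff_lt_or_eq]
  have hν : ∀ x, (ν x : ℕ) ≤ W := by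
    intro x
    have := (ν x).2
    omega
  have hlen : es.length ≤ D.m := by simpa using hnd.length_le_card
  have o0 : s.arr 3 (j + j) = D.fst e := by
    have := hI.own (e, false)
    simpa [code, Data.own, he] using this
  have o1 : s.arr 3 (j + j + 1) = D.snd e := by
    have := hI.own (e, true)
    simpa [code, Data.own, he] using this
  refine wp_add (v := j + j) (by simp [h10]) (by omega) ?_
  refine wp_load (v := D.fst e) (by simp [o0]) (val_le hW _) ?_
  refine wp_load (v := ν (D.fst e)) (by simp [hI.label]) (hν _) ?_
  refine wp_add (v := j + j + 1) (by simp [hone]) (by omega) ?_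
  refine wp_load (v := D.snd e) (by simp [o1]) (val_le hW _) ?_
  refine wp_load (v := ν (D.snd e)) (by simp [hI.label]) (hν _) ?_
  refine wp_eq (fun h => ?_) (fun h => ?_)
  · replace h : ν (D.fst e) = ν (D.snd e) := by simpa [← Fin.ext_iff] using h
    refine ⟨by simp [h10], by simp [hone], es, hnd, fun e' => ?_, hI.base.congr fun y hy => ?_,
      hI.own, hI.map, hI.label, hI.fst, hI.snd⟩
    · rw [hmem, hlt]
      refine ⟨fun h => ⟨Or.inl h.1, h.2⟩, ?_⟩
      rintro ⟨h1 | rfl, h2⟩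
      · exact ⟨h1, h2⟩
      · exact absurd h h2
    · simp [show ∀ i, 10 ≤ i → y ≠ i by omega]
  · replace h : ν (D.fst e) ≠ ν (D.snd e) := by simpa [← Fin.ext_iff] using h
    have hel : e ∉ es := fun hc => by simpa [he] using ((hmem e).1 hc).1
    refine wp_store (i := es.length) (v := ν (D.fst e)) (by simp [hI.base.newm]) (by simp) (hν _) ?_
    refine wp_store (i := es.length) (v := ν (D.snd e)) (by simp [hI.base.newm]) (by simp) (hν _) ?_
    refine wp_add (v := es.length + 1) (by simp [hI.base.newm, hone]) (by omega) ?_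
    refine ⟨by simp [h10], by simp [hone], es ++ [e], ?_, fun e' => ?_, ?_, by simpa using hI.own,
      by simpa using hI.map, by simpa using hI.label, fun i hi => ?_, fun i hi => ?_⟩
    · rw [List.nodup_append]
      refine ⟨hnd, List.nodup_singleton _, fun a ha b hb hab => ?_⟩
      rw [List.mem_singleton] at hb
      exact hel (hb ▸ hab ▸ ha)
    · rw [List.mem_append, hmem, List.mem_singleton, hlt]
      constructor
      · rintro (h1 | rfl)
        · exact ⟨Or.inl h1.1, h1.2⟩
        · exact ⟨Or.inr rfl, h⟩
      · rintro ⟨h1 | h1, h2⟩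
        · exact Or.inl ⟨h1, h2⟩
        · exact Or.inr h1
    · have := hI.base
      constructor <;> simp
      exacts [this.k, this.m, this.n, this.one, this.two, this.four, this.zero, this.log, this.newk]
    · simp only [State.setArr_arr, State.setVar_arr]
      rw [List.length_append, List.length_singleton] at hi
      rcases Nat.lt_or_ge i es.length with h | h
      · simpa [Function.update_of_ne h.ne, List.getElem_append_left h] using hI.fst i h
      · obtain rfl : i = es.length := by omega
        simp
    · simp only [State.setArr_arr, State.setVar_arr]
      rw [List.length_append, List.length_singleton] at hi
      rcases Nat.lt_or_ge i es.length with h | h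
      · simpa [Function.update_of_ne h.ne, List.getElem_append_left h] using hI.snd i h
      · obtain rfl : i = es.length := by omega
        simp

/-- The list of edges, and the map on `{0, …, j - 1}`, were written to the output. -/
structure Placed (D : Data n) (ν : Fin D.k → Fin k') (c : ℕ) (es : List (Fin D.m)) (j : ℕ)
    (s : State) : Prop where
  base : Base D c k' es.length s
  label : ∀ x : Fin D.k, s.arr 11 x = ν x
  fst : ∀ (i : ℕ) (hi : i < es.length), s.arr 0 i = ν (D.fst es[i])
  snd : ∀ (i : ℕ) (hi : i < es.length), s.arr 1 i = ν (D.snd es[i])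
  map : ∀ v : Fin n, s.arr 2 v = if v.val < j then (ν (D.map v) : ℕ) else D.map v

theorem Emitted.placed (hI : Emitted D ν c es s) : Placed D ν c es 0 (s.setVar 10 0) :=
  ⟨hI.base.setVar le_rfl, hI.label, hI.fst, hI.snd, by simpa using hI.map⟩

/-- The map is overwritten in place, so the entries from `j` on still hold the old values. -/
theorem Placed.step {j : ℕ} (hW : 8 * D.size ≤ W) (hk : k' ≤ D.k) (hj : j < n)
    (hI : Placed D ν c es j s) (h10 : s.var 10 = j) :
    wp W Prog.place s fun s' => s'.var 10 = j ∧ s'.var 3 = 1 ∧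
      Placed D ν c es (j + 1) (s'.setVar 10 (j + 1)) := by
  set v : Fin n := ⟨j, hj⟩ with hv
  have hs : n + D.k + D.m = D.size := rfl
  have hone := hI.base.one
  have hmap : s.arr 2 j = D.map v := by
    have := hI.map v
    simpa [hv] using this
  have hν := (ν (D.map v)).2
  refine wp_load (v := D.map v) (by simp [h10, hmap]) (val_le hW _) ?_
  refine wp_load (v := ν (D.map v)) (by simp [hI.label]) (by omega) ?_
  refine wp_store (i := j) (v := ν (D.map v)) (by simp [h10]) (by simp) (by omega) ?_
  refine ⟨by simp [h10], by simp [hone], hI.base.congr fun y hy => ?_, by simpa using hI.label,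
    by simpa using hI.fst, by simpa using hI.snd, fun u => ?_⟩
  · simp [show ∀ i, 10 ≤ i → y ≠ i by omega]
  · simp only [State.setArr_arr, State.setVar_arr, if_true]
    by_cases hu : u = v
    · rw [hu, show (v : ℕ) = j from rfl, Function.update_self, if_pos (by omega)]
    · have : u.val ≠ j := fun hc => hu (Fin.ext hc)
      rw [Function.update_of_ne this, hI.map u]
      simp only [show u.val < j + 1 ↔ u.val < j by omega]

end Data
end CactusRep

/-! ### Assembling the program. -/

namespace CactusRep

open HalfEdge RAM

namespace Data

variable {n : ℕ} {D : Data n} {G : SimpleGraph (Fin n)} {W : ℕ} {s : State}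
  {μ : Fin D.m × Bool → Fin D.m × Bool} {A : Finset (Fin D.k)} {π : Fin D.k → Fin D.k}
  {l : List (Fin D.k)}

/-- The new name of a vertex. -/
def IsReduction.newName (hR : IsReduction D G μ A π) (x : Fin D.k) : Fin A.card :=
  ⟨rank A (π x), rank_lt (hR.mem x)⟩

theorem IsReduction.newName_eq_iff (hR : IsReduction D G μ A π) (x y : Fin D.k) :
    hR.newName x = hR.newName y ↔ π x = π y := by
  rw [newName, newName, Fin.mk.injEq]
  exact (rank_strictMonoOn A).injOn.eq_iff (hR.mem x) (hR.mem y)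

/-- The output of the program. -/
def quotient {k' : ℕ} (ν : Fin D.k → Fin k') (es : List (Fin D.m)) : Data n where
  k := k'
  m := es.length
  fst i := ν (D.fst es[i])
  snd i := ν (D.snd es[i])
  map v := ν (D.map v)

theorem IsReduction.isQuotient (hR : IsReduction D G μ A π) {es : List (Fin D.m)}
    (hnd : es.Nodup) (hmem : ∀ e, e ∈ es ↔ hR.newName (D.fst e) ≠ hR.newName (D.snd e)) :
    IsQuotient D (quotient hR.newName es) hR.newName where
  surj a := by
    obtain ⟨x, hx, hxa⟩ := exists_rank_eq A a.2
    exact ⟨x, Fin.ext ((congrArg (rank A) (hR.fix x hx)).trans hxa)⟩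
  exists_edges := by
    refine ⟨fun i => es[i], fun i j hij => Fin.ext ?_, fun e => ?_, fun _ => rfl, fun _ => rfl⟩
    · exact (List.Nodup.getElem_inj_iff hnd).1 hij
    · exact List.mem_iff_get.symm.trans (hmem e)
  map_eq _ := rfl

/-- A cactus representation as required is stored in `s`. -/
def Output (G : SimpleGraph (Fin n)) [DecidableRel G.Adj] (s : State) : Prop :=
  ∃ D' : Data n, D'.StoredIn s ∧ D'.Represents G (nontrivialMinCuts (Graph.ofSimpleGraph G)) ∧
    D'.k * G.minDegree < 30 * n

theorem Placed.output [DecidableRel G.Adj] (hn : 0 < n) (hI : LeafInv D G D.k μ A π) {c : ℕ}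
    {es : List (Fin D.m)} (hnd : es.Nodup)
    (hmem : ∀ e, e ∈ es ↔ hI.red.newName (D.fst e) ≠ hI.red.newName (D.snd e))
    (hW : 8 * D.size ≤ W) (hP : Placed D hI.red.newName c es n s) :
    wp W (after [.copy 0 8, .copy 1 9] .skip) s (Output G) := by
  have hs : n + D.k + D.m = D.size := rfl
  have hlen : es.length ≤ D.m := by simpa using hnd.length_le_card
  have hA : A.card ≤ D.k := (Finset.card_le_univ _).trans (by simp)
  have hQ := hI.red.isQuotient hnd hmem
  refine wp_copy hP.base.newk (by omega) ?_
  refine wp_copy (v := es.length) (by simp [hP.base.newm]) (by omega) ?_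
  refine ⟨quotient hI.red.newName es, ⟨?_, ?_, ?_, fun j => ?_, fun j => ?_, fun v => ?_⟩,
    hQ.represents hI.red hI.red.newName_eq_iff, hI.card_mul_lt hn⟩
  · simp [quotient]
  · simp [quotient]
  · simpa using hP.base.n
  · exact hP.fst j j.2
  · exact hP.snd j j.2
  · have := hP.map v
    rwa [if_pos v.2] at this

theorem toState_edgeInv (hW : 8 * D.size ≤ W) (hn : 0 < n) :
    wp W (after [.const 3 1, .const 4 2, .const 5 4] .skip) D.toState
      fun s => EdgeInv D 0 (s.setVar 10 0) := by
  have hs : n + D.k + D.m = D.size := rfl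
  refine wp_const (by omega) ?_
  refine wp_const (by omega) ?_
  refine wp_const (by omega) ?_
  refine ⟨⟨?_, ?_, ?_, ?_, ?_, ?_, ?_, ?_, ?_, ?_⟩, fun h hh => absurd hh (by simp),
    fun h hh => absurd hh (by simp), ⟨fun _ => [], by simp, by simp, fun x => ⟨?_, by simp⟩⟩,
    fun e => ?_, fun e => ?_, fun i => ?_, ?_, ?_⟩
  all_goals simp [toState]
  all_goals rfl

theorem main_ends [DecidableRel G.Adj] (hn : 0 < n) (hW : 8 * D.size ≤ W)
    (hD : D.Represents G (minCuts (Graph.ofSimpleGraph G))) :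
    Ends W Prog.main D.toState (1000 * D.size) (Output G) := by
  have hs : n + D.k + D.m = D.size := rfl
  -- A common bound for all loop bodies. With the two steps of loop overhead a loop takes at most
  -- `100 * D.size + 2` steps, and `n > 0` absorbs the two. Eight loops and the seven remaining
  -- steps stay below `1000 * D.size`.
  have c0 : cost Prog.edge ≤ 98 := by decide
  have c1 : cost Prog.count ≤ 98 := by decide
  have c2 : cost Prog.suppress ≤ 98 := by decide
  have c3 : cost Prog.leaf ≤ 98 := by decide
  have c4 : cost Prog.name ≤ 98 := by decide
  have c5 : cost Prog.rename ≤ 98 := by decide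
  have c6 : cost Prog.emit ≤ 98 := by decide
  have c7 : cost Prog.place ≤ 98 := by decide
  have bound : ∀ {N c : ℕ}, N ≤ D.size → c ≤ 98 → N * (c + 2) + 2 ≤ 102 * D.size := by
    intro N c hN hc
    have := Nat.mul_le_mul hN (Nat.add_le_add_right hc 2)
    omega
  refine Ends.mono (T := 4 + (102 * D.size + (102 * D.size + (102 * D.size + (102 * D.size +
    (102 * D.size + (102 * D.size + (102 * D.size + (102 * D.size + 3))))))))) ?_ (by omega)
    fun _ h => h
  refine (toState_edgeInv hW hn).ends.seq fun s hs₀ => ?_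
  refine ((Ends.forLoop (by omega) (fun j s h => h.base.m) hs₀
    fun j s hj hI h10 => hI.step hW hj h10).mono (bound (by omega) c0) fun _ h => h).seq
    fun s hs₁ => ?_
  refine ((Ends.forLoop (by omega) (fun j s h => h.base.n) hs₁.countInv
    fun j s hj hI h10 => hI.step hW hj h10).mono (bound (by omega) c1) fun _ h => h).seq
    fun s hs₂ => ?_
  have hinit : SuppressState D G 0 (s.setVar 10 0) :=
    ⟨_, _, _, _, SuppressInv.init hD, hs₂.stored.1.congr
      (fun y hy => by simp [show y ≠ 10 by omega]) (by simp), hs₂.stored.2⟩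
  refine ((Ends.forLoop (N := D.k) (by omega) (fun j s ⟨_, _, _, _, _, h, _⟩ => h.base.k) hinit
    fun j s hj hI h10 => hI.step hW hj h10).mono (bound (by omega) c2) fun _ h => h).seq
    fun s hs₃ => ?_
  refine ((Ends.forLoop (N := D.k) (by omega) (fun j s ⟨_, _, _, _, _, h, _⟩ => h.base.k)
    hs₃.leafState fun j s hj hI h10 => hI.step hW hj h10).mono (bound (by omega) c3)
    fun _ h => h).seq fun s hs₄ => ?_
  obtain ⟨μ, A, π, l, hI, hS, -⟩ := hs₄
  have hA : A.card ≤ D.k := (Finset.card_le_univ _).trans (by simp)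
  have hl := hS.length_le
  refine ((Ends.forLoop (N := D.k) (Inv := fun j => Naming D A π l
    (A.filter fun x => x.val < j).card fun x => x ∈ A ∧ x.val < j) (by omega)
    (fun j s h => h.base.k) hS.naming
    fun j s hj h h10 => h.name_step hW hI.red.fix hj h10).mono (bound (by omega) c4)
    fun _ h => h).seq fun s hs₅ => ?_
  refine ((Ends.forLoop (N := l.length) (Inv := fun j => Naming D A π l A.card
    fun x => x ∈ A ∨ ∃ (i : ℕ) (h : i < l.length), l.length ≤ i + j ∧ l[i] = x) (by omega)
    (fun j s h => h.base.log) hs₅.rename_start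
    fun j s hj h h10 => h.rename_step hW hj hl hI.red.mem h10).mono (bound (by omega) c5)
    fun _ h => h).seq fun s hs₆ => ?_
  have hemit : EmitState D hI.red.newName l.length 0 (s.setVar 10 0) := by
    refine ⟨[], List.nodup_nil, by simp, hs₆.base.setVar le_rfl, hs₆.own, hs₆.map,
      fun x => hs₆.label x ?_, by simp, by simp⟩
    by_cases hx : x ∈ A
    · exact Or.inl hx
    · obtain ⟨i, hi, h⟩ := List.mem_iff_getElem.1 ((hS.mem x).2 hx)
      exact Or.inr ⟨i, hi, by omega, h⟩
  refine ((Ends.forLoop (N := D.m) (by omega) (fun j s ⟨_, _, _, h⟩ => h.base.m) hemit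
    fun j s hj h h10 => h.step hW hA hj h10).mono (bound (by omega) c6) fun _ h => h).seq
    fun s hs₇ => ?_
  obtain ⟨es, hnd, hmem, hE⟩ := hs₇
  refine ((Ends.forLoop (N := n) (Inv := Placed D hI.red.newName l.length es) (by omega)
    (fun j s h => h.base.n) hE.placed
    fun j s hj h h10 => h.step hW hA hj h10).mono (bound (by omega) c7) fun _ h => h).seq
    fun s hs₈ => ?_
  exact (hs₈.output hn hI hnd (fun e => by simp [hmem]) hW).ends

end Data

end CactusRep

theorem theorem1 :
    ∃ (p : RAM.Program) (c : ℕ),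
      ∀ (n : ℕ) (_ : 0 < n) (G : SimpleGraph (Fin n)) [DecidableRel G.Adj]
        (D : CactusRep.Data n),
        D.Represents G (CactusRep.minCuts (Graph.ofSimpleGraph G)) →
          ∃ (D' : CactusRep.Data n) (t : ℕ) (s : RAM.State),
            RAM.Exec (c * D.size) p D.toState t s ∧ t ≤ c * D.size ∧ D'.StoredIn s ∧
              D'.Represents G (CactusRep.nontrivialMinCuts (Graph.ofSimpleGraph G)) ∧
                (0 < G.minDegree → (D'.k : ℝ) < 30 * n / G.minDegree) := by
  -- The same constant bounds the steps and the stored values; for the values `8 * D.size` would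
  -- already do.
  refine ⟨CactusRep.Prog.main, 1000, fun n hn G _ D hD => ?_⟩
  obtain ⟨t, s, h1, h2, D', h3, h4, h5⟩ :=
    CactusRep.Data.main_ends (W := 1000 * D.size) hn (by omega) hD
  refine ⟨D', t, s, h1, h2, h3, h4, fun hδ => ?_⟩
  rw [lt_div_iff₀ (by exact_mod_cast hδ)]
  exact_mod_cast h5
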